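/- Logarithms are to base 2, and algorithms are randomized programs over finitely many stacks of bits (equivalently, multi-tape machines); each elementary operation, coin flip and oracle call costs one step, and running times hold for all outcomes of the coins and of the oracle answers. \textsc{Linear-2-RL} with feature dimension $d$: the algorithm has oracle access to a Markov decision process with two actions, deterministic transitions $P(s,a)$, random rewards $R(s,a)$ in $[0,1]$ and an end state $\bot$ which every policy reaches from every state within $H = O(d)$ steps, and to features $\psi(s),\psi(s,a)\in\mathbb{Q}^d$ such that, for some $\theta\in\mathbb{R}^d$, the optimal value functions satisfy $V^*(s)=\langle\theta,\psi(s)\rangle$ and $Q^*(s,a)=\langle\theta,\psi(s,a)\rangle$ for all $s,a$. The algorithm is given $d$, $H$ and the starting state $s_0$. It may query, for any state $s$ and action $a$, a fresh sample of $R(s,a)$, the state $P(s,a)$, and the features $\psi(s)$ and $\psi(s,a)$; states are bit strings, rewards are rational, and all inputs and outputs of the oracle have size polynomial in $d$. It has to output (as the sequence of actions taken from $s_0$ until $\bot$) a policy $\pi$ with $V^\pi(s_0) > V^*(s_0) - 1/4$. It is solved in time $t(d)$ with error probability $p$ if, for all choices of the constants hidden in $H = O(d)$ and in "polynomial", some algorithm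 runs in time $O(t(d))$ and outputs such a policy with probability at least $1-p$ on every instance. \textsc{Unique-3-SAT} on $v$ variables: given a 3-CNF formula with $v$ variables and $O(v)$ clauses that has at most one satisfying assignment, decide whether it is satisfiable. It is solved in time $t(v)$ with error probability $p$ if some algorithm runs in time $O(t(v))$, answers YES with probability at least $1-p$ on satisfiable formulas, and answers NO with probability $1$ on unsatisfiable ones. \textbf{Proposition.} If \textsc{Linear-2-RL} with feature dimension $d$ can be solved in time $d^{\log d/(72\log\log d)}$ with error probability $1/10$, then there is a constant $C$ such that \textsc{Unique-3-SAT} on $v$ variables can be solved in time $2^{C v/\log v}$ with error probability $1/8$. -/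

import Mathlib

open scoped ENNReal

/-! # Machine model

Randomized oracle programs over finitely many stacks of bits (each program mentions only finitely
many of the registers; a stack machine with finite control is a multi-tape Turing machine up to
constant factors).  Every elementary operation, every test, every coin flip and every oracle call
costs one step. -/

namespace Machine

/-- Bit strings. -/
abbrev Str := List Bool

/-- Programs.  Registers are stacks of bits; the head of the list is the top of the stack. -/
inductive Prog where
  /-- push a bit onto register `i` -/
  | push (i : ℕ) (b : Bool)
  /-- pop the top bit of register `i` (no effect on an empty register) -/
  | pop (i : ℕ)
  /-- push a uniformly random bit onto register `i` -/
  | flip (i : ℕ)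
  /-- send the content of register `i` to the oracle and overwrite register `j` by its answer -/
  | ask (i j : ℕ)
  /-- sequential composition -/
  | seq (p q : Prog)
  /-- three-way branch: register `i` is empty / has top bit `false` / has top bit `true` -/
  | branch (i : ℕ) (p q r : Prog)
  /-- while register `i` is nonempty, execute `p` -/
  | loop (i : ℕ) (p : Prog)

/-- Contents of the registers. -/
abbrev Store := ℕ → Str

/-- A configuration: what is left to execute (the control state) and the registers. -/
structure Config where
  todo : List Prog
  regs : Store

/-- A (possibly randomized) oracle; the answers to different calls are independent. -/
abbrev Oracle := Str → PMF Str

/-- The oracle that gives no information: machines without an oracle are run with it. -/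
noncomputable def noOracle : Oracle := fun _ => PMF.pure []

/-- One step of computation.  A configuration with nothing left to execute has halted. -/
noncomputable def step (O : Oracle) : Config → PMF Config
  | ⟨[], σ⟩ => PMF.pure ⟨[], σ⟩
  | ⟨.push i b :: k, σ⟩ => PMF.pure ⟨k, Function.update σ i (b :: σ i)⟩
  | ⟨.pop i :: k, σ⟩ => PMF.pure ⟨k, Function.update σ i (σ i).tail⟩
  | ⟨.flip i :: k, σ⟩ =>
      (PMF.uniformOfFintype Bool).map fun b => ⟨k, Function.update σ i (b :: σ i)⟩
  | ⟨.ask i j :: k, σ⟩ => (O (σ i)).map fun y => ⟨k, Function.update σ j y⟩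
  | ⟨.seq p q :: k, σ⟩ => PMF.pure ⟨p :: q :: k, σ⟩
  | ⟨.branch i p q r :: k, σ⟩ =>
      match σ i with
      | [] => PMF.pure ⟨p :: k, σ⟩
      | false :: _ => PMF.pure ⟨q :: k, σ⟩
      | true :: _ => PMF.pure ⟨r :: k, σ⟩
  | ⟨.loop i p :: k, σ⟩ =>
      match σ i with
      | [] => PMF.pure ⟨k, σ⟩
      | _ :: _ => PMF.pure ⟨p :: .loop i p :: k, σ⟩

/-- The distribution of the configuration after `n` steps. -/
noncomputable def run (O : Oracle) : ℕ → Config → PMF Config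
  | 0, c => PMF.pure c
  | n + 1, c => (step O c).bind (run O n)

/-- The input is in register `0`, all other registers are empty. -/
def initial (p : Prog) (x : Str) : Config := ⟨[p], Function.update (fun _ => []) 0 x⟩

/-- Whatever the coins and the oracle answers are, `p` halts on `x` after at most `T` steps. -/
def HaltsWithin (O : Oracle) (p : Prog) (x : Str) (T : ℕ) : Prop :=
  ∀ c ∈ (run O T (initial p x)).support, c.todo = []

/-- The distribution of the output (the content of register `0` after `T` steps). -/
noncomputable def output (O : Oracle) (p : Prog) (x : Str) (T : ℕ) : PMF Str :=
  (run O T (initial p x)).map fun c => c.regs 0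

/-- The probability that the output has the property `A`. -/
noncomputable def outputProb (O : Oracle) (p : Prog) (x : Str) (T : ℕ) (A : Str → Prop) : ℝ≥0∞ :=
  (output O p x T).toOuterMeasure {y | A y}

/-- Unary code `1ⁿ0` of a natural number. -/
def encUnary (n : ℕ) : Str := List.replicate n true ++ [false]

/-- Self-delimiting binary code of a natural number: every binary digit (least significant first)
is preceded by `1`, and a `0` closes the code. -/
def encNat (n : ℕ) : Str := (n.bits.flatMap fun b => [true, b]) ++ [false]

/-- Code of a rational number in lowest terms: sign, numerator, denominator in binary. -/
def encRat (q : ℚ) : Str := decide (q < 0) :: (encNat q.num.natAbs ++ encNat q.den)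

end Machine

/-! # Unique-3-SAT -/

namespace ThreeSat

open Machine

/-- A literal: a variable and the truth value that makes the literal true. -/
abbrev Literal (v : ℕ) := Fin v × Bool

/-- A clause: a disjunction of three literals (not necessarily distinct). -/
abbrev Clause (v : ℕ) := Literal v × Literal v × Literal v

/-- A 3-CNF formula in `v` variables: a conjunction of clauses. -/
abbrev CNF (v : ℕ) := List (Clause v)

/-- The assignment `w` satisfies the formula `φ`. -/
def Satisfies {v : ℕ} (w : Fin v → Bool) (φ : CNF v) : Prop :=
  ∀ C ∈ φ, w C.1.1 = C.1.2 ∨ w C.2.1.1 = C.2.1.2 ∨ w C.2.2.1 = C.2.2.2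

def Satisfiable {v : ℕ} (φ : CNF v) : Prop := ∃ w, Satisfies w φ

/-- The promise: there is at most one satisfying assignment. -/
def UniquePromise {v : ℕ} (φ : CNF v) : Prop :=
  ∀ w w', Satisfies w φ → Satisfies w' φ → w = w'

def encLiteral {v : ℕ} (l : Literal v) : Str := l.2 :: encUnary l.1

def encClause {v : ℕ} (C : Clause v) : Str :=
  encLiteral C.1 ++ encLiteral C.2.1 ++ encLiteral C.2.2

/-- Code of a formula: the number of variables, then the clauses, each of them preceded by `1`,
then a `0`. -/
def encCNF {v : ℕ} (φ : CNF v) : Str :=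
  encUnary v ++ (φ.flatMap fun C => true :: encClause C) ++ [false]

/-- `Unique-3-SAT` on `v` variables and `O(v)` clauses can be solved in time `O(t v)` with (one-sided)
error probability `ε`: some program, without oracle, on all formulas satisfying the promise
with `v` variables and at most `c * v` clauses, halts within `T v = O(t v)` steps (for every `c`),
answers YES with probability at least `1 - ε` if the formula is satisfiable,
and answers NO with probability `1` if it is not. -/
def UniqueThreeSatSolvableInTime (t : ℕ → ℝ) (ε : ℝ≥0∞) : Prop :=
  ∃ p : Prog, ∀ c : ℕ, ∃ T : ℕ → ℕ,
    (fun v => (T v : ℝ)) =O[Filter.atTop] t ∧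
    ∀ (v : ℕ) (φ : CNF v), φ.length ≤ c * v → UniquePromise φ →
      HaltsWithin noOracle p (encCNF φ) (T v) ∧
      (Satisfiable φ → 1 - ε ≤ outputProb noOracle p (encCNF φ) (T v) (· = [true])) ∧
      (¬ Satisfiable φ → outputProb noOracle p (encCNF φ) (T v) (· = [false]) = 1)

end ThreeSat

/-! # Linear-2-RL -/

namespace RL

open Machine

/-- A Markov decision process with deterministic transitions, two actions, stochastic rewards in
`[0, 1]` and bounded horizon.  The end state `⊥` is `none`.  As states and rewards are
communicated to algorithms, states have bit string codes and the sampled rewards are rational. -/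
structure MDP where
  State : Type
  code : State → Str
  code_injective : Function.Injective code
  /-- the starting state -/
  start : State
  /-- the transition function -/
  next : State → Bool → Option State
  /-- the distribution of the reward -/
  reward : State → Bool → PMF ℚ
  reward_mem : ∀ s a, ∀ q ∈ (reward s a).support, 0 ≤ q ∧ q ≤ 1
  horizon : ℕ
  /-- every policy reaches the end state after at most `horizon` steps -/
  horizon_spec : ∀ (π : State → Bool) (s : State),
    (fun o : Option State => o.bind fun s' => next s' (π s'))^[horizon] (some s) = none

namespace MDP

variable (M : MDP)

/-- Deterministic stationary policies. -/
abbrev Policy := M.State → Bool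

/-- The state at time `t`, for the policy `π` started in `s`. -/
def stateAt (π : M.Policy) (s : M.State) (t : ℕ) : Option M.State :=
  (fun o : Option M.State => o.bind fun s' => M.next s' (π s'))^[t] (some s)

/-- The expected reward for action `a` in state `s`. -/
noncomputable def meanReward (s : M.State) (a : Bool) : ℝ :=
  ∑' q : ℚ, (M.reward s a q).toReal * (q : ℝ)

/-- The value `V^π(s)`: the expected total reward collected until the end state is reached.  As
the transitions are deterministic, it is the sum of the expected rewards along the trajectory. -/
noncomputable def V (π : M.Policy) (s : M.State) : ℝ :=
  ∑ t ∈ Finset.range M.horizon, (M.stateAt π s t).elim 0 fun s' => M.meanReward s' (π s')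

/-- The value `Q^π(s, a)`: take action `a` first and follow `π` afterwards. -/
noncomputable def Q (π : M.Policy) (s : M.State) (a : Bool) : ℝ :=
  M.meanReward s a + (M.next s a).elim 0 (M.V π)

/-- The optimal value function `V^*`. -/
noncomputable def VStar (s : M.State) : ℝ := ⨆ π : M.Policy, M.V π s

/-- The optimal action-value function `Q^*`. -/
noncomputable def QStar (s : M.State) (a : Bool) : ℝ := ⨆ π : M.Policy, M.Q π s a

/-- `π`, from the given state on, takes the actions in the list until the end state is reached (and
the list is long enough for that; actions after the end state has been reached are ignored). -/
def Executes (π : M.Policy) : Option M.State → List Bool → Prop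
  | none, _ => True
  | some _, [] => False
  | some s, a :: as => π s = a ∧ Executes π (M.next s a) as

/-- The sequence of actions describes a good policy: one with `V^π > V^* - 1/4` at the start. -/
def IsGood (as : List Bool) : Prop :=
  ∃ π : M.Policy, M.Executes π (some M.start) as ∧ M.VStar M.start - 1 / 4 < M.V π M.start

/-- A `d`-dimensional feature map on states and on state-action pairs. -/
structure Features (d : ℕ) where
  onState : M.State → Fin d → ℚ
  onPair : M.State → Bool → Fin d → ℚ

variable {M}

/-- `V^*` and `Q^*` are linear in the features, with a common coefficient vector. -/
def Features.Linear {d : ℕ} (ψ : M.Features d) : Prop :=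
  ∃ θ : Fin d → ℝ,
    (∀ s, M.VStar s = ∑ i, θ i * (ψ.onState s i : ℝ)) ∧
    (∀ s a, M.QStar s a = ∑ i, θ i * (ψ.onPair s a i : ℝ))

variable (M)

open Classical in
/-- The state with the given code, if there is one. -/
noncomputable def decode (x : Str) : Option M.State :=
  if h : ∃ s, M.code s = x then some h.choose else none

/-- Code of a successor state: `0` for the end state. -/
def encNext : Option M.State → Str
  | none => [false]
  | some s => true :: M.code s

/-- Code of a vector of rationals. -/
def encVector {d : ℕ} (x : Fin d → ℚ) : Str := (List.ofFn fun i => encRat (x i)).flatten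

/-- The access to the MDP and its features.  The two leading bits of a query select the reward
function, the transition function, the features of a state, or the features of a
state-action pair; then come the action (if needed) and the code of the state.  A reward query is
answered by a fresh sample.  Malformed queries are answered by the empty string. -/
noncomputable def oracle {d : ℕ} (ψ : M.Features d) : Oracle
  | false :: false :: a :: x =>
      (M.decode x).elim (PMF.pure []) fun s => (M.reward s a).map encRat
  | false :: true :: a :: x => (M.decode x).elim (PMF.pure []) fun s =>
      PMF.pure (M.encNext (M.next s a))
  | true :: false :: x => (M.decode x).elim (PMF.pure []) fun s =>
      PMF.pure (encVector (ψ.onState s))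
  | true :: true :: a :: x => (M.decode x).elim (PMF.pure []) fun s =>
      PMF.pure (encVector (ψ.onPair s a))
  | _ => PMF.pure []

/-- The instances of `Linear-2-RL` with feature dimension `d`, where `κ` is the constant hidden in
"horizon `O(d)`" and "inputs and outputs of the oracle of size polynomial in `d`". -/
structure IsInstance (κ d : ℕ) (ψ : M.Features d) : Prop where
  linear : ψ.Linear
  horizon_le : M.horizon ≤ κ * d
  code_le : ∀ s, (M.code s).length ≤ κ * d ^ κ
  answer_le : ∀ x, ∀ y ∈ (M.oracle ψ x).support, y.length ≤ κ * d ^ κ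

/-- The input of the algorithm besides the oracle: feature dimension, horizon, starting state. -/
def input (d : ℕ) : Str := encUnary d ++ encUnary M.horizon ++ M.code M.start

end MDP

/-- `Linear-2-RL` with feature dimension `d` can be solved in time `O(t d)` with error probability
`ε`: for all choices of the constant `κ`, some oracle program, on all instances of feature
dimension `d`, halts within `T d = O(t d)` steps and outputs, with probability at least
`1 - ε`, a good policy (as a sequence of actions). -/
def LinearTwoRLSolvableInTime (t : ℕ → ℝ) (ε : ℝ≥0∞) : Prop :=
  ∀ κ : ℕ, ∃ p : Prog, ∃ T : ℕ → ℕ,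
    (fun d => (T d : ℝ)) =O[Filter.atTop] t ∧
    ∀ (d : ℕ) (M : MDP) (ψ : M.Features d), M.IsInstance κ d ψ →
      HaltsWithin (M.oracle ψ) p (M.input d) (T d) ∧
      1 - ε ≤ outputProb (M.oracle ψ) p (M.input d) (T d) M.IsGood

end RL

/-! A formula `φ` becomes a decision process that performs a local search. A state consists of an
assignment `w` of `V` bits, a counter of `B` bits for the flips made, and a phase bit. As long as
`w` falsifies a clause and the counter is not full, the actions flip one of the three variables of
the first falsified clause; three choices take two binary decisions, hence the phase.

Fix a satisfying assignment `w*`. In a falsified clause at least one variable is set differently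
from `w*`, so some choice brings `w` closer to `w*`. Therefore the cost "flips made plus Hamming
distance to `w*`", increased by 2 in the second phase if both remaining variables already agree with
`w*`, never decreases along an action and is preserved by a suitable one (`SearchState.cost_next`).
A reward is paid only on leaving the process; its mean is `((2^B + V + 2 - cost) / (2^B + V +
3))^r`. By `MDP.exists_optimal` this expression is then the optimal value of every state. The cost
is a quadratic polynomial in the bits of a vector that is computable from `φ` without knowing `w*`;
only its coefficients depend on `w*`. So the value is linear in the `2r`-th tensor power of that
vector (`SearchState.tensorLinear_value`), of dimension `d = (2 + B + 3V)^(2r)`.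

Apart from the rewards, the oracle is computable in time polynomial in `d` and the size of `φ`. In a
state whose time is over the mean reward is at most `ε = ((V + 3) / 2^B)^r`, and before the end
there is none. So the given algorithm can be run with all reward queries answered by 0: each answer
is wrong with probability at most `ε`, unless the query mentions a satisfying assignment, and then
the formula is solved (`Simulation.haltProb_le`). A good policy must end in a satisfying assignment,
as the start has value at least 3/4 and running out of time gives at most 1/4
(`formulaMDP.firstFalse_of_isGood`). The answer YES is given only after an assignment has been
checked, so it is never wrong.

The parameters are `r ≈ V^(1/3)` and `B = k r`, where `k ≈ log V`. Then `2^B ≤ d` keeps the horizon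
linear in `d`; the algorithm makes at most about `2^(r² k / 3)` steps, while `ε` is about `2^(-r²
k)`, so that all wrong answers together contribute at most 1/40 and the error is at most `1/10 +
1/40 = 1/8`. Polynomials in the running time are `2^O(r² k²)`, and `r² k³ = V^(2/3) (log V)^O(1)` is
below any constant fraction of `V`, which leaves `2^(v / log v)`. Dummy variables (`V = v + v₀`)
make all asymptotic inequalities on the parameters valid for every formula.

The machine side rests on two tools: `Comp`, a calculus of functions computable in polynomial time
that is closed under composition, branching and bounded loops, and `Simulation`, which replaces
oracle calls in a program by subprograms. -/

namespace Machine

/-! ## Deterministic execution -/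

theorem run_succ_of_step {O : Oracle} {c c' : Config} (h : step O c = PMF.pure c') (N : ℕ) :
    run O (N + 1) c = run O N c' := by
  simp [run, h, PMF.pure_bind]

/-- Started on `σ`, the program `p` makes exactly `t` deterministic steps, none of them an oracle
call, and ends with the registers `σ'`. -/
def Runs (p : Prog) (σ σ' : Store) (t : ℕ) : Prop :=
  ∀ (k : List Prog) (N : ℕ), run noOracle (t + N) ⟨p :: k, σ⟩ = run noOracle N ⟨k, σ'⟩

theorem Runs.push (i : ℕ) (b : Bool) (σ : Store) :
    Runs (.push i b) σ (Function.update σ i (b :: σ i)) 1 := fun k N => by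
  rw [add_comm]; exact run_succ_of_step rfl N

theorem Runs.pop (i : ℕ) (σ : Store) :
    Runs (.pop i) σ (Function.update σ i (σ i).tail) 1 := fun k N => by
  rw [add_comm]; exact run_succ_of_step rfl N

theorem Runs.seq {p q : Prog} {σ σ₁ σ₂ : Store} {t₁ t₂ : ℕ} (hp : Runs p σ σ₁ t₁)
    (hq : Runs q σ₁ σ₂ t₂) : Runs (.seq p q) σ σ₂ (t₁ + t₂ + 1) := fun k N => by
  rw [show t₁ + t₂ + 1 + N = (t₁ + (t₂ + N)) + 1 by omega,
    run_succ_of_step (c' := ⟨p :: q :: k, σ⟩) rfl, hp, hq]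

theorem Runs.branch_nil {i : ℕ} {p q r : Prog} {σ σ' : Store} {t : ℕ} (h : σ i = [])
    (hp : Runs p σ σ' t) : Runs (.branch i p q r) σ σ' (t + 1) := fun k N => by
  rw [show t + 1 + N = (t + N) + 1 by omega,
    run_succ_of_step (c' := ⟨p :: k, σ⟩) (by simp [step, h]), hp]

theorem Runs.branch_false {i : ℕ} {p q r : Prog} {σ σ' : Store} {t : ℕ} {l : Str}
    (h : σ i = false :: l) (hp : Runs q σ σ' t) :
    Runs (.branch i p q r) σ σ' (t + 1) := fun k N => by
  rw [show t + 1 + N = (t + N) + 1 by omega,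
    run_succ_of_step (c' := ⟨q :: k, σ⟩) (by simp [step, h]), hp]

theorem Runs.branch_true {i : ℕ} {p q r : Prog} {σ σ' : Store} {t : ℕ} {l : Str}
    (h : σ i = true :: l) (hp : Runs r σ σ' t) :
    Runs (.branch i p q r) σ σ' (t + 1) := fun k N => by
  rw [show t + 1 + N = (t + N) + 1 by omega,
    run_succ_of_step (c' := ⟨r :: k, σ⟩) (by simp [step, h]), hp]

theorem Runs.loop_nil {i : ℕ} {p : Prog} {σ : Store} (h : σ i = []) :
    Runs (.loop i p) σ σ 1 := fun k N => by
  rw [add_comm, run_succ_of_step (c' := ⟨k, σ⟩) (by simp [step, h])]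

theorem Runs.loop_cons {i : ℕ} {p : Prog} {σ σ₁ σ₂ : Store} {t₁ t₂ : ℕ} {a : Bool} {l : Str}
    (h : σ i = a :: l) (hp : Runs p σ σ₁ t₁) (hl : Runs (.loop i p) σ₁ σ₂ t₂) :
    Runs (.loop i p) σ σ₂ (t₁ + t₂ + 1) := fun k N => by
  rw [show t₁ + t₂ + 1 + N = (t₁ + (t₂ + N)) + 1 by omega,
    run_succ_of_step (c' := ⟨p :: .loop i p :: k, σ⟩) (by simp [step, h]), hp, hl]

theorem Runs.cast {p : Prog} {σ σ' σ'' : Store} {t t' : ℕ} (h : Runs p σ σ' t) (hσ : σ' = σ'')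
    (ht : t = t') : Runs p σ σ'' t' := hσ ▸ ht ▸ h

/-- Empty register `i`. -/
def Prog.clear (i : ℕ) : Prog := .loop i (.pop i)

theorem Runs.clear (i : ℕ) (σ : Store) :
    Runs (.clear i) σ (Function.update σ i []) (2 * (σ i).length + 1) := by
  induction hl : σ i generalizing σ with
  | nil => exact (Runs.loop_nil hl).cast (by rw [← hl, Function.update_eq_self]) rfl
  | cons a l ih =>
    have := ih (Function.update σ i l) (by simp)
    refine (Runs.loop_cons hl (Runs.pop i σ) (by simpa [hl, Prog.clear] using this)).cast rfl ?_
    simp only [List.length_cons]; ring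

/-- Do nothing. -/
def Prog.skip (i : ℕ) : Prog := .seq (.push i false) (.pop i)

theorem Runs.skip (i : ℕ) (σ : Store) : Runs (.skip i) σ σ 3 :=
  ((Runs.push i false σ).seq (Runs.pop i _)).cast (by simp) rfl

/-- Empty the registers `b, …, b + m - 1`. -/
def Prog.clearFrom (b : ℕ) : ℕ → Prog
  | 0 => .skip b
  | m + 1 => .seq (.clearFrom b m) (.clear (b + m))

theorem Runs.clearFrom (b m : ℕ) (σ : Store) :
    Runs (.clearFrom b m) σ (fun i => if b ≤ i ∧ i < b + m then [] else σ i)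
      (∑ i ∈ Finset.range m, (2 * (σ (b + i)).length + 2) + 3) := by
  induction m with
  | zero =>
    refine (Runs.skip b σ).cast ?_ (by simp)
    funext i; rw [if_neg (by omega)]
  | succ m ih =>
    refine (ih.seq (Runs.clear (b + m) _)).cast ?_ ?_
    · funext i
      simp only [Function.update_apply]
      split_ifs <;> first | rfl | omega
    · simp [Finset.sum_range_succ]; ring

/-- Reverse the content of register `i` onto register `j`. -/
def Prog.move (i j : ℕ) : Prog :=
  .loop i (.branch i (.pop i) (.seq (.pop i) (.push j false)) (.seq (.pop i) (.push j true)))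

theorem Runs.move {i j : ℕ} (hij : i ≠ j) (σ : Store) :
    Runs (.move i j) σ (Function.update (Function.update σ i []) j ((σ i).reverse ++ σ j))
      (5 * (σ i).length + 1) := by
  induction hl : σ i generalizing σ with
  | nil =>
    refine (Runs.loop_nil hl).cast ?_ rfl
    rw [← hl, Function.update_eq_self]; simp [hl]
  | cons a l ih =>
    have h1 := ih (Function.update (Function.update σ i l) j (a :: σ j)) (by simp [hij])
    have h2 : Runs (.branch i (.pop i) (.seq (.pop i) (.push j false))
        (.seq (.pop i) (.push j true))) σ
        (Function.update (Function.update σ i l) j (a :: σ j)) 4 := by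
      have : ∀ c, Runs (.seq (.pop i) (.push j c)) σ
          (Function.update (Function.update σ i l) j (c :: σ j)) 3 := fun c =>
        ((Runs.pop i σ).seq (Runs.push j c _)).cast (by simp [hl, hij.symm]) rfl
      cases a
      · exact Runs.branch_false hl (this false)
      · exact Runs.branch_true hl (this true)
    refine (Runs.loop_cons hl h2 h1).cast ?_ ?_
    · funext x
      simp only [Function.update_apply, hij.symm]
      split_ifs <;> simp_all
    · simp only [List.length_cons]; ring

/-- Reverse the content of register `i` onto both registers `j` and `k`. -/
def Prog.moveTwice (i j k : ℕ) : Prog :=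
  .loop i (.branch i (.pop i) (.seq (.pop i) (.seq (.push j false) (.push k false)))
    (.seq (.pop i) (.seq (.push j true) (.push k true))))

theorem Runs.moveTwice {i j k : ℕ} (hij : i ≠ j) (hik : i ≠ k) (hjk : j ≠ k) (σ : Store) :
    Runs (.moveTwice i j k) σ (Function.update (Function.update (Function.update σ i []) j
      ((σ i).reverse ++ σ j)) k ((σ i).reverse ++ σ k)) (7 * (σ i).length + 1) := by
  induction hl : σ i generalizing σ with
  | nil =>
    refine (Runs.loop_nil hl).cast ?_ rfl
    rw [← hl, Function.update_eq_self]; simp [hl]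
  | cons a l ih =>
    have h1 := ih (Function.update (Function.update (Function.update σ i l) j (a :: σ j)) k
      (a :: σ k)) (by simp [hij, hik])
    have h2 : Runs (.branch i (.pop i) (.seq (.pop i) (.seq (.push j false) (.push k false)))
        (.seq (.pop i) (.seq (.push j true) (.push k true)))) σ
        (Function.update (Function.update (Function.update σ i l) j (a :: σ j)) k
          (a :: σ k)) 6 := by
      have : ∀ c, Runs (.seq (.pop i) (.seq (.push j c) (.push k c))) σ
          (Function.update (Function.update (Function.update σ i l) j (c :: σ j)) k
          (c :: σ k)) 5 := fun c =>
        ((Runs.pop i σ).seq ((Runs.push j c _).seq (Runs.push k c _))).cast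
          (by simp [hl, hij.symm, hik.symm, hjk.symm]) rfl
      cases a
      · exact Runs.branch_false hl (this false)
      · exact Runs.branch_true hl (this true)
    refine (Runs.loop_cons hl h2 h1).cast ?_ ?_
    · funext x
      simp only [Function.update_apply, hij.symm]
      split_ifs <;> simp_all
    · simp only [List.length_cons]; ring

/-! ## Polynomial bounds -/

/-- `τ` is bounded by a polynomial in `S`. -/
def Bd {X : Type} (S τ : X → ℕ) : Prop := ∃ k, ∀ x, τ x ≤ (S x + 2) ^ k

namespace Bd

variable {X Y : Type} {S τ τ' : X → ℕ}

theorem mono (h : Bd S τ) (h' : ∀ x, τ' x ≤ τ x) : Bd S τ' := by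
  obtain ⟨k, hk⟩ := h
  exact ⟨k, fun x => (h' x).trans (hk x)⟩

theorem const (c : ℕ) : Bd S (fun _ => c) :=
  ⟨c, fun x => (Nat.lt_two_pow_self (n := c)).le.trans (Nat.pow_le_pow_left (by omega) c)⟩

theorem self : Bd S S := ⟨1, fun x => by simp⟩

theorem add (h : Bd S τ) (h' : Bd S τ') : Bd S (fun x => τ x + τ' x) := by
  obtain ⟨k, hk⟩ := h
  obtain ⟨l, hl⟩ := h'
  refine ⟨max k l + 1, fun x => ?_⟩
  have h1 : (S x + 2) ^ k ≤ (S x + 2) ^ max k l := Nat.pow_le_pow_right (by omega) (le_max_left _ _)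
  have h2 : (S x + 2) ^ l ≤ (S x + 2) ^ max k l :=
    Nat.pow_le_pow_right (by omega) (le_max_right _ _)
  have := hk x
  have := hl x
  calc τ x + τ' x ≤ (S x + 2) ^ max k l * 2 := by omega
    _ ≤ (S x + 2) ^ (max k l + 1) := by rw [pow_succ]; gcongr; omega

theorem mul (h : Bd S τ) (h' : Bd S τ') : Bd S (fun x => τ x * τ' x) := by
  obtain ⟨k, hk⟩ := h
  obtain ⟨l, hl⟩ := h'
  exact ⟨k + l, fun x => by rw [pow_add]; exact Nat.mul_le_mul (hk x) (hl x)⟩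

/-- Polynomials are closed under substitution. The exponent `l + 2` absorbs the summand 2 of the
base, because that base is at least 2. -/
theorem comp {S' τ'' : Y → ℕ} (h : Bd S' τ'') (F : X → Y) (hF : Bd S (fun x => S' (F x))) :
    Bd S (fun x => τ'' (F x)) := by
  obtain ⟨k, hk⟩ := h
  obtain ⟨l, hl⟩ := hF
  refine ⟨(l + 2) * k, fun x => (hk _).trans ?_⟩
  rw [pow_mul]
  refine Nat.pow_le_pow_left ?_ k
  have : S' (F x) ≤ (S x + 2) ^ l := hl x
  have h1 : 1 ≤ (S x + 2) ^ l := Nat.one_le_pow _ _ (by omega)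
  calc S' (F x) + 2 ≤ (S x + 2) ^ l * 2 ^ 2 := by omega
    _ ≤ (S x + 2) ^ l * (S x + 2) ^ 2 := by gcongr; omega
    _ = (S x + 2) ^ (l + 2) := by ring

theorem trans {τ'' : X → ℕ} (h : Bd S τ) (h' : Bd τ τ'') : Bd S τ'' := h'.comp id h

end Bd

/-! ## Functions computable in polynomial time -/

/-- The string `f x` can be computed, in time polynomial in `S x`, from the strings `g x`, for `g`
in the list `V`: for any locations `ρ` of the latter and any target register `j`, all below `b`,
some program that uses the registers from `b` on as working space assigns `f x` to register `j`. -/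
structure Comp {X : Type} (V : List (X → Str)) (S : X → ℕ) (f : X → Str) : Prop where
  bd : Bd S (fun x => (f x).length)
  prog : ∀ (b : ℕ) (ρ : List ℕ) (j : ℕ), (∀ i ∈ ρ, i < b) → j < b → ∃ (p : Prog) (τ : X → ℕ),
    Bd S τ ∧ ∀ x σ, (∀ i, b ≤ i → σ i = []) → ρ.map σ = V.map (fun g => g x) →
      -- The target may hold an old value; the extra term pays for erasing it. Since the final store
      -- differs from `σ` only at `j`, the working registers are empty again afterwards and all
      -- other inputs survive.
      ∃ t ≤ τ x + 2 * (σ j).length, Runs p σ (Function.update σ j (f x)) t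

namespace Comp

variable {X : Type} {V : List (X → Str)} {S : X → ℕ}

theorem congr {f f' : X → Str} (h : Comp V S f) (hf : ∀ x, f x = f' x) : Comp V S f' :=
  (funext hf : f = f') ▸ h

/-- Moving a stack destroys and reverses it. So a copy is made by moving the source to the scratch
register `b` and then back onto both source and target, which restores the order. -/
theorem var (i : ℕ) {g : X → Str} (hi : V[i]? = some g) (hb : Bd S (fun x => (g x).length)) :
    Comp V S g := by
  refine ⟨hb, fun b ρ j hρ hj => ?_⟩
  -- If the list of locations is too short, no store satisfies `ρ.map σ = V.map _`, and any program
  -- will do.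
  by_cases hi' : i < ρ.length
  swap
  · refine ⟨.skip 0, fun _ => 0, Bd.const 0, fun x σ _ hV => ?_⟩
    have := congrArg List.length hV
    have h2 := (List.getElem?_eq_some_iff.mp hi).1
    simp at this; omega
  set a := ρ[i]
  have hab : a < b := hρ _ (List.getElem_mem _)
  have hval : ∀ (σ : Store) x, ρ.map σ = V.map (fun g => g x) → σ a = g x := by
    intro σ x h
    have := congrArg (fun l => l[i]?) h
    simp only [List.getElem?_map, hi, List.getElem?_eq_getElem hi'] at this
    simpa using this
  by_cases haj : a = j
  · refine ⟨.skip 0, fun _ => 3, Bd.const 3, fun x σ _ hV => ⟨3, by dsimp only; omega, ?_⟩⟩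
    rw [← hval σ x hV, ← haj, Function.update_eq_self]
    exact Runs.skip 0 σ
  refine ⟨.seq (.clear j) (.seq (.move a b) (.moveTwice b a j)), fun x => 12 * (g x).length + 5,
    ((Bd.const 12).mul hb).add (Bd.const 5), fun x σ hσ hV => ⟨_, ?_, (Runs.clear j σ).seq
      ((Runs.move hab.ne _).seq (Runs.moveTwice hab.ne' hj.ne' haj _)) |>.cast ?_ rfl⟩⟩
  · have := hval σ x hV
    have hb := hσ b le_rfl
    simp [haj, hj.ne', this, hb]
    omega
  · have := hval σ x hV
    have hb := hσ b le_rfl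
    funext i
    simp only [Function.update_apply, haj, hab.ne', hj.ne', hab.ne, this, hb, if_true, if_false]
    split_ifs <;> simp_all

theorem const (s : Str) : Comp V S (fun _ => s) := by
  refine ⟨Bd.const _, fun b ρ j hρ hj => ?_⟩
  induction s with
  | nil => exact ⟨.clear j, fun _ => 1, Bd.const 1, fun x σ _ _ =>
      ⟨_, by dsimp only; omega, Runs.clear j σ⟩⟩
  | cons a s ih =>
    obtain ⟨p, τ, hτ, h⟩ := ih
    refine ⟨.seq p (.push j a), fun x => τ x + 2, hτ.add (Bd.const 2), fun x σ hσ hV => ?_⟩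
    obtain ⟨t, ht, hr⟩ := h x σ hσ hV
    exact ⟨t + 1 + 1, by dsimp only; omega, (hr.seq (Runs.push j a _)).cast (by simp) rfl⟩

theorem cons {f : X → Str} (a : Bool) (hf : Comp V S f) : Comp V S (fun x => a :: f x) := by
  refine ⟨(hf.bd.add (Bd.const 1)).mono fun x => by simp, fun b ρ j hρ hj => ?_⟩
  obtain ⟨p, τ, hτ, h⟩ := hf.prog b ρ j hρ hj
  refine ⟨.seq p (.push j a), fun x => τ x + 2, hτ.add (Bd.const 2), fun x σ hσ hV => ?_⟩
  obtain ⟨t, ht, hr⟩ := h x σ hσ hV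
  exact ⟨t + 1 + 1, by dsimp only; omega, (hr.seq (Runs.push j a _)).cast (by simp) rfl⟩

theorem tail {f : X → Str} (hf : Comp V S f) : Comp V S (fun x => (f x).tail) := by
  refine ⟨hf.bd.mono fun x => by simp, fun b ρ j hρ hj => ?_⟩
  obtain ⟨p, τ, hτ, h⟩ := hf.prog b ρ j hρ hj
  refine ⟨.seq p (.pop j), fun x => τ x + 2, hτ.add (Bd.const 2), fun x σ hσ hV => ?_⟩
  obtain ⟨t, ht, hr⟩ := h x σ hσ hV
  exact ⟨t + 1 + 1, by dsimp only; omega, (hr.seq (Runs.pop j _)).cast (by simp) rfl⟩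

/-- Evaluate a list of functions into consecutive registers. -/
theorem prog_list {hs : List (X → Str)} (hh : ∀ h ∈ hs, Comp V S h) (b : ℕ) (ρ : List ℕ)
    (hρ : ∀ i ∈ ρ, i < b) : ∃ (p : Prog) (τ : X → ℕ), Bd S τ ∧ ∀ x σ,
      (∀ i, b ≤ i → σ i = []) → ρ.map σ = V.map (fun g => g x) →
      ∃ t ≤ τ x, ∃ σ', Runs p σ σ' t ∧ (∀ i < b, σ' i = σ i) ∧
        (∀ i, b + hs.length ≤ i → σ' i = []) ∧
        (List.range' b hs.length).map σ' = hs.map (fun h => h x) := by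
  induction hs generalizing b with
  | nil => exact ⟨.skip 0, fun _ => 3, Bd.const 3, fun x σ hσ _ =>
      ⟨3, le_rfl, σ, Runs.skip 0 σ, fun _ _ => rfl, hσ, rfl⟩⟩
  | cons h hs ih =>
    obtain ⟨p, τ, hτ, hp⟩ := (hh h (by simp)).prog (b + 1) ρ b
      (fun i hi => (hρ i hi).trans (by omega)) (by omega)
    obtain ⟨q, τ', hτ', hq⟩ := ih (fun g hg => hh g (by simp [hg])) (b + 1)
      (fun i hi => (hρ i hi).trans (by omega))
    refine ⟨.seq p q, fun x => τ x + τ' x + 1, (hτ.add hτ').add (Bd.const 1),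
      fun x σ hσ hV => ?_⟩
    obtain ⟨t, ht, hr⟩ := hp x σ (fun i hi => hσ i (by omega)) hV
    have hbe := hσ b le_rfl
    have hV' : ρ.map (Function.update σ b (h x)) = V.map (fun g => g x) := by
      rw [← hV]
      refine List.map_congr_left fun i hi => ?_
      have := hρ i hi
      rw [Function.update_of_ne (by omega)]
    obtain ⟨t', ht', σ', hr', h1, h2, h3⟩ := hq x (Function.update σ b (h x))
      (fun i hi => by rw [Function.update_of_ne (by omega)]; exact hσ i (by omega)) hV'
    refine ⟨_, ?_, σ', hr.seq hr', fun i hi => ?_, fun i hi => h2 i ?_, ?_⟩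
    · simp [hbe] at ht; dsimp only; omega
    · rw [h1 i (by omega), Function.update_of_ne (by omega)]
    · simp at hi; omega
    · simp [List.range'_succ, h1 b, h3]

/-- Change of the context: composition of functions. -/
theorem subst {Y : Type} {W : List (Y → Str)} {S' : Y → ℕ} {G : Y → Str} (hG : Comp W S' G)
    (F : X → Y) (hW : ∀ g ∈ W, Comp V S (fun x => g (F x))) (hF : Bd S (fun x => S' (F x))) :
    Comp V S (fun x => G (F x)) := by
  refine ⟨hG.bd.comp F hF, fun b ρ j hρ hj => ?_⟩
  set hs : List (X → Str) := W.map (fun g x => g (F x)) with hhs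
  have hW' : ∀ h ∈ hs, Comp V S h := by
    intro h hh
    simp only [hhs, List.mem_map] at hh
    obtain ⟨g, hg, rfl⟩ := hh
    exact hW g hg
  obtain ⟨p, τ, hτ, hp⟩ := prog_list hW' b ρ hρ
  obtain ⟨q, τ', hτ', hq⟩ := hG.prog (b + hs.length) (List.range' b hs.length) j
    (fun i hi => by simp [List.mem_range'] at hi; omega) (by omega)
  have hlen : Bd S (fun x => ∑ i ∈ Finset.range hs.length,
      (2 * ((hs.map (fun h => h x)).getD i []).length + 2)) := by
    have : ∀ m ≤ hs.length, Bd S (fun x => ∑ i ∈ Finset.range m,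
        (2 * ((hs.map (fun h => h x)).getD i []).length + 2)) := by
      intro m
      induction m with
      | zero => intro _; simpa using Bd.const 0
      | succ m ih =>
        intro hm
        simp only [Finset.sum_range_succ]
        refine (ih (by omega)).add (((Bd.const 2).mul ?_).add (Bd.const 2))
        refine (hW' hs[m] (List.getElem_mem _)).bd.mono fun x => ?_
        simp [List.getD_eq_getElem?_getD, List.getElem?_eq_getElem (show m < hs.length by omega)]
    exact this _ le_rfl
  refine ⟨.seq p (.seq q (.clearFrom b hs.length)), fun x => τ x + τ' (F x) +
    ∑ i ∈ Finset.range hs.length, (2 * ((hs.map (fun h => h x)).getD i []).length + 2) + 5,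
    ((hτ.add (hτ'.comp F hF)).add hlen).add (Bd.const 5), fun x σ hσ hV => ?_⟩
  obtain ⟨t, ht, σ', hr, h1, h2, h3⟩ := hp x σ hσ hV
  obtain ⟨t', ht', hr'⟩ := hq (F x) σ' h2 (by rw [h3, hhs, List.map_map]; rfl)
  refine ⟨_, ?_, (hr.seq (hr'.seq (Runs.clearFrom b hs.length _))).cast ?_ rfl⟩
  · have : ∀ i ∈ Finset.range hs.length,
        (2 * ((Function.update σ' j (G (F x))) (b + i)).length + 2)
          = 2 * ((hs.map (fun h => h x)).getD i []).length + 2 := by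
      intro i hi
      rw [Finset.mem_range] at hi
      rw [Function.update_of_ne (by omega), ← h3]
      simp [List.getD_eq_getElem?_getD, hi]
    rw [Finset.sum_congr rfl this]
    rw [h1 j hj] at ht'
    dsimp only
    omega
  · funext i
    by_cases hib : i < b
    · rw [if_neg (by omega)]
      simp only [Function.update_apply, h1 i hib]
    · rw [Function.update_of_ne (show i ≠ j by omega) _ σ, hσ i (by omega)]
      split_ifs with hi
      · rfl
      · rw [Function.update_of_ne (by omega), h2 i (by omega)]

/-- Branching on the first bit. -/
theorem case {f g g₀ g₁ : X → Str} (hf : Comp V S f) (hg : Comp V S g) (hg₀ : Comp V S g₀)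
    (hg₁ : Comp V S g₁) :
    Comp V S (fun x => (f x).casesOn (g x) (fun a _ => bif a then g₁ x else g₀ x)) := by
  refine ⟨((hg.bd.add hg₀.bd).add hg₁.bd).mono fun x => ?_, fun b ρ j hρ hj => ?_⟩
  · rcases f x with _ | ⟨_ | _, _⟩ <;> simp <;> omega
  obtain ⟨p, τ, hτ, hp⟩ := hf.prog (b + 1) ρ b (fun i hi => (hρ i hi).trans (by omega)) (by omega)
  obtain ⟨q, τq, hτq, hq⟩ := hg.prog b ρ j hρ hj
  obtain ⟨q₀, τ₀, hτ₀, hq₀⟩ := hg₀.prog b ρ j hρ hj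
  obtain ⟨q₁, τ₁, hτ₁, hq₁⟩ := hg₁.prog b ρ j hρ hj
  refine ⟨.seq p (.branch b (.seq (.clear b) q) (.seq (.clear b) q₀) (.seq (.clear b) q₁)),
    fun x => τ x + τq x + τ₀ x + τ₁ x + 2 * (f x).length + 4,
    ((((hτ.add hτq).add hτ₀).add hτ₁).add ((Bd.const 2).mul hf.bd)).add (Bd.const 4),
    fun x σ hσ hV => ?_⟩
  obtain ⟨t, ht, hr⟩ := hp x σ (fun i hi => hσ i (by omega)) hV
  rw [hσ b le_rfl] at ht
  have hc : Runs (.clear b) (Function.update σ b (f x)) σ (2 * (f x).length + 1) := by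
    refine (Runs.clear b _).cast ?_ (by simp)
    rw [Function.update_idem, ← hσ b le_rfl, Function.update_eq_self]
  obtain ⟨u, hu, hru⟩ := hq x σ hσ hV
  obtain ⟨u₀, hu₀, hru₀⟩ := hq₀ x σ hσ hV
  obtain ⟨u₁, hu₁, hru₁⟩ := hq₁ x σ hσ hV
  simp only [List.length_nil] at ht
  rcases hfx : f x with _ | ⟨_ | _, l⟩
  · exact ⟨_, by dsimp only; omega, hr.seq (Runs.branch_nil (by simp [hfx]) (hc.seq hru))⟩
  · exact ⟨_, by dsimp only; omega, hr.seq (Runs.branch_false (by simp [hfx]; rfl) (hc.seq hru₀))⟩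
  · exact ⟨_, by dsimp only; omega, hr.seq (Runs.branch_true (by simp [hfx]; rfl) (hc.seq hru₁))⟩

/-- Iteration along a string, if the intermediate results stay short. -/
theorem foldl {l i : X → Str} {h₀ h₁ : X → Str → Str} (hl : Comp V S l) (hi : Comp V S i)
    (hh₀ : Comp (Prod.snd :: V.map (fun g (y : X × Str) => g y.1)) (fun y => S y.1 + y.2.length)
      (fun y : X × Str => h₀ y.1 y.2))
    (hh₁ : Comp (Prod.snd :: V.map (fun g (y : X × Str) => g y.1)) (fun y => S y.1 + y.2.length)
      (fun y : X × Str => h₁ y.1 y.2))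
    (B : X → ℕ) (hB : Bd S B)
    (hb : ∀ x u v, l x = u ++ v →
      (u.foldl (fun acc a => bif a then h₁ x acc else h₀ x acc) (i x)).length ≤ B x) :
    Comp V S (fun x => (l x).foldl (fun acc a => bif a then h₁ x acc else h₀ x acc) (i x)) := by
  refine ⟨hB.mono fun x => hb x (l x) [] (by simp), fun b ρ j hρ hj => ?_⟩
  obtain ⟨p, τ, hτ, hp⟩ := hl.prog (b + 1) ρ b (fun i hi => (hρ i hi).trans (by omega)) (by omega)
  obtain ⟨q, τ', hτ', hq⟩ := hi.prog (b + 2) ρ (b + 1)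
    (fun i hi => (hρ i hi).trans (by omega)) (by omega)
  obtain ⟨p₀, τ₀, ⟨k₀, hk₀⟩, hp₀⟩ := hh₀.prog (b + 2) ((b + 1) :: ρ) (b + 1)
    (by simp only [List.mem_cons]; rintro i (rfl | hi); · omega
        · have := hρ i hi; omega) (by omega)
  obtain ⟨p₁, τ₁, ⟨k₁, hk₁⟩, hp₁⟩ := hh₁.prog (b + 2) ((b + 1) :: ρ) (b + 1)
    (by simp only [List.mem_cons]; rintro i (rfl | hi); · omega
        · have := hρ i hi; omega) (by omega)
  -- A bound for one pass through the loop that does not depend on the accumulator, whose length is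
  -- at most `B x`.
  let E : X → ℕ := fun x => (S x + B x + 2) ^ k₀ + (S x + B x + 2) ^ k₁ + 2 * B x + 4
  have hSB : Bd S (fun x => S x + B x) := Bd.self.add hB
  have hE : Bd S E := by
    have : ∀ k, Bd S (fun x => (S x + B x + 2) ^ k) := fun k =>
      hSB.trans (τ'' := fun x => (S x + B x + 2) ^ k) ⟨k, fun _ => le_rfl⟩
    exact (((this k₀).add (this k₁)).add ((Bd.const 2).mul hB)).add (Bd.const 4)
  have body : ∀ x σ a u v, l x = u ++ a :: v → (∀ i, b + 2 ≤ i → σ i = []) →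
      ρ.map σ = V.map (fun g => g x) → σ b = a :: v →
      σ (b + 1) = u.foldl (fun acc a => bif a then h₁ x acc else h₀ x acc) (i x) →
      ∃ t ≤ E x, Runs (.branch b (.pop b) (.seq (.pop b) p₀) (.seq (.pop b) p₁)) σ
        (Function.update (Function.update σ b v) (b + 1)
          (bif a then h₁ x (σ (b + 1)) else h₀ x (σ (b + 1)))) t := by
    intro x σ a u v hx hσ hV hσb hσb1
    have hlen : (σ (b + 1)).length ≤ B x := hσb1 ▸ hb x u (a :: v) hx
    have hσ' : ∀ i, b + 2 ≤ i → Function.update σ b v i = [] := fun i hi => by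
      rw [Function.update_of_ne (by omega)]; exact hσ i hi
    have hV' : ((b + 1) :: ρ).map (Function.update σ b v) =
        (Prod.snd :: V.map (fun g (y : X × Str) => g y.1)).map (fun g => g (x, σ (b + 1))) := by
      simp only [List.map_cons, List.map_map, Function.comp_def]
      rw [Function.update_of_ne (by omega), ← hV]
      congr 1
      refine List.map_congr_left fun i hi => ?_
      have := hρ i hi
      rw [Function.update_of_ne (by omega)]
    have e : Function.update σ b v (b + 1) = σ (b + 1) := Function.update_of_ne (by omega) _ _
    have hpow : ∀ k, (S x + (σ (b + 1)).length + 2) ^ k ≤ (S x + B x + 2) ^ k := fun k =>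
      Nat.pow_le_pow_left (by omega) k
    obtain ⟨t₀, ht₀, hr₀⟩ := hp₀ (x, σ (b + 1)) _ hσ' hV'
    obtain ⟨t₁, ht₁, hr₁⟩ := hp₁ (x, σ (b + 1)) _ hσ' hV'
    have h0 := (hk₀ (x, σ (b + 1))).trans (hpow k₀)
    have h1 := (hk₁ (x, σ (b + 1))).trans (hpow k₁)
    rw [e] at ht₀ ht₁
    have hpop := Runs.pop b σ
    rw [hσb, List.tail_cons] at hpop
    cases a
    · exact ⟨_, by simp only [E]; omega, Runs.branch_false hσb (hpop.seq hr₀)⟩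
    · exact ⟨_, by simp only [E]; omega, Runs.branch_true hσb (hpop.seq hr₁)⟩
  -- Induction on the unread part `v` of the string; `u` is the part already consumed, and the
  -- accumulator holds the fold over `u`.
  have loop : ∀ x v u σ, l x = u ++ v → (∀ i, b + 2 ≤ i → σ i = []) →
      ρ.map σ = V.map (fun g => g x) → σ b = v →
      σ (b + 1) = u.foldl (fun acc a => bif a then h₁ x acc else h₀ x acc) (i x) →
      ∃ t ≤ v.length * (E x + 1) + 1,
        Runs (.loop b (.branch b (.pop b) (.seq (.pop b) p₀) (.seq (.pop b) p₁))) σ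
        (Function.update (Function.update σ b []) (b + 1)
          ((l x).foldl (fun acc a => bif a then h₁ x acc else h₀ x acc) (i x))) t := by
    intro x v
    induction v with
    | nil =>
      intro u σ hx hσ hV hσb hσb1
      refine ⟨1, by simp, (Runs.loop_nil hσb).cast ?_ rfl⟩
      rw [hx, List.append_nil, ← hσb1, ← hσb, Function.update_eq_self, Function.update_eq_self]
    | cons a v ih =>
      intro u σ hx hσ hV hσb hσb1
      obtain ⟨t, ht, hr⟩ := body x σ a u v hx hσ hV hσb hσb1
      obtain ⟨t', ht', hr'⟩ := ih (u ++ [a]) (Function.update (Function.update σ b v) (b + 1)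
          (bif a then h₁ x (σ (b + 1)) else h₀ x (σ (b + 1)))) (by simp [hx])
        (fun i hi => by
          rw [Function.update_of_ne (by omega), Function.update_of_ne (by omega)]; exact hσ i hi)
        (by
          rw [← hV]
          refine List.map_congr_left fun i hi => ?_
          have := hρ i hi
          rw [Function.update_of_ne (by omega), Function.update_of_ne (by omega)])
        (by rw [Function.update_of_ne (by omega), Function.update_self])
        (by simp [hσb1])
      refine ⟨t + t' + 1, ?_, (Runs.loop_cons hσb hr hr').cast ?_ rfl⟩
      · simp only [List.length_cons]
        nlinarith
      · funext i
        simp only [Function.update_apply]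
        split_ifs <;> rfl
  -- The result goes from `b + 1` to `j` by way of `b`, which the loop has emptied: two reversals
  -- cancel.
  refine ⟨.seq p (.seq q (.seq (.loop b (.branch b (.pop b) (.seq (.pop b) p₀) (.seq (.pop b) p₁)))
      (.seq (.clear j) (.seq (.move (b + 1) b) (.move b j))))),
    fun x => τ x + τ' x + ((l x).length * (E x + 1) + 1) + 10 * B x + 8,
    (((hτ.add hτ').add ((hl.bd.mul (hE.add (Bd.const 1))).add (Bd.const 1))).add
      ((Bd.const 10).mul hB)).add (Bd.const 8), fun x σ hσ hV => ?_⟩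
  obtain ⟨t, ht, hr⟩ := hp x σ (fun i hi => hσ i (by omega)) hV
  have mapne : ∀ (σ : Store) (i : ℕ) (w : Str), b ≤ i → ρ.map (Function.update σ i w) = ρ.map σ :=
    fun σ i w hi => List.map_congr_left fun a ha => by
      have := hρ a ha
      rw [Function.update_of_ne (by omega)]
  obtain ⟨t', ht', hr'⟩ := hq x (Function.update σ b (l x)) (fun i hi => by
    rw [Function.update_of_ne (by omega)]; exact hσ i (by omega)) (by rw [mapne _ _ _ le_rfl, hV])
  obtain ⟨t'', ht'', hr''⟩ := loop x (l x) []
    (Function.update (Function.update σ b (l x)) (b + 1) (i x)) rfl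
    (fun i hi => by
      rw [Function.update_of_ne (by omega), Function.update_of_ne (by omega)]
      exact hσ i (by omega))
    (by rw [mapne _ _ _ (by omega), mapne _ _ _ le_rfl, hV])
    (by rw [Function.update_of_ne (by omega), Function.update_self])
    (by simp)
  have hbl := hb x (l x) [] (by simp)
  set w := (l x).foldl (fun acc a => bif a then h₁ x acc else h₀ x acc) (i x)
  have hb0 := hσ b le_rfl
  have hb1 := hσ (b + 1) (by omega)
  have hjb : j ≠ b := by omega
  have hjb1 : j ≠ b + 1 := by omega
  refine ⟨_, ?_, (hr.seq (hr'.seq (hr''.seq ((Runs.clear j _).seq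
    ((Runs.move (show b + 1 ≠ b by omega) _).seq (Runs.move hjb.symm _)))))).cast ?_ rfl⟩
  · simp [hb0, hb1, hjb, hjb1, hjb.symm, hjb1.symm] at ht ht' ⊢
    omega
  · funext i
    by_cases h1 : i = j
    · subst h1; simp [hjb, hjb1, hjb.symm, hjb1.symm]
    by_cases h2 : i = b
    · subst h2; simp [h1, hb0]
    by_cases h3 : i = b + 1
    · subst h3; simp [h1, hb1]
    simp [h1, h2, h3]

end Comp

end Machine

/-! ### A library of functions computable in polynomial time -/

namespace Machine

/-- A function of one string that is computable in polynomial time. -/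
abbrev Comp₁ (G : Str → Str) : Prop := Comp [fun y : Str => y] List.length G

/-- A function of two strings that is computable in polynomial time. -/
abbrev Comp₂ (G : Str → Str → Str) : Prop :=
  Comp [fun y : Str × Str => y.1, fun y => y.2] (fun y => y.1.length + y.2.length)
    (fun y => G y.1 y.2)

namespace Comp

variable {X : Type} {V : List (X → Str)} {S : X → ℕ}

/-- This allows each basic function to be implemented once, on bare strings, and then to be used in
every context. -/
theorem comp₁ {G : Str → Str} (hG : Comp₁ G) {f : X → Str} (hf : Comp V S f) :
    Comp V S (fun x => G (f x)) :=
  hG.subst f (by simpa using hf) hf.bd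

theorem comp₂ {G : Str → Str → Str} (hG : Comp₂ G) {f g : X → Str} (hf : Comp V S f)
    (hg : Comp V S g) : Comp V S (fun x => G (f x) (g x)) :=
  hG.subst (fun x => (f x, g x)) (by simpa using ⟨hf, hg⟩) (hf.bd.add hg.bd)

theorem var₁ : Comp [fun y : Str => y] List.length (fun y : Str => y) :=
  .var 0 rfl Bd.self

theorem fst₂ : Comp₂ (fun a _ => a) := .var 0 rfl (Bd.self.mono fun _ => by simp)

theorem snd₂ : Comp₂ (fun _ a => a) := .var 1 rfl (Bd.self.mono fun _ => by simp)

/-- Functions of the context in the body of a loop. -/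
theorem lift (hV : ∀ g ∈ V, Bd S (fun x => (g x).length)) {f : X → Str} (hf : Comp V S f) :
    Comp (Prod.snd :: V.map (fun g (y : X × Str) => g y.1)) (fun y => S y.1 + y.2.length)
      (fun y => f y.1) := by
  have hS : Bd (fun y : X × Str => S y.1 + y.2.length) (fun y => S y.1) :=
    Bd.self.mono fun _ => by simp
  refine hf.subst Prod.fst (fun g hg => ?_) hS
  obtain ⟨i, hi, rfl⟩ := List.getElem_of_mem hg
  exact .var (i + 1) (by simp [hi]) ((hV _ hg).comp Prod.fst hS)

theorem acc {W : List (X × Str → Str)} {S' : X × Str → ℕ}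
    (h : ∀ y, y.2.length ≤ S' y := by exact fun _ => Nat.le_add_left _ _) :
    Comp (Prod.snd :: W) S' (fun y => y.2) :=
  .var 0 rfl (Bd.self.mono h)

/-- A fold that ignores the bits it reads: the length of `l x` serves as a loop counter in unary. -/
theorem iterate {l i : X → Str} {h : X → Str → Str} (hl : Comp V S l) (hi : Comp V S i)
    (hh : Comp (Prod.snd :: V.map (fun g (y : X × Str) => g y.1)) (fun y => S y.1 + y.2.length)
      (fun y : X × Str => h y.1 y.2)) (B : X → ℕ) (hB : Bd S B)
    (hb : ∀ x, ∀ m ≤ (l x).length, ((h x)^[m] (i x)).length ≤ B x) :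
    Comp V S (fun x => (h x)^[(l x).length] (i x)) := by
  have key : ∀ x (u : Str) w, u.foldl (fun acc a => bif a then h x acc else h x acc) w
      = (h x)^[u.length] w := fun x u w => by
    induction u generalizing w with
    | nil => rfl
    | cons a u ih => rw [List.foldl_cons, ih]; cases a <;> rfl
  refine (foldl hl hi hh hh B hB fun x u v hx => ?_).congr fun x => key x _ _
  rw [key]
  exact hb x _ (by simp [hx])

/-! ### Bits -/

theorem cond {c : X → Bool} {f g : X → Str} (hc : Comp V S (fun x => [c x])) (hf : Comp V S f)
    (hg : Comp V S g) : Comp V S (fun x => bif c x then f x else g x) :=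
  (case hc hf hg hf).congr fun x => by cases h : c x <;> simp

theorem ite {c : X → Prop} [∀ x, Decidable (c x)] {f g : X → Str}
    (hc : Comp V S (fun x => [decide (c x)])) (hf : Comp V S f) (hg : Comp V S g) :
    Comp V S (fun x => if c x then f x else g x) :=
  (cond hc hf hg).congr fun x => by by_cases h : c x <;> simp [h]

theorem not {c : X → Bool} (hc : Comp V S (fun x => [c x])) : Comp V S (fun x => [!c x]) :=
  (cond hc (const [false]) (const [true])).congr fun x => by cases c x <;> rfl

theorem and {c c' : X → Bool} (hc : Comp V S (fun x => [c x])) (hc' : Comp V S (fun x => [c' x])) :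
    Comp V S (fun x => [c x && c' x]) :=
  (cond hc hc' (const [false])).congr fun x => by cases c x <;> rfl

theorem or {c c' : X → Bool} (hc : Comp V S (fun x => [c x])) (hc' : Comp V S (fun x => [c' x])) :
    Comp V S (fun x => [c x || c' x]) :=
  (cond hc (const [true]) hc').congr fun x => by cases c x <;> rfl

theorem beq {c c' : X → Bool} (hc : Comp V S (fun x => [c x])) (hc' : Comp V S (fun x => [c' x])) :
    Comp V S (fun x => [c x == c' x]) :=
  (cond hc hc' (not hc')).congr fun x => by cases c x <;> simp

theorem isEmpty {f : X → Str} (hf : Comp V S f) : Comp V S (fun x => [(f x).isEmpty]) :=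
  (case hf (const [true]) (const [false]) (const [false])).congr fun x => by
    rcases f x with _ | ⟨_ | _, _⟩ <;> rfl

theorem headD {f : X → Str} (hf : Comp V S f) : Comp V S (fun x => [(f x).headD false]) :=
  (case hf (const [false]) (const [false]) (const [true])).congr fun x => by
    rcases f x with _ | ⟨_ | _, _⟩ <;> rfl

/-- Put a computed bit in front. -/
theorem consBit {c : X → Bool} {f : X → Str} (hc : Comp V S (fun x => [c x])) (hf : Comp V S f) :
    Comp V S (fun x => c x :: f x) :=
  (cond hc (cons true hf) (cons false hf)).congr fun x => by cases c x <;> rfl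

/-! ### Lists -/

theorem reverse {f : X → Str} (hf : Comp V S f) : Comp V S (fun x => (f x).reverse) := by
  have key : ∀ (u w : Str), u.foldl (fun acc a => bif a then true :: acc else false :: acc) w
      = u.reverse ++ w := fun u w => by
    induction u generalizing w with
    | nil => rfl
    | cons a u ih => cases a <;> simp [ih]
  have : Comp₁ List.reverse := (foldl var₁ (const []) (h₀ := fun _ w => false :: w)
    (h₁ := fun _ w => true :: w) (cons _ acc) (cons _ acc) _ Bd.self
    fun x u v h => by rw [key]; simp [h]).congr fun x => by rw [key]; simp
  exact comp₁ this hf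

theorem append {f g : X → Str} (hf : Comp V S f) (hg : Comp V S g) :
    Comp V S (fun x => f x ++ g x) := by
  have key : ∀ (u w : Str), u.foldl (fun acc a => bif a then true :: acc else false :: acc) w
      = u.reverse ++ w := fun u w => by
    induction u generalizing w with
    | nil => rfl
    | cons a u ih => cases a <;> simp [ih]
  have : Comp₂ (fun a b => a ++ b) := (foldl (reverse fst₂) snd₂ (h₀ := fun _ w => false :: w)
    (h₁ := fun _ w => true :: w) (cons _ acc) (cons _ acc) _ Bd.self
    fun x u v h => by
      rw [key]
      have := congrArg List.length h
      simp at this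
      simp; omega).congr fun x => by rw [key]; simp
  exact comp₂ this hf hg

theorem drop {u f : X → Str} (hu : Comp V S u) (hf : Comp V S f) :
    Comp V S (fun x => (f x).drop (u x).length) := by
  have key : ∀ (m : ℕ) (w : Str), List.tail^[m] w = w.drop m := fun m w => by
    induction m generalizing w with
    | zero => rfl
    | succ m ih => cases w <;> simp [ih]
  have : Comp₂ (fun u w => w.drop u.length) := (iterate fst₂ snd₂ (h := fun _ w => w.tail)
    (tail acc) _ Bd.self fun x m _ => by
      rw [show (fun w : Str => w.tail) = List.tail from rfl, key]; simp; omega).congr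
    fun x => key _ _
  exact comp₂ this hu hf

theorem replicate (b : Bool) {u : X → Str} (hu : Comp V S u) :
    Comp V S (fun x => List.replicate (u x).length b) := by
  have key : ∀ (m : ℕ), (fun w => b :: w)^[m] [] = List.replicate m b := fun m => by
    induction m with
    | zero => rfl
    | succ m ih => rw [Function.iterate_succ_apply', ih, List.replicate_succ]
  have : Comp₁ (fun u => List.replicate u.length b) := (iterate var₁ (const [])
    (h := fun _ w => b :: w) (cons b acc) _ Bd.self fun x m h => by rw [key]; simpa using h).congr
    fun x => key _
  exact comp₁ this hu

/-- Reversed, the string loses as many leading bits as `drop` would have left; reversing back gives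
the initial segment. -/
theorem take {u f : X → Str} (hu : Comp V S u) (hf : Comp V S f) :
    Comp V S (fun x => (f x).take (u x).length) :=
  (reverse (drop (drop hu hf) (reverse hf))).congr fun x => by
    rw [List.drop_reverse, List.reverse_reverse, List.length_drop]
    rcases le_total (u x).length (f x).length with h | h
    · congr 1; omega
    · rw [List.take_of_length_le h, List.take_of_length_le (by omega)]

/-- The rest of a string after its leading ones. -/
theorem dropWhile {f : X → Str} (hf : Comp V S f) : Comp V S (fun x => (f x).dropWhile id) := by
  -- Each round removes one leading `true` and does nothing once a `false` is on top, so as many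
  -- rounds as bits suffice.
  have key : ∀ (m : ℕ) (w : Str), m ≤ w.length →
      (fun w : Str => bif w.headD false then w.tail else w)^[m] w = w.drop
        (min m (w.takeWhile id).length) := fun m w => by
    induction m generalizing w with
    | zero => simp
    | succ m ih =>
      intro h
      rcases w with _ | ⟨_ | _, w⟩
      · simp at h
      · have : ∀ m, (fun w : Str => bif w.headD false then w.tail else w)^[m] (false :: w)
          = false :: w := fun m => Function.iterate_fixed rfl m
        rw [this]; simp
      · rw [Function.iterate_succ_apply]
        simp only [List.headD_cons, List.tail_cons, cond_true, List.length_cons] at h ⊢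
        rw [ih w (by omega)]
        simp [Nat.add_min_add_right]
  have : Comp₁ (fun u => u.dropWhile id) := (iterate var₁ var₁
    (h := fun _ w => bif w.headD false then w.tail else w)
    (cond (headD acc) (tail acc) acc) _ Bd.self fun x m h => by
      rw [key _ _ h]; simp).congr fun x => by
      rw [key _ _ le_rfl, min_eq_right]
      · exact (congrArg (List.drop _) List.takeWhile_append_dropWhile.symm).trans
          (List.drop_left' rfl)
      · exact (List.takeWhile_sublist id).length_le
  exact comp₁ this hf

/-- The leading ones of a string. -/
theorem takeWhile {f : X → Str} (hf : Comp V S f) : Comp V S (fun x => (f x).takeWhile id) :=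
  (replicate true (drop (dropWhile hf) hf)).congr fun x => by
    symm
    rw [List.eq_replicate_iff]
    refine ⟨?_, fun b hb => List.mem_takeWhile_imp hb⟩
    have := congrArg List.length (List.takeWhile_append_dropWhile (p := id) (l := f x))
    rw [List.length_append] at this
    rw [List.length_drop]
    omega

/-- Lengths are compared by dropping: nothing remains of `u` after removing `w.length` bits exactly
if `u` is not longer. -/
theorem lenLe {u w : X → Str} (hu : Comp V S u) (hw : Comp V S w) :
    Comp V S (fun x => [decide ((u x).length ≤ (w x).length)]) :=
  (isEmpty (drop hw hu)).congr fun x => by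
    simp only [List.cons.injEq, and_true]
    rw [Bool.eq_iff_iff]; simp [List.isEmpty_iff]

theorem lenEq {u w : X → Str} (hu : Comp V S u) (hw : Comp V S w) :
    Comp V S (fun x => [decide ((u x).length = (w x).length)]) :=
  (and (lenLe hu hw) (lenLe hw hu)).congr fun x => by
    simp [le_antisymm_iff]

/-- Replace every bit by a string. -/
theorem flatMap (s₀ s₁ : Str) {f : X → Str} (hf : Comp V S f) :
    Comp V S (fun x => (f x).flatMap (fun b => bif b then s₁ else s₀)) := by
  have key : ∀ (u w : Str), u.foldl (fun acc a => bif a then acc ++ s₁ else acc ++ s₀) w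
      = w ++ u.flatMap (fun b => bif b then s₁ else s₀) := fun u w => by
    induction u generalizing w with
    | nil => simp
    | cons a u ih => cases a <;> simp [ih]
  have hlen : ∀ u : Str, (u.flatMap (fun b => bif b then s₁ else s₀)).length
      ≤ u.length * (s₀.length + s₁.length) := fun u => by
    induction u with
    | nil => simp
    | cons a u ih =>
      rw [List.flatMap_cons, List.length_append, List.length_cons, add_mul]
      cases a <;> simp only [cond_true, cond_false] <;> omega
  have : Comp₁ (fun u => u.flatMap (fun b => bif b then s₁ else s₀)) := (foldl var₁ (const [])
    (h₀ := fun _ w => w ++ s₀) (h₁ := fun _ w => w ++ s₁) (append acc (const _))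
    (append acc (const _)) _ (Bd.self.mul (Bd.const (s₀.length + s₁.length)))
    fun x u v h => by
      rw [key, h]
      simp only [List.nil_append, List.length_append]
      exact (hlen u).trans (Nat.mul_le_mul_right _ (by omega))).congr fun x => by rw [key]; simp
  exact comp₁ this hf

/-- Kronecker product of 0-1-vectors. -/
def _root_.Machine.kron (u w : Str) : Str :=
  u.flatMap fun b => bif b then w else List.replicate w.length false

theorem _root_.Machine.length_kron (u w : Str) : (kron u w).length = u.length * w.length := by
  induction u with
  | nil => simp [kron]
  | cons a u ih =>
    rw [kron] at ih ⊢
    cases a <;> simp [ih] <;> ring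

theorem kron {f g : X → Str} (hf : Comp V S f) (hg : Comp V S g) :
    Comp V S (fun x => Machine.kron (f x) (g x)) := by
  have key : ∀ (z u w : Str), u.foldl
      (fun acc a => bif a then acc ++ z else acc ++ List.replicate z.length false) w
      = w ++ Machine.kron u z := fun z u w => by
    induction u generalizing w with
    | nil => simp [Machine.kron]
    | cons a u ih => cases a <;> simp [ih, Machine.kron]
  have hb : ∀ g ∈ [fun y : Str × Str => y.1, fun y => y.2],
      Bd (fun y : Str × Str => y.1.length + y.2.length) (fun y => (g y).length) := by
    simp only [List.mem_cons, List.not_mem_nil, or_false]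
    rintro g (rfl | rfl)
    · exact Bd.self.mono fun _ => by simp
    · exact Bd.self.mono fun _ => by simp
  have : Comp₂ Machine.kron := (foldl fst₂ (const [])
    (h₀ := fun x w => w ++ List.replicate x.2.length false) (h₁ := fun x w => w ++ x.2)
    (append acc (lift hb (replicate false snd₂))) (append acc (lift hb snd₂)) _
    (Bd.self.mul Bd.self) fun x u v h => by
      have h : x.1 = u ++ v := h
      rw [key, h]
      simp only [List.nil_append, length_kron, List.length_append]
      exact Nat.mul_le_mul (by omega) (by omega)).congr fun x => by
      simp only [key, List.nil_append]
  exact comp₂ this hf hg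

/-- Multiplication of numbers in unary. -/
theorem mul {f g : X → Str} (hf : Comp V S f) (hg : Comp V S g) :
    Comp V S (fun x => List.replicate ((f x).length * (g x).length) true) :=
  (replicate true (kron hf hg)).congr fun x => by rw [length_kron]

end Comp

end Machine

namespace Machine

/-! ## Simulation of oracle programs -/

/-- All registers mentioned in the program are below `m`. -/
def Prog.Below (m : ℕ) : Prog → Prop
  | .push i _ => i < m
  | .pop i => i < m
  | .flip i => i < m
  | .ask i j => i < m ∧ j < m
  | .seq p q => p.Below m ∧ q.Below m
  | .branch i p q r => i < m ∧ p.Below m ∧ q.Below m ∧ r.Below m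
  | .loop i p => i < m ∧ p.Below m

theorem Prog.Below.mono {m m' : ℕ} (h : m ≤ m') : ∀ {p : Prog}, p.Below m → p.Below m'
  | .push _ _, hp => lt_of_lt_of_le hp h
  | .pop _, hp => lt_of_lt_of_le hp h
  | .flip _, hp => lt_of_lt_of_le hp h
  | .ask _ _, hp => ⟨lt_of_lt_of_le hp.1 h, lt_of_lt_of_le hp.2 h⟩
  | .seq _ _, hp => ⟨hp.1.mono h, hp.2.mono h⟩
  | .branch _ _ _ _, hp =>
    ⟨lt_of_lt_of_le hp.1 h, hp.2.1.mono h, hp.2.2.1.mono h, hp.2.2.2.mono h⟩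
  | .loop _ _, hp => ⟨lt_of_lt_of_le hp.1 h, hp.2.mono h⟩

theorem Prog.exists_below : ∀ p : Prog, ∃ m, p.Below m
  | .push i _ => ⟨i + 1, Nat.lt_succ_self i⟩
  | .pop i => ⟨i + 1, Nat.lt_succ_self i⟩
  | .flip i => ⟨i + 1, Nat.lt_succ_self i⟩
  | .ask i j => ⟨i + j + 1, show i < _ by omega, show j < _ by omega⟩
  | .seq p q =>
    let ⟨a, ha⟩ := p.exists_below
    let ⟨b, hb⟩ := q.exists_below
    ⟨a + b, ha.mono (by omega), hb.mono (by omega)⟩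
  | .branch i p q r =>
    let ⟨a, ha⟩ := p.exists_below
    let ⟨b, hb⟩ := q.exists_below
    let ⟨c, hc⟩ := r.exists_below
    ⟨a + b + c + i + 1, show i < _ by omega, ha.mono (by omega), hb.mono (by omega),
      hc.mono (by omega)⟩
  | .loop i p =>
    let ⟨a, ha⟩ := p.exists_below
    ⟨a + i + 1, show i < _ by omega, ha.mono (by omega)⟩

/-- Shift the registers by two, and replace the oracle calls by other programs. -/
def Prog.translate (A : ℕ → ℕ → Prog) : Prog → Prog
  | .push i b => .push (i + 2) b
  | .pop i => .pop (i + 2)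
  | .flip i => .flip (i + 2)
  | .ask i j => A i j
  | .seq p q => .seq (p.translate A) (q.translate A)
  | .branch i p q r => .branch (i + 2) (p.translate A) (q.translate A) (r.translate A)
  | .loop i p => .loop (i + 2) (p.translate A)

/-- The registers of the simulation: some data, a flag, and the simulated registers. -/
def sim (x f : Str) (σ : Store) : Store
  | 0 => x
  | 1 => f
  | i + 2 => σ i

theorem update_sim (x f : Str) (σ : Store) (i : ℕ) (w : Str) :
    Function.update (sim x f σ) (i + 2) w = sim x f (Function.update σ i w) := by
  funext a
  rcases a with _ | _ | a <;> simp [sim, Function.update_apply]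

theorem update_sim_one (x f : Str) (σ : Store) (w : Str) :
    Function.update (sim x f σ) 1 w = sim x w σ := by
  funext a
  rcases a with _ | _ | a <;> simp [sim]

theorem run_nil (O : Oracle) (n : ℕ) (σ : Store) : run O n ⟨[], σ⟩ = PMF.pure ⟨[], σ⟩ := by
  induction n with
  | zero => rfl
  | succ n ih => rw [run_succ_of_step (c' := ⟨[], σ⟩) rfl, ih]

/-- The probability to have halted after `n` steps with registers that satisfy `E`. -/
noncomputable def haltProb (O : Oracle) (n : ℕ) (c : Config) (E : Store → Prop) : ℝ≥0∞ :=
  (run O n c).toOuterMeasure {e | e.todo = [] ∧ E e.regs}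

theorem toOuterMeasure_le_one {α : Type*} (μ : PMF α) (s : Set α) : μ.toOuterMeasure s ≤ 1 := by
  rw [PMF.toOuterMeasure_apply, ← μ.tsum_coe]
  exact ENNReal.tsum_le_tsum fun a => Set.indicator_le_self _ _ _

theorem haltProb_le_one (O : Oracle) (n : ℕ) (c : Config) (E : Store → Prop) :
    haltProb O n c E ≤ 1 := toOuterMeasure_le_one _ _

theorem haltProb_of_step {O : Oracle} {c c' : Config} (h : step O c = PMF.pure c') (n : ℕ)
    (E : Store → Prop) : haltProb O (n + 1) c E = haltProb O n c' E := by
  rw [haltProb, run_succ_of_step h]; rfl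

theorem haltProb_of_step_map {O : Oracle} {c : Config} {β : Type} {μ : PMF β} {g : β → Config}
    (h : step O c = μ.map g) (n : ℕ) (E : Store → Prop) :
    haltProb O (n + 1) c E = ∑' b, μ b * haltProb O n (g b) E := by
  rw [haltProb, run, h, PMF.bind_map, PMF.toOuterMeasure_bind_apply]; rfl

theorem mem_support_of_step_map {O : Oracle} {c : Config} {β : Type} {μ : PMF β} {g : β → Config}
    (h : step O c = μ.map g) (n : ℕ) (e : Config) :
    e ∈ (run O (n + 1) c).support ↔ ∃ b ∈ μ.support, e ∈ (run O n (g b)).support := by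
  rw [run, h, PMF.bind_map, PMF.mem_support_bind_iff]; rfl

/-- If one value is almost certain, an expectation is close to the function at that value. -/
theorem tsum_mul_le {β : Type} (μ : PMF β) (F : β → ℝ≥0∞) (hF : ∀ b, F b ≤ 1) (a : β) (ε : ℝ≥0∞)
    (hε : 1 ≤ μ a + ε) : ∑' b, μ b * F b ≤ F a + ε := by
  classical
  have h1 : ∑' b, (if b = a then 0 else μ b) ≤ ε := by
    have h := ENNReal.tsum_eq_add_tsum_ite (f := μ) a
    rw [μ.tsum_coe] at h
    rw [h] at hε
    exact (ENNReal.add_le_add_iff_left (μ.apply_ne_top a)).mp hε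
  rw [ENNReal.tsum_eq_add_tsum_ite a]
  refine add_le_add (mul_le_of_le_one_left' (μ.coe_le_one a)) (le_trans ?_ h1)
  refine ENNReal.tsum_le_tsum fun b => ?_
  split_ifs
  · exact le_rfl
  · exact mul_le_of_le_one_right' (hF b)

/-- Data for the simulation of a program with oracle `O`: each oracle call `ask i j` is replaced by
a program `A i j` that, on registers of length at most `L`, answers `ans q` to the query `q`
within `M` steps and updates the flag. -/
structure Simulation (O : Oracle) (m : ℕ) (x : Str) (L a M : ℕ) (A : ℕ → ℕ → Prog)
    (ans : Str → Str) (mark : Str → Str → Str) : Prop where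
  mem_support : ∀ q, ans q ∈ (O q).support
  length_ans : ∀ q, (ans q).length ≤ a
  one_le : 1 ≤ a
  runs : ∀ i < m, ∀ j < m, ∀ σ f, f.length ≤ 1 → (∀ i, m ≤ i → σ i = []) →
    (∀ i, (σ i).length ≤ L) → ∃ t ≤ M,
      Runs (A i j) (sim x f σ) (sim x (mark f (σ i)) (Function.update σ j (ans (σ i)))) t

namespace Simulation

variable {O : Oracle} {m : ℕ} {x : Str} {L a M : ℕ} {A : ℕ → ℕ → Prog} {ans : Str → Str}
  {mark : Str → Str → Str}

/-- Bookkeeping for the length bound `L`: each step still to come may lengthen a register by at most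
`a`, so the space reserved shrinks by `a` per step. -/
theorem length_update {σ : Store} {n : ℕ} (ha : 1 ≤ a)
    (h : ∀ i, (σ i).length + (n + 1) * a ≤ L) {j : ℕ} {w : Str}
    (hw : w.length ≤ (σ j).length + 1 ∨ w.length ≤ a) (i : ℕ) :
    (Function.update σ j w i).length + n * a ≤ L := by
  have h1 := h i
  have h2 := h j
  rw [add_mul] at h1 h2
  rcases eq_or_ne i j with rfl | hij
  · rw [Function.update_self]; omega
  · rw [Function.update_of_ne hij]; omega

theorem update_empty {σ : Store} (h : ∀ i, m ≤ i → σ i = []) {j : ℕ} (hj : j < m) (w : Str)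
    (i : ℕ) (hi : m ≤ i) : Function.update σ j w i = [] := by
  rw [Function.update_of_ne (by omega), h i hi]

/-- If the oracle program always halts, so does the simulation. -/
theorem support (S : Simulation O m x L a M A ans mark) (Inv : Str → Prop)
    (hlen : ∀ f, Inv f → f.length ≤ 1) (hInv : ∀ f q, Inv f → Inv (mark f q)) (rest : Prog)
    (Tf : ℕ) (E : Store → Prop)
    (hrest : ∀ σ f, Inv f → (∀ i, m ≤ i → σ i = []) → (∀ i, (σ i).length ≤ L) →
      ∃ t ≤ Tf, ∃ σ', Runs rest (sim x f σ) σ' t ∧ E σ') :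
    ∀ (n : ℕ) (todo : List Prog) (σ : Store) (f : Str) (N : ℕ), (∀ p ∈ todo, p.Below m) → Inv f →
      (∀ i, m ≤ i → σ i = []) → (∀ i, (σ i).length + n * a ≤ L) →
      (∀ e ∈ (run O n ⟨todo, σ⟩).support, e.todo = []) → n * (M + 1) + Tf ≤ N →
      ∀ e ∈ (run noOracle N ⟨todo.map (Prog.translate A) ++ [rest], sim x f σ⟩).support,
        e.todo = [] ∧ E e.regs := by
  intro n
  induction n with
  | zero =>
    intro todo σ f N hB hf hσ hL hh hN e he
    have : todo = [] := hh ⟨todo, σ⟩ (by simp [run])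
    subst this
    obtain ⟨t, ht, σ', hr, hE⟩ := hrest σ f hf hσ (fun i => by simpa using hL i)
    obtain ⟨N', rfl⟩ : ∃ N', N = t + N' := ⟨N - t, by omega⟩
    rw [List.map_nil, List.nil_append, hr, run_nil, PMF.support_pure, Set.mem_singleton_iff] at he
    subst he
    exact ⟨rfl, hE⟩
  | succ n ih =>
    intro todo σ f N hB hf hσ hL hh hN
    have hN' : n * (M + 1) + Tf + M + 1 ≤ N := by rw [add_mul] at hN; omega
    have hL' : ∀ i, (σ i).length + n * a ≤ L := fun i => by
      have := hL i; rw [add_mul] at this; omega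
    -- Steps that are neither coin flips nor oracle calls are matched one to one; this treats all of
    -- them together.
    have det : ∀ todo' σ', step O ⟨todo, σ⟩ = PMF.pure ⟨todo', σ'⟩ →
        step noOracle ⟨todo.map (Prog.translate A) ++ [rest], sim x f σ⟩
          = PMF.pure ⟨todo'.map (Prog.translate A) ++ [rest], sim x f σ'⟩ →
        (∀ p ∈ todo', p.Below m) → (∀ i, m ≤ i → σ' i = []) →
        (∀ i, (σ' i).length + n * a ≤ L) →
        ∀ e ∈ (run noOracle N ⟨todo.map (Prog.translate A) ++ [rest], sim x f σ⟩).support,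
          e.todo = [] ∧ E e.regs := by
      intro todo' σ' h1 h2 hB' hσ' hL'
      obtain ⟨N', rfl⟩ : ∃ N', N = N' + 1 := ⟨N - 1, by omega⟩
      rw [run_succ_of_step h2]
      rw [run_succ_of_step h1] at hh
      exact ih todo' σ' f N' hB' hf hσ' hL' hh (by omega)
    rcases todo with _ | ⟨p, k⟩
    · rw [run_succ_of_step (c' := ⟨[], σ⟩) rfl] at hh
      exact ih [] σ f N hB hf hσ hL' hh (by omega)
    have hk : ∀ q ∈ k, q.Below m := fun q hq => hB q (by simp [hq])
    have hp : p.Below m := hB p (by simp)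
    have cons₁ : ∀ q : Prog, q.Below m → ∀ q' ∈ q :: k, q'.Below m := by
      intro q hq q' h'
      rcases List.mem_cons.mp h' with rfl | h'
      · exact hq
      · exact hk _ h'
    cases p with
    | push i b =>
      exact det k (Function.update σ i (b :: σ i)) rfl (by rw [← update_sim]; rfl) hk
        (update_empty hσ hp _) (length_update S.one_le hL (Or.inl (by simp)))
    | pop i =>
      exact det k (Function.update σ i (σ i).tail) rfl (by rw [← update_sim]; rfl) hk
        (update_empty hσ hp _) (length_update S.one_le hL (Or.inl (by simp; omega)))
    | flip i =>
      obtain ⟨N', rfl⟩ : ∃ N', N = N' + 1 := ⟨N - 1, by omega⟩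
      intro e he
      rw [mem_support_of_step_map (μ := PMF.uniformOfFintype Bool) (g := fun b =>
        ⟨k.map (Prog.translate A) ++ [rest], sim x f (Function.update σ i (b :: σ i))⟩)
        (by simp_rw [← update_sim]; rfl)] at he
      obtain ⟨b, hb, he⟩ := he
      refine ih k _ f N' hk hf (update_empty hσ hp _)
        (length_update S.one_le hL (Or.inl (by simp))) (fun e' he' => hh e' ?_) (by omega) e he
      rw [mem_support_of_step_map (μ := PMF.uniformOfFintype Bool)
        (g := fun b => ⟨k, Function.update σ i (b :: σ i)⟩) rfl]
      exact ⟨b, hb, he'⟩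
    | ask i j =>
      -- The computed answer is one the oracle may give, so the simulated run is a possible run of
      -- the original program and inherits its halting time.
      obtain ⟨t, ht, hr⟩ := S.runs i hp.1 j hp.2 σ f (hlen f hf) hσ
        (fun i => by have := hL i; omega)
      obtain ⟨N', rfl⟩ : ∃ N', N = t + N' := ⟨N - t, by omega⟩
      rw [List.map_cons, List.cons_append, Prog.translate, hr]
      refine ih k _ _ N' hk (hInv f _ hf) (update_empty hσ hp.2 _)
        (length_update S.one_le hL (Or.inr (S.length_ans _))) (fun e' he' => hh e' ?_) (by omega)
      rw [mem_support_of_step_map (μ := O (σ i)) (g := fun y => ⟨k, Function.update σ j y⟩) rfl]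
      exact ⟨_, S.mem_support _, he'⟩
    | seq p q =>
      refine det (p :: q :: k) σ rfl rfl ?_ hσ hL'
      intro q' hmem
      rcases List.mem_cons.mp hmem with rfl | hmem
      · exact hp.1
      · exact cons₁ q hp.2 q' hmem
    | branch i p q r =>
      have hs : sim x f σ (i + 2) = σ i := rfl
      rcases h : σ i with _ | ⟨_ | _, l⟩
      · exact det (p :: k) σ (by simp [step, h]) (by simp [Prog.translate, step, hs, h])
          (cons₁ p hp.2.1) hσ hL'
      · exact det (q :: k) σ (by simp [step, h]) (by simp [Prog.translate, step, hs, h])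
          (cons₁ q hp.2.2.1) hσ hL'
      · exact det (r :: k) σ (by simp [step, h]) (by simp [Prog.translate, step, hs, h])
          (cons₁ r hp.2.2.2) hσ hL'
    | loop i p =>
      have hs : sim x f σ (i + 2) = σ i := rfl
      rcases h : σ i with _ | ⟨b, l⟩
      · exact det k σ (by simp [step, h]) (by simp [Prog.translate, step, hs, h]) hk hσ hL'
      · refine det (p :: .loop i p :: k) σ (by simp [step, h])
          (by simp [Prog.translate, step, hs, h]) ?_ hσ hL'
        intro q' hmem
        rcases List.mem_cons.mp hmem with rfl | hmem
        · exact hp.2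
        · exact cons₁ (.loop i p) hp q' hmem

/-- If each answer of the simulation is almost certainly the one of the oracle, or leads to
acceptance, the simulation accepts with almost the probability of a good outcome. -/
theorem haltProb_le (S : Simulation O m x L a M A ans mark) (ε : ℝ≥0∞)
    (hε : ∀ q, (∀ f, mark f q = [true]) ∨ 1 ≤ O q (ans q) + ε)
    (hmark : ∀ f q, mark f q = f ∨ mark f q = [true])
    (rest : Prog) (Tf : ℕ) (E E' : Store → Prop)
    (hrest : ∀ σ f, f = [] ∨ f = [true] → (∀ i, m ≤ i → σ i = []) → (∀ i, (σ i).length ≤ L) →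
      ∃ t ≤ Tf, ∃ σ', Runs rest (sim x f σ) σ' t ∧ (f = [true] ∨ E σ → E' σ')) :
    ∀ (n : ℕ) (todo : List Prog) (σ : Store) (f : Str) (N : ℕ), (∀ p ∈ todo, p.Below m) →
      f = [] ∨ f = [true] →
      (∀ i, m ≤ i → σ i = []) → (∀ i, (σ i).length + n * a ≤ L) →
      (∀ e ∈ (run O n ⟨todo, σ⟩).support, e.todo = []) → n * (M + 1) + Tf ≤ N →
      haltProb O n ⟨todo, σ⟩ E ≤
        haltProb noOracle N ⟨todo.map (Prog.translate A) ++ [rest], sim x f σ⟩ E' + n * ε := by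
  intro n
  induction n with
  | zero =>
    intro todo σ f N hB hf hσ hL hh hN
    have : todo = [] := hh ⟨todo, σ⟩ (by simp [run])
    subst this
    obtain ⟨t, ht, σ', hr, hE⟩ := hrest σ f hf hσ (fun i => by simpa using hL i)
    obtain ⟨N', rfl⟩ : ∃ N', N = t + N' := ⟨N - t, by omega⟩
    rw [haltProb, haltProb, List.map_nil, List.nil_append, hr, run_nil, run_nil]
    classical
    rw [PMF.toOuterMeasure_pure_apply, PMF.toOuterMeasure_pure_apply]
    by_cases hEσ : E σ
    · simp [hEσ, hE (Or.inr hEσ)]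
    · simp [hEσ]
  | succ n ih =>
    intro todo σ f N hB hf hσ hL hh hN
    have hN' : n * (M + 1) + Tf + M + 1 ≤ N := by rw [add_mul] at hN; omega
    have hL' : ∀ i, (σ i).length + n * a ≤ L := fun i => by
      have := hL i; rw [add_mul] at this; omega
    have hn : (n : ℝ≥0∞) * ε ≤ (n + 1 : ℕ) * ε := by gcongr; simp
    have det : ∀ todo' σ', step O ⟨todo, σ⟩ = PMF.pure ⟨todo', σ'⟩ →
        step noOracle ⟨todo.map (Prog.translate A) ++ [rest], sim x f σ⟩
          = PMF.pure ⟨todo'.map (Prog.translate A) ++ [rest], sim x f σ'⟩ →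
        (∀ p ∈ todo', p.Below m) → (∀ i, m ≤ i → σ' i = []) →
        (∀ i, (σ' i).length + n * a ≤ L) →
        haltProb O (n + 1) ⟨todo, σ⟩ E ≤
          haltProb noOracle N ⟨todo.map (Prog.translate A) ++ [rest], sim x f σ⟩ E'
            + (n + 1 : ℕ) * ε := by
      intro todo' σ' h1 h2 hB' hσ' hL'
      obtain ⟨N', rfl⟩ : ∃ N', N = N' + 1 := ⟨N - 1, by omega⟩
      rw [haltProb_of_step h2, haltProb_of_step h1]
      rw [run_succ_of_step h1] at hh
      exact (ih todo' σ' f N' hB' hf hσ' hL' hh (by omega)).trans (by gcongr)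
    rcases todo with _ | ⟨p, k⟩
    · rw [run_succ_of_step (c' := ⟨[], σ⟩) rfl] at hh
      rw [haltProb_of_step (c' := ⟨[], σ⟩) rfl]
      exact (ih [] σ f N hB hf hσ hL' hh (by omega)).trans (by gcongr)
    have hk : ∀ q ∈ k, q.Below m := fun q hq => hB q (by simp [hq])
    have hp : p.Below m := hB p (by simp)
    have cons₁ : ∀ q : Prog, q.Below m → ∀ q' ∈ q :: k, q'.Below m := by
      intro q hq q' h'
      rcases List.mem_cons.mp h' with rfl | h'
      · exact hq
      · exact hk _ h'
    cases p with
    | push i b =>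
      exact det k (Function.update σ i (b :: σ i)) rfl (by rw [← update_sim]; rfl) hk
        (update_empty hσ hp _) (length_update S.one_le hL (Or.inl (by simp)))
    | pop i =>
      exact det k (Function.update σ i (σ i).tail) rfl (by rw [← update_sim]; rfl) hk
        (update_empty hσ hp _) (length_update S.one_le hL (Or.inl (by simp; omega)))
    | flip i =>
      obtain ⟨N', rfl⟩ : ∃ N', N = N' + 1 := ⟨N - 1, by omega⟩
      rw [haltProb_of_step_map (O := noOracle) (μ := PMF.uniformOfFintype Bool) (g := fun b =>
        ⟨k.map (Prog.translate A) ++ [rest], sim x f (Function.update σ i (b :: σ i))⟩)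
        (by simp_rw [← update_sim]; rfl), haltProb_of_step_map (O := O)
        (μ := PMF.uniformOfFintype Bool) (g := fun b => ⟨k, Function.update σ i (b :: σ i)⟩) rfl]
      have hc : ∑' b, PMF.uniformOfFintype Bool b * ((n : ℝ≥0∞) * ε) = n * ε := by
        rw [ENNReal.tsum_mul_right, PMF.tsum_coe, one_mul]
      refine le_trans ?_ (add_le_add_right hn _)
      rw [← hc, ← ENNReal.tsum_add]
      refine ENNReal.tsum_le_tsum fun b => ?_
      rw [← mul_add]
      refine mul_le_mul_right (ih k _ f N' hk hf (update_empty hσ hp _)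
        (length_update S.one_le hL (Or.inl (by simp))) (fun e' he' => hh e' ?_) (by omega)) _
      rw [mem_support_of_step_map (μ := PMF.uniformOfFintype Bool)
        (g := fun b => ⟨k, Function.update σ i (b :: σ i)⟩) rfl]
      exact ⟨b, by simp, he'⟩
    | ask i j =>
      have hlen : f.length ≤ 1 := by rcases hf with rfl | rfl <;> simp
      obtain ⟨t, ht, hr⟩ := S.runs i hp.1 j hp.2 σ f hlen hσ (fun i => by have := hL i; omega)
      obtain ⟨N', rfl⟩ : ∃ N', N = t + N' := ⟨N - t, by omega⟩
      have hh' : ∀ e ∈ (run O n ⟨k, Function.update σ j (ans (σ i))⟩).support, e.todo = [] := by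
        refine fun e' he' => hh e' ?_
        rw [mem_support_of_step_map (μ := O (σ i)) (g := fun y => ⟨k, Function.update σ j y⟩) rfl]
        exact ⟨_, S.mem_support _, he'⟩
      have hL'' := length_update S.one_le hL (j := j) (Or.inr (S.length_ans (σ i)))
      have hσ' := update_empty hσ hp.2 (ans (σ i))
      have hN'' : n * (M + 1) + Tf ≤ N' := by omega
      rw [haltProb, haltProb, List.map_cons, List.cons_append, Prog.translate, hr,
        ← haltProb, ← haltProb]
      rcases hε (σ i) with hm | hm
      -- The flag is raised by this query and never lowered again, so the simulation accepts with
      -- certainty and no comparison with the oracle is needed.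
      · have := S.support (fun f => f = [true]) (by rintro f rfl; simp)
          (fun f q hf => (hmark f q).elim (fun h => h.trans hf) id) rest Tf E'
          (by
            rintro σ f rfl h1 h2
            obtain ⟨t, ht, σ', hr, hE⟩ := hrest σ [true] (Or.inr rfl) h1 h2
            exact ⟨t, ht, σ', hr, hE (Or.inl rfl)⟩)
          n k _ _ N' hk (hm f) hσ' hL'' hh' hN''
        have h1 : haltProb noOracle N' ⟨k.map (Prog.translate A) ++ [rest],
            sim x (mark f (σ i)) (Function.update σ j (ans (σ i)))⟩ E' = 1 := by
          rw [haltProb, PMF.toOuterMeasure_apply_eq_one_iff]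
          exact this
        rw [h1]
        exact (haltProb_le_one _ _ _ _).trans le_self_add
      · rw [haltProb_of_step_map (O := O) (μ := O (σ i))
          (g := fun y => ⟨k, Function.update σ j y⟩) rfl]
        have h1 := ih k _ (mark f (σ i)) N' hk
          (by rcases hmark f (σ i) with h | h
              · rwa [h]
              · exact Or.inr h) hσ' hL'' hh' hN''
        -- The expectation over the oracle answers is replaced by its value at the computed answer,
        -- at the price of `ε`; the induction hypothesis then pays `ε` for each remaining step.
        refine (tsum_mul_le _ _ (fun _ => haltProb_le_one _ _ _ _) _ ε hm).trans ?_
        refine (add_le_add_left h1 ε).trans ?_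
        rw [add_assoc]
        push_cast
        rw [add_mul, one_mul]
    | seq p q =>
      refine det (p :: q :: k) σ rfl rfl ?_ hσ hL'
      intro q' hmem
      rcases List.mem_cons.mp hmem with rfl | hmem
      · exact hp.1
      · exact cons₁ q hp.2 q' hmem
    | branch i p q r =>
      have hs : sim x f σ (i + 2) = σ i := rfl
      rcases h : σ i with _ | ⟨_ | _, l⟩
      · exact det (p :: k) σ (by simp [step, h]) (by simp [Prog.translate, step, hs, h])
          (cons₁ p hp.2.1) hσ hL'
      · exact det (q :: k) σ (by simp [step, h]) (by simp [Prog.translate, step, hs, h])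
          (cons₁ q hp.2.2.1) hσ hL'
      · exact det (r :: k) σ (by simp [step, h]) (by simp [Prog.translate, step, hs, h])
          (cons₁ r hp.2.2.2) hσ hL'
    | loop i p =>
      have hs : sim x f σ (i + 2) = σ i := rfl
      rcases h : σ i with _ | ⟨b, l⟩
      · exact det k σ (by simp [step, h]) (by simp [Prog.translate, step, hs, h]) hk hσ hL'
      · refine det (p :: .loop i p :: k) σ (by simp [step, h])
          (by simp [Prog.translate, step, hs, h]) ?_ hσ hL'
        intro q' hmem
        rcases List.mem_cons.mp hmem with rfl | hmem
        · exact hp.2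
        · exact cons₁ (.loop i p) hp q' hmem

end Simulation

end Machine

namespace RL

open Machine

/-! ## Values of Markov decision processes -/

/-- The distribution of a reward in `{0, 1}` with mean `p`. -/
noncomputable def coin (p : ℝ≥0∞) (h : p ≤ 1) : PMF ℚ :=
  (PMF.ofFintype (fun b : Bool => bif b then p else 1 - p) (by simp [h])).map
    fun b => bif b then 1 else 0

theorem coin_one (p : ℝ≥0∞) (h : p ≤ 1) : coin p h 1 = p := by
  rw [coin, PMF.map_apply, tsum_bool]; simp

theorem coin_zero (p : ℝ≥0∞) (h : p ≤ 1) : coin p h 0 = 1 - p := by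
  rw [coin, PMF.map_apply, tsum_bool]; simp

theorem support_coin (p : ℝ≥0∞) (h : p ≤ 1) (q : ℚ) (hq : q ∈ (coin p h).support) :
    q = 0 ∨ q = 1 := by
  rw [coin, PMF.support_map] at hq
  obtain ⟨b, -, rfl⟩ := hq
  cases b <;> simp

theorem tsum_coin (p : ℝ≥0∞) (h : p ≤ 1) : ∑' q : ℚ, (coin p h q).toReal * (q : ℝ) = p.toReal := by
  rw [tsum_eq_single 1, coin_one]
  · simp
  · intro q hq
    by_cases h0 : q = 0
    · simp [h0]
    · have : coin p h q = 0 := by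
        by_contra hne
        rcases support_coin p h q ((PMF.mem_support_iff _ _).mpr hne) with h' | h' <;> contradiction
      simp [this]

namespace MDP

variable (M : MDP)

/-- The reward collected within `T` steps. -/
noncomputable def W (π : M.Policy) (o : Option M.State) (T : ℕ) : ℝ :=
  ∑ t ∈ Finset.range T, ((fun o : Option M.State => o.bind fun s' => M.next s' (π s'))^[t] o).elim 0
    fun s' => M.meanReward s' (π s')

variable {M}

theorem W_succ (π : M.Policy) (s : M.State) (T : ℕ) :
    M.W π (some s) (T + 1) = M.meanReward s (π s) + M.W π (M.next s (π s)) T := by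
  rw [W, Finset.sum_range_succ']
  simp [W, add_comm]

theorem W_none (π : M.Policy) (T : ℕ) : M.W π none T = 0 := by
  rw [W]
  refine Finset.sum_eq_zero fun t _ => ?_
  rw [Function.iterate_fixed rfl]; rfl

theorem V_eq_W (π : M.Policy) (s : M.State) : M.V π s = M.W π (some s) M.horizon := rfl

variable {G : M.State → ℝ}

/-- A supersolution of the Bellman equations dominates every policy. Nonnegativity covers
trajectories that are cut off before the end state. -/
theorem W_le (h0 : ∀ s, 0 ≤ G s)
    (hle : ∀ s a, M.meanReward s a + (M.next s a).elim 0 G ≤ G s) (π : M.Policy) (T : ℕ)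
    (o : Option M.State) : M.W π o T ≤ o.elim 0 G := by
  induction T generalizing o with
  | zero => cases o <;> simp [W, h0]
  | succ T ih =>
    cases o with
    | none => rw [W_none]; simp
    | some s =>
      rw [W_succ]
      exact (add_le_add_right (ih _) _).trans (hle s (π s))

/-- Where the Bellman inequality is an equality along `π`, the sum telescopes; reaching the end
state within `T` steps leaves no remainder. -/
theorem W_greedy (π : M.Policy)
    (hex : ∀ s, M.meanReward s (π s) + (M.next s (π s)).elim 0 G = G s) (T : ℕ)
    (o : Option M.State)
    (hT : (fun o : Option M.State => o.bind fun s' => M.next s' (π s'))^[T] o = none) :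
    M.W π o T = o.elim 0 G := by
  induction T generalizing o with
  | zero => rw [Function.iterate_zero, id] at hT; simp [hT, W]
  | succ T ih =>
    cases o with
    | none => rw [W_none]; simp
    | some s =>
      rw [W_succ, ih _ (by rwa [Function.iterate_succ_apply] at hT)]
      exact hex s

/-- A solution of the Bellman equations is the optimal value function. -/
theorem exists_optimal (h0 : ∀ s, 0 ≤ G s)
    (hle : ∀ s a, M.meanReward s a + (M.next s a).elim 0 G ≤ G s)
    (hex : ∀ s, ∃ a, M.meanReward s a + (M.next s a).elim 0 G = G s) :
    (∀ s, M.VStar s = G s) ∧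
      ∀ s a, M.QStar s a = M.meanReward s a + (M.next s a).elim 0 G := by
  choose π hπ using hex
  have hV : ∀ π s, M.V π s ≤ G s := fun π s => W_le h0 hle π _ (some s)
  have hVπ : ∀ s, M.V π s = G s := fun s =>
    W_greedy π hπ _ (some s) (M.horizon_spec π s)
  have hE : ∀ (π : M.Policy) (o : Option M.State), o.elim 0 (M.V π) ≤ o.elim 0 G := fun π o => by
    cases o with
    | none => simp
    | some s => exact hV π s
  have hQ : ∀ π s a, M.Q π s a ≤ M.meanReward s a + (M.next s a).elim 0 G := fun π s a =>
    add_le_add_right (hE π _) _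
  refine ⟨fun s => le_antisymm (ciSup_le fun π => hV π s) ?_,
    fun s a => le_antisymm (ciSup_le fun π => hQ π s a) ?_⟩
  · rw [← hVπ s]
    exact le_ciSup (f := fun π => M.V π s) ⟨G s, by rintro _ ⟨π, rfl⟩; exact hV π s⟩ π
  · have : M.Q π s a = M.meanReward s a + (M.next s a).elim 0 G := by
      rw [Q]
      congr 2
      exact funext hVπ
    rw [← this]
    exact le_ciSup (f := fun π => M.Q π s a)
      ⟨M.meanReward s a + (M.next s a).elim 0 G, by rintro _ ⟨π, rfl⟩; exact hQ π s a⟩ π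

/-- The state reached by the actions; a state without successor is not left. -/
def walk (M : MDP) (s : M.State) (as : List Bool) : M.State :=
  as.foldl (fun s a => (M.next s a).getD s) s

/-- If only the last state gives a reward, then the value of a policy is the reward in the last
state of its trajectory. -/
theorem W_le_of_executes (hG : ∀ s a, M.next s a = none → ∀ b, M.next s b = none)
    (hr : ∀ s a, M.next s a ≠ none → M.meanReward s a = 0)
    (hr' : ∀ s a, M.next s a = none → M.meanReward s a ≤ G s) (h0 : ∀ s, 0 ≤ G s)
    (π : M.Policy) (as : List Bool) (s : M.State) (T : ℕ) (h : M.Executes π (some s) as) :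
    (∀ a, M.next (M.walk s as) a = none) ∧ M.W π (some s) T ≤ G (M.walk s as) := by
  induction as generalizing s T with
  | nil => exact h.elim
  | cons a as ih =>
    obtain ⟨rfl, h⟩ := h
    rcases hn : M.next s (π s) with _ | s'
    -- A state from which the process ends is never left by `walk`, so superfluous actions do no
    -- harm.
    · have hw : ∀ as : List Bool, M.walk s as = s := fun as => by
        induction as with
        | nil => rfl
        | cons b as ih =>
          rw [walk, List.foldl_cons, hG s _ hn b]; exact ih
      rw [hw]
      refine ⟨hG s _ hn, ?_⟩
      cases T with
      | zero => simpa [W] using h0 s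
      | succ T => rw [W_succ, hn, W_none, add_zero]; exact hr' s _ hn
    · rw [hn] at h
      have hw : M.walk s (π s :: as) = M.walk s' as := by
        rw [walk, List.foldl_cons, hn]; rfl
      rw [hw]
      refine ⟨(ih s' 0 h).1, ?_⟩
      cases T with
      | zero => simpa [W] using h0 _
      | succ T =>
        rw [W_succ, hn, hr s _ (by simp [hn]), zero_add]
        exact (ih s' T h).2

end MDP

end RL

namespace Machine

/-! ## Binary counters -/

/-- The number with the given binary digits, least significant digit first. -/
def val : Str → ℕ
  | [] => 0
  | b :: l => b.toNat + 2 * val l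

/-- Add one to a number in binary; the length changes only if all digits are one. -/
def inc (l : Str) : Str :=
  List.replicate (l.takeWhile id).length false ++ true :: (l.dropWhile id).tail

theorem inc_false (l : Str) : inc (false :: l) = true :: l := by simp [inc]

theorem inc_true (l : Str) : inc (true :: l) = false :: inc l := by
  simp [inc, List.replicate_succ]

theorem inc_nil : inc [] = [true] := by simp [inc]

theorem val_inc (l : Str) : val (inc l) = val l + 1 := by
  induction l with
  | nil => simp [inc_nil, val]
  | cons b l ih =>
    cases b
    · simp [inc_false, val]; ring
    · simp [inc_true, val, ih]; ring

/-- All digits are one. -/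
def allOnes (l : Str) : Bool := (l.dropWhile id).isEmpty

theorem allOnes_cons_true (l : Str) : allOnes (true :: l) = allOnes l := by simp [allOnes]

theorem allOnes_cons_false (l : Str) : allOnes (false :: l) = false := by simp [allOnes]

theorem length_inc (l : Str) (h : allOnes l = false) : (inc l).length = l.length := by
  induction l with
  | nil => simp [allOnes] at h
  | cons b l ih =>
    cases b
    · simp [inc_false]
    · rw [allOnes_cons_true] at h; simp [inc_true, ih h]

theorem val_lt (l : Str) : val l < 2 ^ l.length := by
  induction l with
  | nil => simp [val]
  | cons b l ih =>
    rw [val, List.length_cons, pow_succ]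
    cases b <;> simp <;> omega

theorem val_of_allOnes (l : Str) (h : allOnes l = true) : val l + 1 = 2 ^ l.length := by
  induction l with
  | nil => simp [val]
  | cons b l ih =>
    cases b
    · simp [allOnes_cons_false] at h
    · rw [allOnes_cons_true] at h
      rw [val, List.length_cons, pow_succ, ← ih h]
      simp; ring

theorem length_inc_of_allOnes (l : Str) (h : allOnes l = true) : (inc l).length = l.length + 1 := by
  induction l with
  | nil => simp [inc_nil]
  | cons b l ih =>
    cases b
    · simp [allOnes_cons_false] at h
    · rw [allOnes_cons_true] at h; simp [inc_true, ih h]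

theorem val_replicate_false (n : ℕ) : val (List.replicate n false) = 0 := by
  induction n with
  | zero => rfl
  | succ n ih => simp [List.replicate_succ, val, ih]

/-- The digits of `n` in binary. -/
def binary (n : ℕ) : Str := inc^[n] []

theorem val_binary (n : ℕ) : val (binary n) = n := by
  induction n with
  | zero => rfl
  | succ n ih => rw [binary, Function.iterate_succ_apply', ← binary, val_inc, ih]

theorem lt_two_pow_length_binary (n : ℕ) : n < 2 ^ (binary n).length := by
  conv_lhs => rw [← val_binary n]
  exact val_lt _

/-- A digit is added only when all digits are one, that is, when the next number is the power of two
`2 ^ length`. -/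
theorem two_pow_length_binary_le {n : ℕ} (hn : n ≠ 0) : 2 ^ (binary n).length ≤ 2 * n := by
  induction n with
  | zero => exact absurd rfl hn
  | succ n ih =>
    rw [binary, Function.iterate_succ_apply', ← binary]
    rcases h : allOnes (binary n)
    · rw [length_inc _ h]
      have : n ≠ 0 := by rintro rfl; simp [binary, allOnes] at h
      have := ih this
      omega
    · have := val_of_allOnes _ h
      rw [val_binary] at this
      rw [length_inc_of_allOnes _ h, pow_succ, ← this, mul_comm]

/-- Change the bit at position `i`. -/
def flipAt (w : Str) (i : ℕ) : Str := w.set i (!w.getD i false)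

@[simp] theorem length_flipAt (w : Str) (i : ℕ) : (flipAt w i).length = w.length := by
  simp [flipAt]

theorem getD_flipAt (w : Str) {i : ℕ} (hi : i < w.length) (j : ℕ) :
    (flipAt w i).getD j false = if j = i then !w.getD i false else w.getD j false := by
  rw [flipAt, List.getD_eq_getElem?_getD, List.getElem?_set]
  by_cases h : i = j
  · subst h; simp [hi]
  · rw [if_neg h, if_neg (Ne.symm h), List.getD_eq_getElem?_getD]

end Machine

namespace ThreeSat

open Machine

/-- Evaluation of a literal; the assignment is a string, perhaps with superfluous bits. -/
def Literal.eval {v : ℕ} (w : Str) (l : Literal v) : Bool := w.getD l.1 false == l.2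

def Clause.eval {v : ℕ} (w : Str) (C : Clause v) : Bool :=
  Literal.eval w C.1 || Literal.eval w C.2.1 || Literal.eval w C.2.2

/-- The first falsified clause. -/
def firstFalse {v : ℕ} (φ : CNF v) (w : Str) : Option (Clause v) :=
  φ.find? fun C => !Clause.eval w C

theorem satisfies_iff {v : ℕ} (φ : CNF v) (w : Str) :
    Satisfies (fun i : Fin v => w.getD i false) φ ↔ firstFalse φ w = none := by
  rw [firstFalse, List.find?_eq_none]
  refine forall₂_congr fun C _ => ?_
  simp only [Clause.eval, Literal.eval, Bool.not_eq_true', Bool.not_eq_false, Bool.or_eq_true,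
    beq_iff_eq, or_assoc]

end ThreeSat

namespace RL

open Machine ThreeSat

/-! ## The decision process of a formula -/

/-- A phase bit, a counter, and an assignment. -/
@[ext] structure SearchState (B V : ℕ) where
  phase : Bool
  count : Str
  assign : Str
  length_count : count.length = B
  length_assign : assign.length = V

namespace SearchState

variable {v B V : ℕ}

/-- The code of a state. -/
def code (s : SearchState B V) : Str := s.phase :: (s.count ++ s.assign)

theorem code_injective : Function.Injective (code : SearchState B V → Str) := by
  intro s t h
  simp only [code, List.cons.injEq] at h
  have := List.append_inj h.2 (by rw [s.length_count, t.length_count])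
  ext1
  exacts [h.1, this.1, this.2]

theorem length_code (s : SearchState B V) : s.code.length = 1 + B + V := by
  simp [code, s.length_count, s.length_assign]; ring

theorem exists_code {x : Str} (hx : x.length = 1 + B + V) : ∃ s : SearchState B V, s.code = x := by
  rcases x with _ | ⟨b, x⟩
  · simp at hx; omega
  · simp at hx
    exact ⟨⟨b, x.take B, x.drop B, by simp; omega, by simp; omega⟩, by simp [code]⟩

/-- The clause to be repaired: the first falsified one, unless the time is over. -/
def clause (φ : CNF v) (s : SearchState B V) : Option (Clause v) :=
  if allOnes s.count then none else firstFalse φ s.assign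

theorem allOnes_of_clause {φ : CNF v} {s : SearchState B V} {C : Clause v}
    (h : s.clause φ = some C) : allOnes s.count = false := by
  by_contra h'
  rw [Bool.not_eq_false] at h'
  rw [clause, if_pos h'] at h
  cases h

theorem firstFalse_of_clause {φ : CNF v} {s : SearchState B V} {C : Clause v}
    (h : s.clause φ = some C) : firstFalse φ s.assign = some C := by
  rwa [clause, allOnes_of_clause h, if_neg (by simp)] at h

/-- Flip a variable. -/
def move (s : SearchState B V) (h : allOnes s.count = false) (i : ℕ) : SearchState B V :=
  ⟨false, inc s.count, flipAt s.assign i, by rw [length_inc _ h, s.length_count],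
    by rw [length_flipAt, s.length_assign]⟩

/-- Go to the second phase. -/
def pass (s : SearchState B V) : SearchState B V :=
  ⟨true, s.count, s.assign, s.length_count, s.length_assign⟩

/-- In the first phase, flip the first variable of a falsified clause or pass to the second
phase; in the second phase, flip one of the other two variables. -/
def next (φ : CNF v) (s : SearchState B V) (a : Bool) : Option (SearchState B V) :=
  match h : s.clause φ with
  | none => none
  | some C => some (match s.phase, a with
    | false, true => s.move (allOnes_of_clause h) C.1.1
    | false, false => s.pass
    | true, false => s.move (allOnes_of_clause h) C.2.1.1
    | true, true => s.move (allOnes_of_clause h) C.2.2.1)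

theorem next_of_none {φ : CNF v} {s : SearchState B V} (h : s.clause φ = none) (a : Bool) :
    s.next φ a = none := by
  unfold next; split
  · rfl
  · simp_all

theorem next_of_some {φ : CNF v} {s : SearchState B V} {C : Clause v} (h : s.clause φ = some C)
    (a : Bool) : s.next φ a = some (match s.phase, a with
      | false, true => s.move (allOnes_of_clause h) C.1.1
      | false, false => s.pass
      | true, false => s.move (allOnes_of_clause h) C.2.1.1
      | true, true => s.move (allOnes_of_clause h) C.2.2.1) := by
  unfold next; split
  · simp_all
  · next C' h' =>
    obtain rfl : C' = C := by rw [h] at h'; exact (Option.some.inj h').symm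
    rfl

theorem next_eq_none_iff {φ : CNF v} {s : SearchState B V} {a : Bool} :
    s.next φ a = none ↔ s.clause φ = none := by
  refine ⟨fun h => ?_, fun h => next_of_none h a⟩
  rcases hC : s.clause φ with _ | C
  · rfl
  · rw [next_of_some hC] at h; cases h

/-- The number of steps that are left. -/
def fuel (s : SearchState B V) : ℕ :=
  -- Each later counter value accounts for at most one state per phase, and the final 1 is the step
  -- into the end state.
  2 * (2 ^ B - 1 - val s.count) + (bif s.phase then 0 else 1) + 1

/-- Passing to the second phase costs one unit; a flip raises the counter, which gains more than the
return to the first phase loses. This bounds the horizon by `2 * 2 ^ B`. -/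
theorem fuel_next {φ : CNF v} {s t : SearchState B V} {a : Bool} (h : s.next φ a = some t) :
    t.fuel + 1 ≤ s.fuel := by
  rcases hC : s.clause φ with _ | C
  · rw [next_of_none hC] at h; cases h
  · rw [next_of_some hC, Option.some.injEq] at h
    have hl := val_lt (inc s.count)
    rw [length_inc _ (allOnes_of_clause hC), s.length_count, val_inc] at hl
    subst h
    rcases hp : s.phase <;> cases a <;> simp [fuel, hp, move, pass, val_inc] <;> omega

theorem iterate_next (φ : CNF v) (π : SearchState B V → Bool) (T : ℕ)
    (o : Option (SearchState B V)) (h : o.elim 0 fuel ≤ T) :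
    (fun o : Option (SearchState B V) => o.bind fun s' => s'.next φ (π s'))^[T] o = none := by
  induction T generalizing o with
  | zero =>
    cases o with
    | none => rfl
    | some s => simp [fuel] at h
  | succ T ih =>
    rw [Function.iterate_succ_apply]
    refine ih _ ?_
    rcases ho : o with _ | s
    · simp
    rcases hn : s.next φ (π s) with _ | t
    · simp [hn]
    · have := fuel_next hn
      simp [ho] at h
      simp [hn]; omega

theorem fuel_le (s : SearchState B V) : s.fuel ≤ 2 * 2 ^ B := by
  have : 1 ≤ 2 ^ B := Nat.one_le_two_pow
  rw [fuel]
  cases s.phase <;> simp <;> omega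

/-- The starting state. -/
def origin (B V : ℕ) : SearchState B V :=
  ⟨false, List.replicate B false, List.replicate V false, by simp, by simp⟩

end SearchState

/-- The decision process: search for a satisfying assignment.  A reward is given only at the end,
with probability `p`. -/
noncomputable def searchMDP {v : ℕ} (φ : CNF v) (B V : ℕ) (p : SearchState B V → ℝ≥0∞)
    (hp : ∀ s, p s ≤ 1) : MDP where
  State := SearchState B V
  code := SearchState.code
  code_injective := SearchState.code_injective
  start := SearchState.origin B V
  next := SearchState.next φ
  reward s _ := if s.clause φ = none then coin (p s) (hp s) else PMF.pure 0
  reward_mem s a q hq := by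
    split_ifs at hq
    · rcases support_coin _ _ _ hq with rfl | rfl <;> norm_num
    · simp at hq; subst hq; norm_num
  horizon := 2 * 2 ^ B
  horizon_spec π s := SearchState.iterate_next φ π _ _ s.fuel_le

namespace searchMDP

variable {v : ℕ} {φ : CNF v} {B V : ℕ} {p : SearchState B V → ℝ≥0∞} {hp : ∀ s, p s ≤ 1}

theorem meanReward_of_none {s : SearchState B V} (h : s.clause φ = none) (a : Bool) :
    (searchMDP φ B V p hp).meanReward s a = (p s).toReal := by
  have : (searchMDP φ B V p hp).reward s a = coin (p s) (hp s) := if_pos h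
  simp only [MDP.meanReward, this, tsum_coin]

theorem meanReward_of_some {s : SearchState B V} {C : Clause v} (h : s.clause φ = some C)
    (a : Bool) : (searchMDP φ B V p hp).meanReward s a = 0 := by
  have : (searchMDP φ B V p hp).reward s a = PMF.pure 0 := if_neg (by simp [h])
  simp only [MDP.meanReward, this]
  rw [tsum_eq_single 0]
  · simp
  · intro q hq; simp [hq]

end searchMDP

end RL

namespace RL

open Machine ThreeSat

/-! ## The optimal value function -/

/-- Whether two bits differ. -/
def differ (a b : Bool) : ℝ := if a = b then 0 else 1

/-- The Hamming distance to `ws` on the first `V` bits. -/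
def dist (ws : ℕ → Bool) (V : ℕ) (w : Str) : ℝ :=
  ∑ i ∈ Finset.range V, differ (w.getD i false) (ws i)

theorem differ_nonneg (a b : Bool) : 0 ≤ differ a b := by
  unfold differ; split_ifs <;> norm_num

theorem differ_le (a b : Bool) : differ a b ≤ 1 := by
  unfold differ; split_ifs <;> norm_num

theorem dist_nonneg (ws : ℕ → Bool) (V : ℕ) (w : Str) : 0 ≤ dist ws V w :=
  Finset.sum_nonneg fun _ _ => differ_nonneg _ _

theorem dist_le (ws : ℕ → Bool) (V : ℕ) (w : Str) : dist ws V w ≤ V := by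
  refine (Finset.sum_le_sum fun i _ => differ_le (w.getD i false) (ws i)).trans ?_
  simp

/-- A flip reduces the distance by one if the bit was wrong and increases it by one if it was right.
-/
theorem dist_flipAt (ws : ℕ → Bool) {V : ℕ} {w : Str} (hw : w.length = V) {i : ℕ} (hi : i < V) :
    dist ws V (flipAt w i) = dist ws V w + 1 - 2 * differ (w.getD i false) (ws i) := by
  have : ∀ j ∈ Finset.range V, differ ((flipAt w i).getD j false) (ws j) =
      differ (w.getD j false) (ws j) +
        if i = j then 1 - 2 * differ (w.getD i false) (ws i) else 0 := by
    intro j _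
    rw [getD_flipAt w (hw ▸ hi)]
    rcases eq_or_ne i j with rfl | h
    · simp only [if_true]
      cases w.getD i false <;> cases ws i <;> norm_num [differ]
    · rw [if_neg h.symm, if_neg h, add_zero]
  rw [dist, Finset.sum_congr rfl this, Finset.sum_add_distrib, Finset.sum_ite_eq,
    if_pos (Finset.mem_range.mpr hi), ← dist]
  ring

namespace SearchState

variable {v B V : ℕ} {φ : CNF v}

/-- In the second phase, the two assignments to choose from; in the first phase, the present
assignment twice. -/
def options (φ : CNF v) (s : SearchState B V) : Bool × Str × Str :=
  match s.clause φ, s.phase with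
  | some C, true => (true, flipAt s.assign C.2.1.1, flipAt s.assign C.2.2.1)
  | _, _ => (false, s.assign, s.assign)

theorem options_of_none {s : SearchState B V} (h : s.clause φ = none) :
    s.options φ = (false, s.assign, s.assign) := by
  simp [options, h]

theorem options_of_false {s : SearchState B V} (h : s.phase = false) :
    s.options φ = (false, s.assign, s.assign) := by
  unfold options; split <;> simp_all

theorem options_of_true {s : SearchState B V} {C : Clause v} (hC : s.clause φ = some C)
    (h : s.phase = true) :
    s.options φ = (true, flipAt s.assign C.2.1.1, flipAt s.assign C.2.2.1) := by
  simp [options, hC, h]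

theorem length_options (s : SearchState B V) :
    (s.options φ).2.1.length = V ∧ (s.options φ).2.2.length = V := by
  unfold options; split <;> simp [s.length_assign]

/-- The number of flips already made and still to be made. -/
noncomputable def cost (φ : CNF v) (ws : ℕ → Bool) (s : SearchState B V) : ℝ :=
  val s.count + dist ws V s.assign +
    -- For a flip of variable `i`, the change of the distance plus 1 is 0 or 2, and it is 0 exactly
    -- if the bit was wrong. So half of the product is 2 if both options are bad and 0 otherwise. If
    -- there are no options, the product is 1, and the last term, controlled by the flag, removes
    -- the resulting 1/2. Written like this, the cost is a polynomial of degree two in the bits of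
    -- the state and its options, without case distinctions.
    (dist ws V (s.options φ).2.1 - dist ws V s.assign + 1) *
      (dist ws V (s.options φ).2.2 - dist ws V s.assign + 1) / 2 -
    (1 - bif (s.options φ).1 then 1 else 0) / 2

variable (ws : ℕ → Bool)

theorem cost_of_options {s : SearchState B V} (h : s.options φ = (false, s.assign, s.assign)) :
    s.cost φ ws = val s.count + dist ws V s.assign := by
  simp [cost, h]

/-- In the second phase two flips are wasted if neither remaining variable is wrong: one for the
forced bad flip and one to undo it. -/
theorem cost_of_true (hvV : v ≤ V) {s : SearchState B V} {C : Clause v}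
    (hC : s.clause φ = some C) (h : s.phase = true) :
    s.cost φ ws = val s.count + dist ws V s.assign +
      2 * (1 - differ (s.assign.getD C.2.1.1 false) (ws C.2.1.1)) *
        (1 - differ (s.assign.getD C.2.2.1 false) (ws C.2.2.1)) := by
  rw [cost, options_of_true hC h]
  dsimp only
  rw [dist_flipAt ws s.length_assign (C.2.1.1.2.trans_le hvV),
    dist_flipAt ws s.length_assign (C.2.2.1.2.trans_le hvV), cond_true]
  ring

theorem cost_move (hvV : v ≤ V) (s : SearchState B V) (h : allOnes s.count = false) (i : Fin v) :
    (s.move h i).cost φ ws = val s.count + dist ws V s.assign + 2 -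
      2 * differ (s.assign.getD i false) (ws i) := by
  rw [cost_of_options ws (options_of_false rfl)]
  simp only [move]
  rw [val_inc, dist_flipAt ws s.length_assign (i.2.trans_le hvV)]
  push_cast; ring

theorem le_cost (hvV : v ≤ V) (s : SearchState B V) :
    val s.count + dist ws V s.assign ≤ s.cost φ ws := by
  rcases hC : s.clause φ with _ | C
  · rw [cost_of_options ws (options_of_none hC)]
  · rcases hp : s.phase
    · rw [cost_of_options ws (options_of_false hp)]
    · rw [cost_of_true ws hvV hC hp]
      have h1 := differ_le (s.assign.getD C.2.1.1 false) (ws C.2.1.1)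
      have h2 := differ_le (s.assign.getD C.2.2.1 false) (ws C.2.2.1)
      have := mul_nonneg (sub_nonneg.mpr h1) (sub_nonneg.mpr h2)
      linarith

theorem cost_nonneg (hvV : v ≤ V) (s : SearchState B V) : 0 ≤ s.cost φ ws :=
  le_trans (add_nonneg (Nat.cast_nonneg _) (dist_nonneg _ _ _)) (le_cost ws hvV s)

/-- At most `2 ^ B - 1` flips made, distance at most `V`, and a penalty of at most 2. -/
theorem cost_le (hvV : v ≤ V) (s : SearchState B V) : s.cost φ ws ≤ 2 ^ B + V + 1 := by
  have hval : (val s.count : ℝ) + 1 ≤ 2 ^ B := by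
    have := val_lt s.count
    rw [s.length_count] at this
    exact_mod_cast this
  have hd := dist_le ws V s.assign
  rcases hC : s.clause φ with _ | C
  · rw [cost_of_options ws (options_of_none hC)]; linarith
  · rcases hp : s.phase
    · rw [cost_of_options ws (options_of_false hp)]; linarith
    · rw [cost_of_true ws hvV hC hp]
      have h1 := differ_nonneg (s.assign.getD C.2.1.1 false) (ws C.2.1.1)
      have h2 := differ_nonneg (s.assign.getD C.2.2.1 false) (ws C.2.2.1)
      have h3 := differ_le (s.assign.getD C.2.1.1 false) (ws C.2.1.1)
      have h4 := differ_le (s.assign.getD C.2.2.1 false) (ws C.2.2.1)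
      nlinarith

/-- The Bellman equations, for the cost. -/
theorem cost_next (hvV : v ≤ V) (hws : ∀ C ∈ φ, ws C.1.1 = C.1.2 ∨ ws C.2.1.1 = C.2.1.2 ∨
    ws C.2.2.1 = C.2.2.2) (s : SearchState B V) {C : Clause v} (hC : s.clause φ = some C) :
    (∀ a, ∀ t ∈ s.next φ a, s.cost φ ws ≤ t.cost φ ws) ∧
      ∃ a, ∃ t ∈ s.next φ a, t.cost φ ws = s.cost φ ws := by
  have hpass : s.pass.clause φ = some C := hC
  have hf := firstFalse_of_clause hC
  have hmem : C ∈ φ := List.mem_of_find?_eq_some hf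
  have heval : Clause.eval s.assign C = false := by
    have := List.find?_some hf
    simpa using this
  -- The heart of the local search: `ws` satisfies a clause that the present assignment falsifies,
  -- so they differ on one of its variables.
  have hu : differ (s.assign.getD C.1.1 false) (ws C.1.1) = 1 ∨
      differ (s.assign.getD C.2.1.1 false) (ws C.2.1.1) = 1 ∨
      differ (s.assign.getD C.2.2.1 false) (ws C.2.2.1) = 1 := by
    simp only [Clause.eval, Literal.eval, Bool.or_eq_false_iff, beq_eq_false_iff_ne] at heval
    obtain ⟨⟨h1, h2⟩, h3⟩ := heval
    rcases hws C hmem with h | h | h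
    · exact Or.inl (if_neg (h ▸ h1))
    · exact Or.inr (Or.inl (if_neg (h ▸ h2)))
    · exact Or.inr (Or.inr (if_neg (h ▸ h3)))
  have h01 : ∀ a b : Bool, differ a b = 0 ∨ differ a b = 1 := fun a b => by
    unfold differ; split_ifs <;> simp
  have e1 := cost_move (φ := φ) ws hvV s (allOnes_of_clause hC) C.1.1
  have e2 := cost_move (φ := φ) ws hvV s (allOnes_of_clause hC) C.2.1.1
  have e3 := cost_move (φ := φ) ws hvV s (allOnes_of_clause hC) C.2.2.1
  have e4 := cost_of_true ws hvV hpass rfl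
  simp only [next_of_some hC, Option.mem_def, Option.some.injEq, forall_eq', exists_eq_left',
    Bool.forall_bool, Bool.exists_bool]
  rcases hp : s.phase
  · have e := cost_of_options ws (options_of_false (φ := φ) hp)
    simp only
    rw [e, e1, e4]
    simp only [pass]
    -- All patterns of wrong bits are checked. If the first bit is wrong, flipping it keeps the
    -- cost; otherwise one of the other two is wrong, and passing keeps it.
    rcases h01 (s.assign.getD C.1.1 false) (ws C.1.1) with h1 | h1 <;>
    rcases h01 (s.assign.getD C.2.1.1 false) (ws C.2.1.1) with h2 | h2 <;>
    rcases h01 (s.assign.getD C.2.2.1 false) (ws C.2.2.1) with h3 | h3 <;>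
    rw [h1, h2, h3] at hu ⊢ <;> first | (norm_num at hu; done) | norm_num
  · have e := cost_of_true ws hvV hC hp
    simp only
    rw [e, e2, e3]
    rcases h01 (s.assign.getD C.2.1.1 false) (ws C.2.1.1) with h2 | h2 <;>
    rcases h01 (s.assign.getD C.2.2.1 false) (ws C.2.2.1) with h3 | h3 <;>
    rw [h2, h3] <;> norm_num

/-- The optimal value, if `ws` is a satisfying assignment. -/
noncomputable def value (r : ℕ) (φ : CNF v) (ws : ℕ → Bool) (s : SearchState B V) : ℝ :=
  -- Since `0 ≤ cost ≤ 2 ^ B + V + 1`, the base lies strictly between 0 and 1. The exponent makes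
  -- the value after a timeout tiny, at the price of a larger degree in the features.
  ((2 ^ B + V + 2 - s.cost φ ws) / (2 ^ B + V + 3)) ^ r

variable {r : ℕ}

theorem value_pos (hvV : v ≤ V) (s : SearchState B V) : 0 < s.value r φ ws := by
  have := cost_le (φ := φ) ws hvV s
  exact pow_pos (div_pos (by linarith) (by positivity)) _

/-- Strictness matters: the reward 0 must have positive probability everywhere, for the run with all
rewards 0 to be a possible one. -/
theorem value_lt_one (hvV : v ≤ V) (hr : r ≠ 0) (s : SearchState B V) : s.value r φ ws < 1 := by
  have h1 := cost_le (φ := φ) ws hvV s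
  have h2 := cost_nonneg (φ := φ) ws hvV s
  refine pow_lt_one₀ (div_nonneg (by linarith) (by positivity)) ?_ hr
  rw [div_lt_one (by positivity)]
  linarith

theorem value_le_value (hvV : v ≤ V) {s t : SearchState B V} (h : t.cost φ ws ≤ s.cost φ ws) :
    s.value r φ ws ≤ t.value r φ ws := by
  have := cost_le (φ := φ) ws hvV s
  rw [value, value]
  gcongr
  exact div_nonneg (by linarith) (by positivity)

/-- When the time is over, almost nothing can be gained. -/
theorem value_le_of_allOnes (hvV : v ≤ V) {s : SearchState B V} (h : allOnes s.count = true) :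
    s.value r φ ws ≤ ((V + 3) / 2 ^ B) ^ r := by
  have hval : (val s.count : ℝ) + 1 = 2 ^ B := by
    have := val_of_allOnes _ h
    rw [s.length_count] at this
    exact_mod_cast this
  have h1 := cost_le (φ := φ) ws hvV s
  have h2 := le_cost (φ := φ) ws hvV s
  have h3 := dist_nonneg ws V s.assign
  rw [value]
  refine pow_le_pow_left₀ (div_nonneg (by linarith) (by positivity)) ?_ _
  -- A full counter already contributes `2 ^ B - 1` to the cost, which leaves at most `V + 3` in the
  -- numerator.
  refine div_le_div₀ (by positivity) (by linarith) (by positivity) ?_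
  have : (0 : ℝ) ≤ V := Nat.cast_nonneg _
  linarith

/-- Initially the cost is only the distance, at most `V`, so the base is at least `1 - (V + 1) / (2
^ B + V + 3)`; Bernoulli's inequality handles the power. -/
theorem value_origin (φ : CNF v) : 1 - r * ((V + 1) / 2 ^ B) ≤ (origin B V).value r φ ws := by
  have hc : (origin B V).cost φ ws ≤ V := by
    rw [cost_of_options ws (options_of_false rfl)]
    simp only [origin, val_replicate_false, Nat.cast_zero, zero_add]
    exact dist_le _ _ _
  have hB : (0 : ℝ) < 2 ^ B := by positivity
  have hb : -2 ≤ -((V + 1 : ℝ) / (2 ^ B + V + 3)) := by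
    have : ((V : ℝ) + 1) / (2 ^ B + V + 3) ≤ 1 := by
      rw [div_le_one (by positivity)]; linarith
    linarith
  have h1 := one_add_mul_le_pow hb r
  have h2 : (V + 1 : ℝ) / (2 ^ B + V + 3) ≤ (V + 1) / 2 ^ B := by
    gcongr
    have : (0 : ℝ) ≤ V := Nat.cast_nonneg _
    linarith
  calc 1 - r * ((V + 1) / 2 ^ B) ≤ 1 + r * -((V + 1 : ℝ) / (2 ^ B + V + 3)) := by
        have : (r : ℝ) * ((V + 1 : ℝ) / (2 ^ B + V + 3)) ≤ r * ((V + 1) / 2 ^ B) := by gcongr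
        linarith
    _ ≤ (1 + -((V + 1 : ℝ) / (2 ^ B + V + 3))) ^ r := h1
    _ ≤ _ := by
        rw [value]
        have h3 : 1 + -((V + 1 : ℝ) / (2 ^ B + V + 3)) = (2 ^ B + 2) / (2 ^ B + V + 3) := by
          field_simp; ring
        rw [h3]
        gcongr
        linarith

end SearchState

end RL

namespace Machine

/-! ## Tensor powers of 0-1-vectors -/

/-- Tensor power. -/
def tpow (u : Str) : ℕ → Str
  | 0 => [true]
  | m + 1 => kron u (tpow u m)

theorem length_tpow (u : Str) (m : ℕ) : (tpow u m).length = u.length ^ m := by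
  induction m with
  | zero => rfl
  | succ m ih => rw [tpow, length_kron, ih, pow_succ, mul_comm]

theorem tpow_one (u : Str) : tpow u 1 = u := by
  have : (fun b : Bool => bif b then [true] else [false]) = fun b => [b] := by
    funext b; cases b <;> rfl
  simp [tpow, kron, this]

/-- Scalar product with a 0-1-vector. -/
def dot : (ℕ → ℝ) → Str → ℝ
  | _, [] => 0
  | θ, b :: l => (bif b then θ 0 else 0) + dot (fun i => θ (i + 1)) l

theorem dot_congr {θ θ' : ℕ → ℝ} {l : Str} (h : ∀ i < l.length, θ i = θ' i) :
    dot θ l = dot θ' l := by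
  induction l generalizing θ θ' with
  | nil => rfl
  | cons b l ih =>
    rw [dot, dot, h 0 (by simp), ih fun i hi => h (i + 1) (by simpa using hi)]

theorem dot_append (θ : ℕ → ℝ) (l l' : Str) :
    dot θ (l ++ l') = dot θ l + dot (fun i => θ (i + l.length)) l' := by
  induction l generalizing θ with
  | nil => simp [dot]
  | cons b l ih => simp [dot, ih, add_assoc]

theorem dot_replicate_false (θ : ℕ → ℝ) (n : ℕ) : dot θ (List.replicate n false) = 0 := by
  induction n generalizing θ with
  | zero => rfl
  | succ n ih => simp [List.replicate_succ, dot, ih]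

theorem dot_smul (c : ℝ) (θ : ℕ → ℝ) (l : Str) : dot (fun i => c * θ i) l = c * dot θ l := by
  induction l generalizing θ with
  | nil => simp [dot]
  | cons b l ih => cases b <;> simp [dot, ih, mul_add]

theorem dot_add (θ θ' : ℕ → ℝ) (l : Str) :
    dot (fun i => θ i + θ' i) l = dot θ l + dot θ' l := by
  induction l generalizing θ θ' with
  | nil => simp [dot]
  | cons b l ih => cases b <;> simp [dot, ih]; ring

/-- Position `i` of the Kronecker product belongs to the pair `(i / w.length, i % w.length)`. -/
theorem dot_kron (a θ : ℕ → ℝ) (u w : Str) (hw : 0 < w.length) :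
    dot (fun i => a (i / w.length) * θ (i % w.length)) (kron u w) = dot a u * dot θ w := by
  induction u generalizing a with
  | nil => simp [kron, dot]
  | cons b u ih =>
    have h1 : kron (b :: u) w = (bif b then w else List.replicate w.length false) ++ kron u w := by
      simp [kron]
    have hl : (bif b then w else List.replicate w.length false).length = w.length := by
      cases b <;> simp
    rw [h1, dot_append, hl, dot, add_mul, ← ih]
    congr 1
    · cases b
      · simp [dot_replicate_false]
      · rw [cond_true, cond_true, ← dot_smul]
        refine dot_congr fun i hi => ?_
        rw [Nat.div_eq_of_lt hi, Nat.mod_eq_of_lt hi]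
    · refine dot_congr fun i _ => ?_
      rw [Nat.add_div_right _ hw, Nat.add_mod_right]

/-- A bit as a number. -/
def bit (b : Bool) : ℝ := bif b then 1 else 0

theorem dot_eq_sum (θ : ℕ → ℝ) (l : Str) :
    dot θ l = ∑ i ∈ Finset.range l.length, θ i * bit (l.getD i false) := by
  induction l generalizing θ with
  | nil => rfl
  | cons b l ih =>
    rw [dot, ih, List.length_cons, Finset.sum_range_succ']
    cases b <;> simp [bit, add_comm]

section Linear

variable {X : Type} {u : X → Str} {n : ℕ}

/-- Linear functions of tensor powers. -/
def TensorLinear (u : X → Str) (m : ℕ) (f : X → ℝ) : Prop := ∃ θ, ∀ x, f x = dot θ (tpow (u x) m)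

namespace TensorLinear

theorem add {m : ℕ} {f g : X → ℝ} (hf : TensorLinear u m f) (hg : TensorLinear u m g) :
    TensorLinear u m (fun x => f x + g x) := by
  obtain ⟨θ, hθ⟩ := hf
  obtain ⟨θ', hθ'⟩ := hg
  exact ⟨fun i => θ i + θ' i, fun x => by dsimp only; rw [hθ, hθ', dot_add]⟩

theorem smul {m : ℕ} {f : X → ℝ} (c : ℝ) (hf : TensorLinear u m f) :
    TensorLinear u m (fun x => c * f x) := by
  obtain ⟨θ, hθ⟩ := hf
  exact ⟨fun i => c * θ i, fun x => by dsimp only; rw [hθ, dot_smul]⟩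

theorem sum {m : ℕ} {ι : Type} (s : Finset ι) {f : ι → X → ℝ}
    (hf : ∀ i, TensorLinear u m (f i)) : TensorLinear u m (fun x => ∑ i ∈ s, f i x) := by
  classical
  induction s using Finset.induction_on with
  | empty => exact ⟨fun _ => 0, fun x => by
      have := dot_smul 0 (fun _ => 0) (tpow (u x) m)
      simp only [zero_mul] at this
      rw [this]; simp⟩
  | insert a s ha ih =>
    simp only [Finset.sum_insert ha]
    exact (hf a).add ih

theorem one : TensorLinear u 0 (fun _ => 1) := ⟨fun _ => 1, fun x => by simp [tpow, dot]⟩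

/-- The product of two linear forms is a linear form of the tensor product. The vectors need a
common length, because the splitting of the indices must not depend on `x`. -/
theorem mul (hu : ∀ x, (u x).length = n) (hn : 0 < n) {m : ℕ} {f g : X → ℝ}
    (hf : TensorLinear u 1 f) (hg : TensorLinear u m g) :
    TensorLinear u (m + 1) (fun x => f x * g x) := by
  obtain ⟨θ, hθ⟩ := hf
  obtain ⟨θ', hθ'⟩ := hg
  refine ⟨fun i => θ (i / n ^ m) * θ' (i % n ^ m), fun x => ?_⟩
  have hlen : (tpow (u x) m).length = n ^ m := by rw [length_tpow, hu]
  dsimp only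
  rw [hθ, hθ', tpow_one, tpow, ← dot_kron _ _ _ _ (by rw [hlen]; positivity), hlen]

theorem coordinate (hu : ∀ x, (u x).length = n) {i : ℕ} (hi : i < n) :
    TensorLinear u 1 (fun x => bit ((u x).getD i false)) := by
  refine ⟨fun j => if j = i then 1 else 0, fun x => ?_⟩
  rw [tpow_one, dot_eq_sum]
  simp [hu, hi]

end TensorLinear

end Linear

end Machine

/-! ### The value as a polynomial of degree `2r` in the bits of a state -/

namespace RL

open Machine ThreeSat

namespace SearchState

variable {v B V : ℕ} {φ : CNF v}

/-- The vector the features are built from. -/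
def vector (φ : CNF v) (s : SearchState B V) : Str :=
  true :: (s.options φ).1 :: (s.count ++ (s.assign ++ ((s.options φ).2.1 ++ (s.options φ).2.2)))

theorem length_vector (s : SearchState B V) : (s.vector φ).length = 2 + B + 3 * V := by
  have := s.length_options (φ := φ)
  simp [vector, s.length_count, s.length_assign, this]
  ring

theorem val_eq_sum (l : Str) :
    (val l : ℝ) = ∑ i ∈ Finset.range l.length, 2 ^ i * bit (l.getD i false) := by
  induction l with
  | nil => simp [val]
  | cons b l ih =>
    rw [List.length_cons, Finset.sum_range_succ', val]
    push_cast
    rw [ih, Finset.mul_sum, add_comm]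
    congr 1
    · refine Finset.sum_congr rfl fun i _ => ?_
      rw [List.getD_cons_succ]; ring
    · cases b <;> simp [bit]

theorem tensorLinear_coordinate {i : ℕ} (hi : i < 2 + B + 3 * V) :
    TensorLinear (vector φ : SearchState B V → Str) 1 (fun s => bit ((s.vector φ).getD i false)) :=
  .coordinate length_vector hi

theorem tensorLinear_one :
    TensorLinear (vector φ : SearchState B V → Str) 1 (fun _ => 1) := by
  have := tensorLinear_coordinate (φ := φ) (B := B) (V := V) (i := 0) (by omega)
  simpa [vector, bit] using this

theorem tensorLinear_val :
    TensorLinear (vector φ : SearchState B V → Str) 1 (fun s => val s.count) := by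
  -- The test `i < B` is always passed in this range; it is there because `TensorLinear.sum` asks
  -- for tensor linearity of the summand for every index.
  have : ∀ s : SearchState B V, (val s.count : ℝ) =
      ∑ i ∈ Finset.range B,
        2 ^ i * (if i < B then bit ((s.vector φ).getD (i + 2) false) else 0) := by
    intro s
    rw [val_eq_sum, s.length_count]
    refine Finset.sum_congr rfl fun i hi => ?_
    rw [Finset.mem_range] at hi
    rw [if_pos hi, vector, List.getD_cons_succ, List.getD_cons_succ,
      List.getD_append _ _ _ _ (by rw [s.length_count]; exact hi)]
  simp only [this]
  refine .sum _ fun i => .smul _ ?_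
  split_ifs with hi
  · exact tensorLinear_coordinate (by omega)
  · simpa using tensorLinear_one.smul 0

/-- For bits, `|b - c| = c + (1 - 2c) b` is affine in `b`, and the leading coordinate 1 of the
vector supplies constants. `k` is the offset of the block in which `w s` is stored. -/
theorem tensorLinear_dist (ws : ℕ → Bool) (k : ℕ) (hk : k + V ≤ 2 + B + 3 * V)
    (w : SearchState B V → Str)
    (hw : ∀ s, ∀ i < V, (s.vector φ).getD (i + k) false = (w s).getD i false) :
    TensorLinear (vector φ : SearchState B V → Str) 1 (fun s => dist ws V (w s)) := by
  have : ∀ s : SearchState B V, dist ws V (w s) =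
      ∑ i ∈ Finset.range V, (bit (ws i) * 1 + (1 - 2 * bit (ws i)) *
        (if i < V then bit ((s.vector φ).getD (i + k) false) else 0)) := by
    intro s
    refine Finset.sum_congr rfl fun i hi => ?_
    rw [Finset.mem_range] at hi
    rw [if_pos hi, hw s i hi]
    cases (w s).getD i false <;> cases ws i <;> norm_num [differ, bit]
  simp only [this]
  refine .sum _ fun i => (tensorLinear_one.smul _).add (.smul _ ?_)
  split_ifs with hi
  · exact tensorLinear_coordinate (by omega)
  · simpa using tensorLinear_one.smul 0

/-- The base of the power is a linear form plus a product of two linear forms, hence quadratic in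
the coordinates of `vector`; each of the `r` factors adds two tensor factors. -/
theorem tensorLinear_value (r : ℕ) (ws : ℕ → Bool) :
    TensorLinear (vector φ : SearchState B V → Str) (2 * r) (value r φ ws) := by
  have hlen : ∀ s : SearchState B V, (s.vector φ).length = 2 + B + 3 * V := length_vector
  have hn : 0 < 2 + B + 3 * V := by omega
  have ho := fun s : SearchState B V => s.length_options (φ := φ)
  have h0 := tensorLinear_dist (φ := φ) (B := B) (V := V) ws (2 + B) (by omega) (fun s => s.assign)
    (fun s i hi => by
      rw [vector, show i + (2 + B) = (i + B) + 1 + 1 by omega, List.getD_cons_succ,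
        List.getD_cons_succ, List.getD_append_right _ _ _ _ (by rw [s.length_count]; omega),
        s.length_count, Nat.add_sub_cancel,
        List.getD_append _ _ _ _ (by rw [s.length_assign]; exact hi)])
  have h1 := tensorLinear_dist (φ := φ) (B := B) (V := V) ws (2 + B + V) (by omega)
    (fun s => (s.options φ).2.1)
    (fun s i hi => by
      rw [vector, show i + (2 + B + V) = (i + V + B) + 1 + 1 by omega, List.getD_cons_succ,
        List.getD_cons_succ, List.getD_append_right _ _ _ _ (by rw [s.length_count]; omega),
        s.length_count, Nat.add_sub_cancel,
        List.getD_append_right _ _ _ _ (by rw [s.length_assign]; omega),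
        s.length_assign, Nat.add_sub_cancel, List.getD_append _ _ _ _ (by rw [(ho s).1]; exact hi)])
  have h2 := tensorLinear_dist (φ := φ) (B := B) (V := V) ws (2 + B + V + V) (by omega)
    (fun s => (s.options φ).2.2)
    (fun s i hi => by
      rw [vector, show i + (2 + B + V + V) = (i + V + V + B) + 1 + 1 by omega, List.getD_cons_succ,
        List.getD_cons_succ, List.getD_append_right _ _ _ _ (by rw [s.length_count]; omega),
        s.length_count, Nat.add_sub_cancel,
        List.getD_append_right _ _ _ _ (by rw [s.length_assign]; omega),
        s.length_assign, Nat.add_sub_cancel,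
        List.getD_append_right _ _ _ _ (by rw [(ho s).1]; omega), (ho s).1, Nat.add_sub_cancel])
  have h3 : TensorLinear (vector φ : SearchState B V → Str) 1
      (fun s => bit (s.options φ).1) := by
    have := tensorLinear_coordinate (φ := φ) (B := B) (V := V) (i := 1) (by omega)
    simpa [vector] using this
  set c : ℝ := (2 ^ B + V + 3)⁻¹
  have hL := ((((tensorLinear_one.smul (2 ^ B + V + 2 + 1 / 2 : ℝ)).add
    (tensorLinear_val.smul (-1))).add (h0.smul (-1))).add (h3.smul (-1 / 2))).smul c
  have hA := ((h1.add (h0.smul (-1))).add tensorLinear_one).smul (-c / 2)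
  have hB := (h2.add (h0.smul (-1))).add tensorLinear_one
  have hval : ∀ s : SearchState B V, value r φ ws s = (c * ((2 ^ B + V + 2 + 1 / 2 : ℝ) * 1 +
      -1 * val s.count + -1 * dist ws V s.assign + -1 / 2 * bit (s.options φ).1) * 1 +
      (-c / 2 * (dist ws V (s.options φ).2.1 + -1 * dist ws V s.assign + 1)) *
      (dist ws V (s.options φ).2.2 + -1 * dist ws V s.assign + 1)) ^ r := by
    intro s
    rw [value, cost, div_eq_mul_inv]
    congr 1
    simp only [bit]
    ring
  rw [funext hval]
  clear hval
  induction r with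
  | zero => simpa using TensorLinear.one
  | succ r ih =>
    -- Tensor powers of different degrees cannot be added, so the linear part is multiplied by the
    -- coordinate 1 to have degree two as well.
    have e1 := hL.mul hlen hn (tensorLinear_one.mul hlen hn ih)
    have e2 := hA.mul hlen hn (hB.mul hlen hn ih)
    obtain ⟨θ, hθ⟩ := e1.add e2
    refine ⟨θ, fun s => ?_⟩
    rw [show 2 * (r + 1) = 2 * r + 1 + 1 by ring, ← hθ s]
    dsimp only
    rw [pow_succ]
    ring

end SearchState

end RL

namespace RL

open Machine ThreeSat

/-! ## The instances of `Linear-2-RL` -/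

/-- A satisfying assignment, if there is one. -/
noncomputable def witness {v : ℕ} (φ : CNF v) (i : ℕ) : Bool :=
  open Classical in if h : Satisfiable φ then (if hi : i < v then h.choose ⟨i, hi⟩ else false)
  else false

theorem witness_spec {v : ℕ} {φ : CNF v} (h : Satisfiable φ) :
    ∀ C ∈ φ, witness φ C.1.1 = C.1.2 ∨ witness φ C.2.1.1 = C.2.1.2 ∨
      witness φ C.2.2.1 = C.2.2.2 := by
  intro C hC
  have := h.choose_spec C hC
  simpa [witness, h] using this

open Classical in
/-- The probability of a reward. -/
noncomputable def rewardProb {v : ℕ} (φ : CNF v) {B V : ℕ} (r : ℕ) (s : SearchState B V) : ℝ≥0∞ :=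
  min 1 (if Satisfiable φ then ENNReal.ofReal (s.value r φ (witness φ)) else 0)

theorem rewardProb_le_one {v : ℕ} (φ : CNF v) {B V : ℕ} (r : ℕ) (s : SearchState B V) :
    rewardProb φ r s ≤ 1 := min_le_left _ _

/-- The decision process of a formula. -/
noncomputable def formulaMDP {v : ℕ} (φ : CNF v) (B V r : ℕ) : MDP :=
  searchMDP φ B V (rewardProb φ r) (rewardProb_le_one φ r)

/-- The features: tensor powers. -/
noncomputable def formulaFeatures {v : ℕ} (φ : CNF v) (B V r : ℕ) :
    (formulaMDP φ B V r).Features ((2 + B + 3 * V) ^ (2 * r)) where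
  onState (s : SearchState B V) i :=
    bif (tpow (s.vector φ) (2 * r)).getD i false then 1 else 0
  onPair (s : SearchState B V) a i :=
    bif (tpow (((s.next φ a).getD s).vector φ) (2 * r)).getD i false then 1 else 0

namespace formulaMDP

variable {v B V r : ℕ} {φ : CNF v}

/-- The truncation at 1 only serves to make `rewardProb` a probability unconditionally; here it has
no effect. -/
theorem toReal_rewardProb (h : Satisfiable φ) (hvV : v ≤ V) (hr : r ≠ 0) (s : SearchState B V) :
    (rewardProb φ r s).toReal = s.value r φ (witness φ) := by
  have h1 := SearchState.value_pos (φ := φ) (r := r) (witness φ) hvV s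
  have h2 := SearchState.value_lt_one (φ := φ) (witness φ) hvV hr s
  rw [rewardProb, if_pos h, min_eq_right, ENNReal.toReal_ofReal h1.le]
  simpa using h2.le

theorem rewardProb_lt_one (hvV : v ≤ V) (hr : r ≠ 0) (s : SearchState B V) :
    rewardProb φ r s < 1 := by
  refine min_lt_iff.mpr (Or.inr ?_)
  split_ifs
  · have h2 := SearchState.value_lt_one (φ := φ) (witness φ) hvV hr s
    simpa using h2
  · exact one_pos

theorem rewardProb_le (hvV : v ≤ V) {s : SearchState B V} (h : allOnes s.count = true) :
    rewardProb φ r s ≤ ENNReal.ofReal (((V + 3) / 2 ^ B) ^ r) := by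
  refine (min_le_right _ _).trans ?_
  split_ifs
  · exact ENNReal.ofReal_le_ofReal (SearchState.value_le_of_allOnes _ hvV h)
  · exact zero_le

theorem bellman (hvV : v ≤ V) (hr : r ≠ 0) (s : SearchState B V) {C : Clause v}
    (hC : s.clause φ = some C) :
    (∀ a, ∀ t ∈ s.next φ a, (rewardProb φ r t).toReal ≤ (rewardProb φ r s).toReal) ∧
      ∃ a, ∃ t ∈ s.next φ a, (rewardProb φ r t).toReal = (rewardProb φ r s).toReal := by
  by_cases hs : Satisfiable φ
  · obtain ⟨h1, a, t, ht, h2⟩ := SearchState.cost_next (witness φ) hvV (witness_spec hs) s hC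
    simp only [toReal_rewardProb hs hvV hr]
    refine ⟨fun a t ht => SearchState.value_le_value _ hvV (h1 a t ht), a, t, ht, ?_⟩
    rw [SearchState.value, SearchState.value, h2]
  · have : ∀ t : SearchState B V, rewardProb φ r t = 0 := fun t => by simp [rewardProb, hs]
    simp [this, SearchState.next_of_some hC]

/-- The expected rewards at the end are chosen as the proposed values, so the Bellman equations hold
there by definition; elsewhere they are `bellman`. Replacing a missing successor by the state itself
gives one formula for `QStar` in both cases, so that a pair can have the features of a state. -/
theorem optimal (hvV : v ≤ V) (hr : r ≠ 0) :
    (∀ s : SearchState B V,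
      (formulaMDP φ B V r).VStar s = (rewardProb φ r s).toReal) ∧
    ∀ (s : SearchState B V) a,
      (formulaMDP φ B V r).QStar s a = (rewardProb φ r ((s.next φ a).getD s)).toReal := by
  have key : ∀ (s : SearchState B V) a, (formulaMDP φ B V r).meanReward s a +
      ((formulaMDP φ B V r).next s a).elim 0 (fun t => (rewardProb φ r t).toReal) =
      (rewardProb φ r ((s.next φ a).getD s)).toReal := by
    intro s a
    rcases hC : s.clause φ with _ | C
    · have h1 : (formulaMDP φ B V r).meanReward s a = (rewardProb φ r s).toReal :=
        searchMDP.meanReward_of_none hC a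
      have h2 : (s.next φ a).elim 0 (fun t => (rewardProb φ r t).toReal) = 0 := by
        rw [SearchState.next_of_none hC]; rfl
      rw [SearchState.next_of_none hC]
      exact (congrArg₂ (· + ·) h1 h2).trans (add_zero _)
    · have h1 : (formulaMDP φ B V r).meanReward s a = 0 := searchMDP.meanReward_of_some hC a
      have h2 : (s.next φ a).elim 0 (fun t => (rewardProb φ r t).toReal) =
          (rewardProb φ r ((s.next φ a).getD s)).toReal := by
        rw [SearchState.next_of_some hC]; rfl
      exact (congrArg₂ (· + ·) h1 h2).trans (zero_add _)
  have := MDP.exists_optimal (M := formulaMDP φ B V r)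
    (G := fun t : SearchState B V => (rewardProb φ r t).toReal)
    (fun s => ENNReal.toReal_nonneg)
    (fun s a => by
      refine (key s a).trans_le ?_
      rcases hC : SearchState.clause φ s with _ | C
      · rw [SearchState.next_of_none hC]; exact le_rfl
      · rw [SearchState.next_of_some hC]
        exact (bellman hvV hr s hC).1 a _ (SearchState.next_of_some hC a))
    (fun s => by
      rcases hC : SearchState.clause φ s with _ | C
      · refine ⟨true, (key s true).trans ?_⟩
        rw [SearchState.next_of_none hC]; rfl
      · obtain ⟨a, t, ht, h⟩ := (bellman hvV hr s hC).2
        refine ⟨a, (key s a).trans ?_⟩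
        rw [Option.mem_def.mp ht]
        exact h)
  exact ⟨this.1, fun s a => (this.2 s a).trans (key s a)⟩

/-- For an unsatisfiable formula all values vanish and the zero vector serves; otherwise the
coefficients come from `tensorLinear_value`. -/
theorem linear (hvV : v ≤ V) (hr : r ≠ 0) : (formulaFeatures φ B V r).Linear := by
  obtain ⟨θ, hθ⟩ : ∃ θ : ℕ → ℝ, ∀ s : SearchState B V,
      (rewardProb φ r s).toReal = dot θ (tpow (s.vector φ) (2 * r)) := by
    by_cases hs : Satisfiable φ
    · obtain ⟨θ, hθ⟩ := SearchState.tensorLinear_value (φ := φ) (B := B) (V := V) r (witness φ)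
      exact ⟨θ, fun s => (toReal_rewardProb hs hvV hr s).trans (hθ s)⟩
    · refine ⟨fun _ => 0, fun s => ?_⟩
      rw [dot_eq_sum]
      simp [rewardProb, hs]
  have key : ∀ s : SearchState B V, (rewardProb φ r s).toReal =
      ∑ i : Fin ((2 + B + 3 * V) ^ (2 * r)), θ i *
        ((bif (tpow (s.vector φ) (2 * r)).getD i false then 1 else 0 : ℚ) : ℝ) := by
    intro s
    rw [hθ, dot_eq_sum, length_tpow, SearchState.length_vector,
      ← Fin.sum_univ_eq_sum_range (fun i => θ i * bit ((tpow (s.vector φ) (2 * r)).getD i false))]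
    refine Finset.sum_congr rfl fun i _ => ?_
    cases (tpow (s.vector φ) (2 * r)).getD i false <;> simp [bit]
  obtain ⟨h1, h2⟩ := optimal (B := B) (φ := φ) hvV hr
  exact ⟨fun i => θ i, fun s => (h1 s).trans (key s), fun s a => (h2 s a).trans (key _)⟩

theorem decode_code (s : SearchState B V) : (formulaMDP φ B V r).decode s.code = some s := by
  have h : ∃ t, (formulaMDP φ B V r).code t = s.code := ⟨s, rfl⟩
  rw [MDP.decode, dif_pos h]
  exact congrArg some (SearchState.code_injective h.choose_spec)

theorem decode_of_length {x : Str} (h : x.length ≠ 1 + B + V) :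
    (formulaMDP φ B V r).decode x = none := by
  rw [MDP.decode, dif_neg]
  rintro ⟨s, rfl⟩
  exact h (SearchState.length_code s)

theorem encRat_zero : encRat 0 = [false, false, true, true, false] := by
  simp [encRat, encNat]

theorem encRat_one : encRat 1 = [false, true, true, false, true, true, false] := by
  simp [encRat, encNat]

theorem length_encRat_zero : (encRat 0).length = 5 := by rw [encRat_zero]; rfl

theorem length_encRat_one : (encRat 1).length = 7 := by rw [encRat_one]; rfl

theorem encVector_eq {d : ℕ} {l : Str} (h : l.length = d) :
    MDP.encVector (fun i : Fin d => bif l.getD i false then 1 else 0) =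
      l.flatMap fun b => bif b then encRat 1 else encRat 0 := by
  subst h
  rw [MDP.encVector, List.flatMap_def]
  congr 1
  refine List.ext_getElem (by simp) fun i h1 h2 => ?_
  have : i < l.length := by simpa using h1
  simp only [List.getElem_ofFn, List.getElem_map, List.getD_eq_getElem?_getD,
    List.getElem?_eq_getElem this, Option.getD_some]
  cases l[i] <;> rfl

theorem length_flatMap_encRat (l : Str) :
    (l.flatMap fun b => bif b then encRat 1 else encRat 0).length ≤ 7 * l.length := by
  induction l with
  | nil => simp
  | cons b l ih =>
    rw [List.flatMap_cons, List.length_append, List.length_cons]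
    cases b
    · rw [cond_false, length_encRat_zero]; omega
    · rw [cond_true, length_encRat_one]; omega

/-- The answers of the oracle if there were no rewards. -/
noncomputable def answer (φ : CNF v) (B V r : ℕ) : Str → Str
  | false :: false :: _ :: x => ((formulaMDP φ B V r).decode x).elim [] fun _ => encRat 0
  | false :: true :: a :: x => ((formulaMDP φ B V r).decode x).elim [] fun s =>
      (formulaMDP φ B V r).encNext ((formulaMDP φ B V r).next s a)
  | true :: false :: x => ((formulaMDP φ B V r).decode x).elim [] fun s =>
      MDP.encVector ((formulaFeatures φ B V r).onState s)
  | true :: true :: a :: x => ((formulaMDP φ B V r).decode x).elim [] fun s =>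
      MDP.encVector ((formulaFeatures φ B V r).onPair s a)
  | _ => []

/-- Each answer of the oracle is the answer to a reward query, or the only possible one. -/
theorem oracle_cases (q : Str) :
    (∃ (a : Bool) (s : SearchState B V), q.drop 3 = s.code ∧
      (formulaMDP φ B V r).oracle (formulaFeatures φ B V r) q =
        ((formulaMDP φ B V r).reward s a).map encRat ∧ answer φ B V r q = encRat 0) ∨
    (formulaMDP φ B V r).oracle (formulaFeatures φ B V r) q = PMF.pure (answer φ B V r q) := by
  rcases q with _ | ⟨_ | _, _ | ⟨_ | _, q⟩⟩
  · right; rfl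
  · right; rfl
  · rcases q with _ | ⟨a, x⟩
    · right; rfl
    · by_cases hx : x.length = 1 + B + V
      · obtain ⟨s, rfl⟩ := SearchState.exists_code hx
        left
        refine ⟨a, s, rfl, ?_, ?_⟩
        · rw [MDP.oracle, decode_code]; rfl
        · rw [answer, decode_code]; rfl
      · right
        rw [MDP.oracle, answer, decode_of_length hx]; rfl
  · rcases q with _ | ⟨a, x⟩
    · right; rfl
    · right
      rw [MDP.oracle, answer]
      rcases (formulaMDP φ B V r).decode x <;> rfl
  · right; rfl
  · right
    rw [MDP.oracle, answer]
    rcases (formulaMDP φ B V r).decode q <;> rfl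
  · rcases q with _ | ⟨a, x⟩
    · right; rfl
    · right
      rw [MDP.oracle, answer]
      rcases (formulaMDP φ B V r).decode x <;> rfl

theorem reward_of_none {s : SearchState B V} (h : s.clause φ = none) (a : Bool) :
    (formulaMDP φ B V r).reward s a = coin (rewardProb φ r s) (rewardProb_le_one φ r s) := if_pos h

theorem reward_of_some {s : SearchState B V} {C : Clause v} (h : s.clause φ = some C) (a : Bool) :
    (formulaMDP φ B V r).reward s a = PMF.pure 0 := if_neg (by simp [h])

/-- All reward probabilities are below 1, so the answer 0 to a reward query is always possible. -/
theorem answer_mem_support (hvV : v ≤ V) (hr : r ≠ 0) (q : Str) :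
    answer φ B V r q ∈
      ((formulaMDP φ B V r).oracle (formulaFeatures φ B V r) q).support := by
  rcases oracle_cases (φ := φ) (B := B) (V := V) (r := r) q with ⟨a, s, -, h1, h2⟩ | h
  · rw [h1, h2, PMF.support_map]
    refine ⟨0, ?_, rfl⟩
    rcases hC : s.clause φ with _ | C
    · rw [reward_of_none hC, PMF.mem_support_iff, coin_zero]
      exact (tsub_pos_of_lt (rewardProb_lt_one hvV hr s)).ne'
    · rw [reward_of_some hC]; simp
  · rw [h]; simp

/-- The answer is almost certain, unless a satisfying assignment has been found. -/
theorem one_le_answer_add (hvV : v ≤ V) (q : Str) :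
    (∃ s : SearchState B V, q.drop 3 = s.code ∧ firstFalse φ s.assign = none) ∨
      1 ≤ (formulaMDP φ B V r).oracle (formulaFeatures φ B V r) q (answer φ B V r q) +
        ENNReal.ofReal (((V + 3) / 2 ^ B) ^ r) := by
  rcases oracle_cases (φ := φ) (B := B) (V := V) (r := r) q with ⟨a, s, h0, h1, h2⟩ | h
  · by_cases hf : firstFalse φ s.assign = none
    · exact Or.inl ⟨s, h0, hf⟩
    right
    have hle : (formulaMDP φ B V r).reward s a 0 ≤
        ((formulaMDP φ B V r).reward s a).map encRat (encRat 0) := by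
      rw [PMF.map_apply]
      refine le_trans ?_ (ENNReal.le_tsum (0 : ℚ))
      rw [if_pos rfl]
    rw [h1, h2]
    refine le_trans ?_ (add_le_add_left hle _)
    rcases hC : s.clause φ with _ | C
    -- No clause is left to repair although one is falsified, so the time is over and the reward is
    -- improbable.
    · have hcount : allOnes s.count = true := by
        by_contra h'
        rw [SearchState.clause, if_neg h'] at hC
        exact hf hC
      rw [reward_of_none hC, coin_zero]
      refine le_trans ?_ (add_le_add_right (rewardProb_le (φ := φ) hvV hcount) _)
      rw [tsub_add_cancel_of_le (rewardProb_le_one φ r s)]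
    · rw [reward_of_some hC]; simp
  · right; rw [h]; simp

/-- The longest answers are feature vectors: `d` coordinates with codes of at most seven bits each.
-/
theorem length_answer {d : ℕ} (hd : d = (2 + B + 3 * V) ^ (2 * r)) (hr : r ≠ 0) (q : Str) :
    (answer φ B V r q).length ≤ 7 * d := by
  have hn : 2 + B + 3 * V ≤ d := by rw [hd]; exact Nat.le_self_pow (by omega) _
  have hvec : ∀ s : SearchState B V, (MDP.encVector (fun i : Fin ((2 + B + 3 * V) ^ (2 * r)) =>
      bif (tpow (s.vector φ) (2 * r)).getD i false then 1 else 0)).length ≤ 7 * d := fun s => by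
    have hl : (tpow (s.vector φ) (2 * r)).length = (2 + B + 3 * V) ^ (2 * r) := by
      rw [length_tpow, SearchState.length_vector]
    rw [encVector_eq hl]
    refine (length_flatMap_encRat _).trans ?_
    rw [hl, hd]
  have key : ∀ (x : Str) (f : SearchState B V → Str), (∀ s, (f s).length ≤ 7 * d) →
      (((formulaMDP φ B V r).decode x).elim [] f).length ≤ 7 * d := by
    intro x f hf
    rcases (formulaMDP φ B V r).decode x with _ | s
    · exact Nat.zero_le _
    · exact hf s
  rcases q with _ | ⟨_ | _, _ | ⟨_ | _, q⟩⟩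
  · simp [answer]
  · simp [answer]
  · rcases q with _ | ⟨a, x⟩
    · simp [answer]
    · rw [answer]
      refine key x _ fun s => ?_
      rw [length_encRat_zero]; omega
  · rcases q with _ | ⟨a, x⟩
    · simp [answer]
    · rw [answer]
      refine key x _ fun s => ?_
      rcases (formulaMDP φ B V r).next s a with _ | t
      · simp [MDP.encNext]; omega
      · have : ((formulaMDP φ B V r).code t).length = 1 + B + V := SearchState.length_code t
        rw [MDP.encNext, List.length_cons, this]; omega
  · simp [answer]
  · rw [answer]
    exact key q _ fun s => hvec s
  · rcases q with _ | ⟨a, x⟩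
    · simp [answer]
    · rw [answer]
      exact key x _ fun s => hvec ((SearchState.next φ s a).getD s)

/-- The constant 8 covers everything: horizon `2 * 2 ^ B ≤ 2 d`, state codes shorter than `d`, and
answers of at most `7 d` bits. -/
theorem isInstance (hvV : v ≤ V) (hr : r ≠ 0) (hB : 2 ^ B ≤ (2 + B + 3 * V) ^ (2 * r)) :
    (formulaMDP φ B V r).IsInstance 8 ((2 + B + 3 * V) ^ (2 * r)) (formulaFeatures φ B V r) := by
  have hn : 2 + B + 3 * V ≤ (2 + B + 3 * V) ^ (2 * r) := Nat.le_self_pow (by omega) _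
  have hd8 : (2 + B + 3 * V) ^ (2 * r) ≤ ((2 + B + 3 * V) ^ (2 * r)) ^ 8 :=
    Nat.le_self_pow (by norm_num) _
  refine ⟨linear hvV hr, ?_, fun s => ?_, fun q y hy => ?_⟩
  · change 2 * 2 ^ B ≤ _
    omega
  · have : ((formulaMDP φ B V r).code s).length = 1 + B + V := SearchState.length_code s
    omega
  · rcases oracle_cases (φ := φ) (B := B) (V := V) (r := r) q with ⟨a, s, -, h1, -⟩ | h
    · rw [h1, PMF.support_map] at hy
      obtain ⟨x, hx, rfl⟩ := hy
      have : x = 0 ∨ x = 1 := by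
        rcases hC : s.clause φ with _ | C
        · rw [reward_of_none hC] at hx; exact support_coin _ _ _ hx
        · rw [reward_of_some hC] at hx; left; simpa using hx
      rcases this with rfl | rfl
      · rw [length_encRat_zero]; omega
      · rw [length_encRat_one]; omega
    · rw [h, PMF.support_pure, Set.mem_singleton_iff] at hy
      rw [hy]
      have := length_answer (φ := φ) (B := B) (V := V) rfl hr q
      omega

/-- A good policy finds a satisfying assignment. -/
theorem firstFalse_of_isGood (hs : Satisfiable φ) (hvV : v ≤ V) (hr : r ≠ 0)
    (h1 : (r : ℝ) * ((V + 1) / 2 ^ B) ≤ 1 / 4) (h2 : (((V : ℝ) + 3) / 2 ^ B) ^ r ≤ 1 / 4)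
    {as : List Bool} (h : (formulaMDP φ B V r).IsGood as) :
    firstFalse φ (SearchState.assign
      ((formulaMDP φ B V r).walk (SearchState.origin B V) as : SearchState B V)) = none := by
  obtain ⟨π, hπ, hV⟩ := h
  obtain ⟨hw1, hw2⟩ := MDP.W_le_of_executes (M := formulaMDP φ B V r)
    (G := fun t : SearchState B V => (rewardProb φ r t).toReal)
    (fun s a h b => SearchState.next_of_none (SearchState.next_eq_none_iff.mp h) b)
    (fun s a h => by
      rcases hC : SearchState.clause φ s with _ | C
      · exact absurd (SearchState.next_of_none hC a) h
      · exact searchMDP.meanReward_of_some hC a)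
    (fun s a h => (searchMDP.meanReward_of_none (SearchState.next_eq_none_iff.mp h) a).le)
    (fun s => ENNReal.toReal_nonneg) π as _ (formulaMDP φ B V r).horizon hπ
  rw [← MDP.V_eq_W] at hw2
  rw [show (formulaMDP φ B V r).VStar (formulaMDP φ B V r).start = _ from
    (optimal hvV hr).1 (SearchState.origin B V), toReal_rewardProb hs hvV hr] at hV
  have hinit := SearchState.value_origin (B := B) (V := V) (r := r) (witness φ) φ
  -- The policy is worth more than `3/4 - 1/4`, and all it can earn is the reward at its last state
  -- `t`; if `t` does not satisfy the formula, its time is over and this is at most 1/4.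
  set t : SearchState B V := (formulaMDP φ B V r).walk (SearchState.origin B V) as
  have hC : t.clause φ = none := SearchState.next_eq_none_iff.mp (hw1 true)
  by_contra hne
  have hcount : allOnes t.count = true := by
    by_contra h'
    rw [SearchState.clause, if_neg h'] at hC
    exact hne hC
  have h3 := SearchState.value_le_of_allOnes (φ := φ) (r := r) (witness φ) hvV hcount
  have h4 : (formulaMDP φ B V r).V π (formulaMDP φ B V r).start ≤ t.value r φ (witness φ) :=
    hw2.trans (toReal_rewardProb hs hvV hr t).le
  linarith

end formulaMDP

end RL

/-! ### Evaluating an encoded formula, and arithmetic for the parameters -/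

namespace Machine

/-- Codes of the clauses of a formula. -/
def encClauses {v : ℕ} (φ : ThreeSat.CNF v) : Str :=
  (φ.flatMap fun C => true :: ThreeSat.encClause C) ++ [false]

/-- The code without its first literal. -/
def dropLiteral (c : Str) : Str := (c.tail.dropWhile id).tail

/-- The variable of the first literal, in unary. -/
def variableStr (c : Str) : Str := c.tail.takeWhile id

/-- Whether the first literal is false. -/
def literalFalse (w c : Str) : Bool :=
  !((w.drop (variableStr c).length).headD false == c.headD false)

/-- Whether the first three literals are false. -/
def clauseFalse (w c : Str) : Bool :=
  literalFalse w c && (literalFalse w (dropLiteral c) &&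
    literalFalse w (dropLiteral (dropLiteral c)))

/-- Proceed to the next clause, if the first one is true. -/
def skipClause (w c : Str) : Str :=
  bif c.headD false && !clauseFalse w c.tail then
    dropLiteral (dropLiteral (dropLiteral c.tail)) else c

theorem takeWhile_replicate_append (n : ℕ) (l : Str) :
    (List.replicate n true ++ false :: l).takeWhile id = List.replicate n true := by
  induction n with
  | zero => simp
  | succ n ih => simp [List.replicate_succ, ih]

theorem dropWhile_replicate_append (n : ℕ) (l : Str) :
    (List.replicate n true ++ false :: l).dropWhile id = false :: l := by
  induction n with
  | zero => simp
  | succ n ih => simp [List.replicate_succ, ih]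

open ThreeSat

section Codes

variable {v : ℕ}

theorem dropLiteral_append (l : Literal v) (c : Str) : dropLiteral (encLiteral l ++ c) = c := by
  simp [dropLiteral, encLiteral, encUnary]

theorem variableStr_append (l : Literal v) (c : Str) :
    variableStr (encLiteral l ++ c) = List.replicate l.1 true := by
  simp [variableStr, encLiteral, encUnary]

theorem literalFalse_append (w : Str) (l : Literal v) (c : Str) :
    literalFalse w (encLiteral l ++ c) = !Literal.eval w l := by
  rw [literalFalse, variableStr_append, Literal.eval]
  have h1 : (encLiteral l ++ c).headD false = l.2 := rfl
  have h2 : ∀ i, (w.drop i).headD false = w.getD i false := fun i => by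
    rw [List.headD_eq_head?_getD, List.head?_drop, List.getD_eq_getElem?_getD]
  rw [h1, h2, List.length_replicate]

theorem encClause_append (C : Clause v) (c : Str) : encClause C ++ c =
    encLiteral C.1 ++ (encLiteral C.2.1 ++ (encLiteral C.2.2 ++ c)) := by
  simp [encClause]

theorem clauseFalse_append (w : Str) (C : Clause v) (c : Str) :
    clauseFalse w (encClause C ++ c) = !Clause.eval w C := by
  rw [clauseFalse, encClause_append, dropLiteral_append, dropLiteral_append, literalFalse_append,
    literalFalse_append, literalFalse_append, Clause.eval]
  simp only [Bool.not_or, Bool.and_assoc]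

theorem encClauses_cons (C : Clause v) (φ : CNF v) :
    encClauses (C :: φ) = true :: (encClause C ++ encClauses φ) := by
  simp [encClauses]

theorem skipClause_nil (w : Str) :
    skipClause w (encClauses ([] : CNF v)) = encClauses ([] : CNF v) :=
  rfl

theorem skipClause_cons (w : Str) (C : Clause v) (φ : CNF v) :
    skipClause w (encClauses (C :: φ)) =
      bif Clause.eval w C then encClauses φ else encClauses (C :: φ) := by
  rw [encClauses_cons, skipClause, List.tail_cons, clauseFalse_append, encClause_append,
    dropLiteral_append, dropLiteral_append, dropLiteral_append]
  simp

/-- The first falsified clause and the empty list are fixed points, so the exact number of rounds is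
irrelevant once it is at least the number of clauses. -/
theorem iterate_skipClause (w : Str) (φ : CNF v) (m : ℕ) (hm : φ.length ≤ m) :
    (skipClause w)^[m] (encClauses φ) = encClauses (φ.dropWhile (Clause.eval w)) := by
  induction φ generalizing m with
  | nil => exact Function.iterate_fixed (skipClause_nil w) m
  | cons C φ ih =>
    have := skipClause_cons w C φ
    rcases h : Clause.eval w C
    · rw [h, cond_false] at this
      rw [Function.iterate_fixed this, List.dropWhile_cons_of_neg (by simp [h])]
    · rw [h, cond_true] at this
      obtain ⟨m, rfl⟩ : ∃ m', m = m' + 1 := ⟨m - 1, by simp at hm; omega⟩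
      rw [Function.iterate_succ_apply, this, List.dropWhile_cons_of_pos h]
      exact ih m (by simpa using hm)

theorem length_le_length_encClauses (φ : CNF v) : φ.length ≤ (encClauses φ).length := by
  induction φ with
  | nil => simp
  | cons C φ ih => rw [encClauses_cons]; simp; omega

theorem length_skipClause (w c : Str) : (skipClause w c).length ≤ c.length := by
  have h : ∀ c : Str, (dropLiteral c).length ≤ c.length := fun c => by
    rw [dropLiteral, List.length_tail]
    have := (List.dropWhile_suffix (l := c.tail) id).length_le
    simp at this
    omega
  rw [skipClause]
  cases c.headD false && !clauseFalse w c.tail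
  · exact le_rfl
  · have h1 := h c.tail
    have h2 := h (dropLiteral c.tail)
    have h3 := h (dropLiteral (dropLiteral c.tail))
    simp at h1 ⊢
    omega

theorem head_dropWhile (φ : CNF v) (w : Str) :
    firstFalse φ w = (φ.dropWhile (Clause.eval w)).head? := by
  rw [firstFalse]
  induction φ with
  | nil => rfl
  | cons C φ ih =>
    rcases h : Clause.eval w C
    · simp [h]
    · simp [h, ih]

end Codes

namespace Comp

variable {X : Type} {V : List (X → Str)} {S : X → ℕ}

theorem dropLiteral {f : X → Str} (hf : Comp V S f) :
    Comp V S (fun x => Machine.dropLiteral (f x)) := tail (dropWhile (tail hf))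

theorem variableStr {f : X → Str} (hf : Comp V S f) :
    Comp V S (fun x => Machine.variableStr (f x)) := takeWhile (tail hf)

theorem literalFalse {f g : X → Str} (hf : Comp V S f) (hg : Comp V S g) :
    Comp V S (fun x => [Machine.literalFalse (f x) (g x)]) :=
  not (beq (headD (drop (variableStr hg) hf)) (headD hg))

theorem clauseFalse {f g : X → Str} (hf : Comp V S f) (hg : Comp V S g) :
    Comp V S (fun x => [Machine.clauseFalse (f x) (g x)]) :=
  and (literalFalse hf hg) (and (literalFalse hf (dropLiteral hg))
    (literalFalse hf (dropLiteral (dropLiteral hg))))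

theorem skipClause {f g : X → Str} (hf : Comp V S f) (hg : Comp V S g) :
    Comp V S (fun x => Machine.skipClause (f x) (g x)) :=
  cond (and (headD hg) (not (clauseFalse hf (tail hg))))
    (dropLiteral (dropLiteral (dropLiteral (tail hg)))) hg

theorem bd_vars₂ : ∀ g ∈ [fun y : Str × Str => y.1, fun y => y.2],
    Bd (fun y : Str × Str => y.1.length + y.2.length) (fun y => (g y).length) := by
  simp only [List.mem_cons, List.not_mem_nil, or_false]
  rintro g (rfl | rfl)
  · exact Bd.self.mono fun _ => by simp
  · exact Bd.self.mono fun _ => by simp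

/-- The length of the code bounds the number of clauses and serves as the loop counter. -/
theorem skipClauses {f g : X → Str} (hf : Comp V S f) (hg : Comp V S g) :
    Comp V S (fun x => (Machine.skipClause (f x))^[(g x).length] (g x)) := by
  have step : Comp (Prod.snd :: [fun y : Str × Str => y.1, fun y => y.2].map
      (fun g (y : (Str × Str) × Str) => g y.1)) (fun y => y.1.1.length + y.1.2.length + y.2.length)
      (fun y : (Str × Str) × Str => Machine.skipClause y.1.1 y.2) :=
    skipClause (f := fun y : (Str × Str) × Str => y.1.1)
      (lift (f := fun y : Str × Str => y.1) bd_vars₂ fst₂) acc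
  have : Comp₂ (fun w c => (Machine.skipClause w)^[c.length] c) :=
    iterate (X := Str × Str) (l := fun y => y.2) (i := fun y => y.2) snd₂ snd₂
      (h := fun x c => Machine.skipClause x.1 c) step _ Bd.self fun x m _ => by
        have : ∀ m, ((Machine.skipClause x.1)^[m] x.2).length ≤ x.2.length := fun m => by
          induction m with
          | zero => exact le_rfl
          | succ m ih =>
            rw [Function.iterate_succ_apply']
            exact (length_skipClause _ _).trans ih
        exact (this m).trans (by simp)
  exact comp₂ this hf hg

theorem inc {f : X → Str} (hf : Comp V S f) : Comp V S (fun x => Machine.inc (f x)) :=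
  append (replicate false (takeWhile hf)) (cons true (tail (dropWhile hf)))

theorem allOnes {f : X → Str} (hf : Comp V S f) : Comp V S (fun x => [Machine.allOnes (f x)]) :=
  isEmpty (dropWhile hf)

/-- The string is cut at the position given in unary; the separate case is a position beyond the
end, where nothing is to be changed. -/
theorem flipAt {f u : X → Str} (hf : Comp V S f) (hu : Comp V S u) :
    Comp V S (fun x => Machine.flipAt (f x) (u x).length) :=
  (cond (isEmpty (drop hu hf)) hf
    (append (take hu hf) (consBit (not (headD (drop hu hf))) (tail (drop hu hf))))).congr
    fun x => by
      generalize (u x).length = i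
      generalize f x = w
      have h2 : (w.drop i).headD false = w.getD i false := by
        rw [List.headD_eq_head?_getD, List.head?_drop, List.getD_eq_getElem?_getD]
      rw [h2, Machine.flipAt, List.tail_drop]
      rcases lt_or_ge i w.length with h | h
      · have : (w.drop i).isEmpty = false := by simpa using h
        rw [this, cond_false, List.set_eq_take_append_cons_drop, if_pos h]
      · have : (w.drop i).isEmpty = true := by simpa using h
        rw [this, cond_true, List.set_eq_of_length_le h]

theorem binary {u : X → Str} (hu : Comp V S u) :
    Comp V S (fun x => Machine.binary (u x).length) := by
  have hlen : ∀ m, (Machine.binary m).length ≤ m := fun m => by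
    induction m with
    | zero => exact le_rfl
    | succ m ih =>
      rw [Machine.binary, Function.iterate_succ_apply', ← Machine.binary]
      rcases h : Machine.allOnes (Machine.binary m)
      · rw [length_inc _ h]; omega
      · rw [length_inc_of_allOnes _ h]; omega
  have : Comp₁ (fun u => Machine.binary u.length) :=
    iterate var₁ (const []) (h := fun _ c => Machine.inc c) (inc acc) _ Bd.self
      fun x m hm => (hlen m).trans hm
  exact comp₁ this hu

/-- Tensor powers; their size is allowed for in the bound on the running time. -/
theorem tpow {f u : X → Str} (hf : Comp V S f) (hu : Comp V S u)
    (hb : Bd S (fun x => (f x).length ^ (u x).length)) :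
    Comp V S (fun x => Machine.tpow (f x) (u x).length) := by
  have hS : Bd (fun y : Str × Str => y.1.length + y.2.length + y.1.length ^ y.2.length)
      (fun y => y.1.length + y.2.length) := Bd.self.mono fun _ => by simp
  have bd : ∀ g ∈ [fun y : Str × Str => y.1, fun y => y.2],
      Bd (fun y : Str × Str => y.1.length + y.2.length + y.1.length ^ y.2.length)
        (fun y => (g y).length) := fun g hg => hS.trans (bd_vars₂ g hg)
  have key : Comp [fun y : Str × Str => y.1, fun y => y.2]
      (fun y => y.1.length + y.2.length + y.1.length ^ y.2.length)
      (fun y => Machine.tpow y.1 y.2.length) := by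
    have e : ∀ (u : Str) (m : ℕ), (Machine.kron u)^[m] [true] = Machine.tpow u m := fun u m => by
      induction m with
      | zero => rfl
      | succ m ih => rw [Function.iterate_succ_apply', ih]; rfl
    refine (iterate (.var 1 rfl (bd _ (by simp))) (const [true])
      (h := fun y c => Machine.kron y.1 c)
      (kron (lift bd (.var 0 rfl (bd _ (by simp)))) acc)
      (fun y => 1 + y.1.length ^ y.2.length) ?_ ?_).congr fun y => e _ _
    · exact ((Bd.const 1).add Bd.self).mono fun y => by omega
    · intro y m hm
      rw [e, length_tpow]
      rcases Nat.eq_zero_or_pos y.1.length with h | h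
      · rw [h]
        exact (Nat.pow_le_pow_left zero_le_one m).trans
          (by rw [one_pow]; exact Nat.le_add_right _ _)
      · exact (Nat.pow_le_pow_right h hm).trans (by omega)
  exact key.subst (fun x => (f x, u x)) (by simpa using ⟨hf, hu⟩) ((hf.bd.add hu.bd).add hb)

end Comp

/-- The least number whose third power is above `n`. -/
def cubeRoot (n : ℕ) : ℕ := (fun r => if r ^ 3 ≤ n then r + 1 else r)^[n] 1

/-- The loop invariant: the candidate has grown in every round so far, unless it has already passed
the cube root. -/
theorem cubeRoot_aux (n m : ℕ) :
    let r := (fun r => if r ^ 3 ≤ n then r + 1 else r)^[m] 1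
    1 ≤ r ∧ r ≤ m + 1 ∧ (r - 1) ^ 3 ≤ n ∧ (n < r ^ 3 ∨ r = m + 1) := by
  induction m with
  | zero => simp
  | succ m ih =>
    simp only [Function.iterate_succ_apply'] at ih ⊢
    obtain ⟨h1, h2, h3, h4⟩ := ih
    split_ifs with h
    · refine ⟨by omega, by omega, by simpa using h, ?_⟩
      rcases h4 with h4 | h4 <;> omega
    · exact ⟨h1, by omega, h3, Or.inl (by omega)⟩

theorem one_le_cubeRoot (n : ℕ) : 1 ≤ cubeRoot n := (cubeRoot_aux n n).1

theorem lt_cubeRoot_pow (n : ℕ) : n < cubeRoot n ^ 3 := by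
  obtain ⟨h1, h2, h3, h4⟩ := cubeRoot_aux n n
  rcases h4 with h4 | h4
  · exact h4
  · calc n < n + 1 := by omega
      _ ≤ (n + 1) ^ 3 := Nat.le_self_pow (by norm_num) _
      _ = cubeRoot n ^ 3 := by rw [cubeRoot, h4]

theorem cubeRoot_sub_one_pow_le (n : ℕ) : (cubeRoot n - 1) ^ 3 ≤ n := (cubeRoot_aux n n).2.2.1

namespace Comp

variable {X : Type} {V : List (X → Str)} {S : X → ℕ}

theorem cubeRoot {u : X → Str} (hu : Comp V S u) :
    Comp V S (fun x => List.replicate (Machine.cubeRoot (u x).length) true) := by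
  have e : ∀ n m : ℕ, (fun c : Str => if c.length ^ 3 ≤ n then true :: c else c)^[m] [true] =
      List.replicate ((fun r => if r ^ 3 ≤ n then r + 1 else r)^[m] 1) true := fun n m => by
    induction m with
    | zero => rfl
    | succ m ih =>
      rw [Function.iterate_succ_apply', ih, Function.iterate_succ_apply', List.length_replicate]
      split_ifs <;> simp [List.replicate_succ]
  have : Comp₁ (fun u => List.replicate (Machine.cubeRoot u.length) true) := by
    refine (iterate var₁ (const [true])
      (h := fun y c => if c.length ^ 3 ≤ y.length then true :: c else c)
      ((ite (lenLe (mul acc (mul acc acc)) (lift (by simpa using Bd.self) var₁)) (cons true acc)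
        acc).congr fun y => ?_) (fun y => y.length + 1) (Bd.self.add (Bd.const 1)) ?_).congr
        fun y => e _ _
    · have : y.2.length * (y.2.length * y.2.length) = y.2.length ^ 3 := by ring
      simp only [List.length_replicate, this]
    · intro y m hm
      rw [e, List.length_replicate]
      have := (cubeRoot_aux y.length m).2.1
      exact this.trans (by omega)
  exact comp₁ this hu

end Comp

end Machine

namespace Machine

open ThreeSat

theorem encCNF_eq {v : ℕ} (φ : CNF v) :
    encCNF φ = List.replicate v true ++ false :: encClauses φ := by
  simp [encCNF, encClauses, encUnary]

theorem headD_encClauses {v : ℕ} (φ : CNF v) :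
    (encClauses φ).headD false = φ.head?.isSome := by
  cases φ with
  | nil => rfl
  | cons C φ => rw [encClauses_cons]; rfl

/-- The code of the formula from the first falsified clause on. -/
def falseClauses {v : ℕ} (φ : CNF v) (w : Str) : Str :=
  encClauses (φ.dropWhile (Clause.eval w))

theorem headD_falseClauses {v : ℕ} (φ : CNF v) (w : Str) :
    (falseClauses φ w).headD false = (firstFalse φ w).isSome := by
  rw [falseClauses, headD_encClauses, head_dropWhile]

theorem tail_falseClauses {v : ℕ} {φ : CNF v} {w : Str} {C : Clause v}
    (h : firstFalse φ w = some C) : ∃ c, (falseClauses φ w).tail = encClause C ++ c := by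
  rw [head_dropWhile] at h
  rw [falseClauses]
  cases hd : φ.dropWhile (Clause.eval w) with
  | nil => rw [hd] at h; cases h
  | cons D ψ =>
    rw [hd, List.head?_cons, Option.some.injEq] at h
    subst h
    exact ⟨_, by rw [encClauses_cons]; rfl⟩

end Machine

/-! ### Transitions and oracle answers as functions of strings -/

namespace RL.SearchState

open Machine ThreeSat

variable {v B V : ℕ}

/-- Read a state from a string, which is padded by zeros. -/
def ofStr (B V : ℕ) (x : Str) : SearchState B V :=
  ⟨x.headD false, (x.tail ++ List.replicate B false).take B,
    ((x.tail ++ List.replicate B false).drop B ++ List.replicate V false).take V,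
    by simp, by simp⟩

theorem ofStr_code (s : SearchState B V) : ofStr B V s.code = s := by
  have h1 := s.length_count
  have h2 := s.length_assign
  have e : s.count ++ s.assign ++ List.replicate B false =
      s.count ++ (s.assign ++ List.replicate B false) := List.append_assoc _ _ _
  ext1
  · rfl
  · change List.take B (s.count ++ s.assign ++ _) = _
    rw [e]
    exact List.take_left' h1
  · change List.take V (List.drop B (s.count ++ s.assign ++ List.replicate B false) ++ _) = _
    rw [e, List.drop_left' h1, List.append_assoc]
    exact List.take_left' h2

/-- Thanks to the padding, reading the empty string produces the starting state; the programs create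
it in this way. -/
theorem ofStr_nil : ofStr B V [] = origin B V := by
  ext1 <;> simp [ofStr, origin]

/-- The state reached by a sequence of actions. -/
def follow (φ : CNF v) (s : SearchState B V) (as : List Bool) : SearchState B V :=
  as.foldl (fun s a => (s.next φ a).getD s) s

/-- The next state, as a function of the code of the falsified clauses. -/
theorem next_eq (φ : CNF v) (s : SearchState B V) (a : Bool) :
    (s.next φ a).isNone = (allOnes s.count || !(falseClauses φ s.assign).headD false) ∧
    ((s.next φ a).getD s).phase = (bif (allOnes s.count || !(falseClauses φ s.assign).headD false)
      then s.phase else !s.phase && !a) ∧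
    ((s.next φ a).getD s).count = (bif (allOnes s.count || !(falseClauses φ s.assign).headD false)
      then s.count else bif !s.phase && !a then s.count else inc s.count) ∧
    ((s.next φ a).getD s).assign = (bif (allOnes s.count || !(falseClauses φ s.assign).headD false)
      then s.assign else bif !s.phase && !a then s.assign else flipAt s.assign
        (variableStr (bif s.phase then
          (bif a then dropLiteral (dropLiteral (falseClauses φ s.assign).tail)
            else dropLiteral (falseClauses φ s.assign).tail)
          else (falseClauses φ s.assign).tail)).length) := by
  rw [headD_falseClauses]
  rcases hC : s.clause φ with _ | C
  · have : (allOnes s.count || !(firstFalse φ s.assign).isSome) = true := by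
      rw [clause] at hC
      split_ifs at hC with h
      · simp [h]
      · simp [hC]
    rw [next_of_none hC, this]
    exact ⟨rfl, rfl, rfl, rfl⟩
  · rw [next_of_some hC]
    have h1 := allOnes_of_clause hC
    have h2 := firstFalse_of_clause hC
    obtain ⟨c, hc⟩ := tail_falseClauses h2
    rw [h1, h2, hc, encClause_append, dropLiteral_append, dropLiteral_append]
    rcases s.phase <;> cases a <;> simp [pass, move, variableStr_append]

/-- In the second phase the options are the assignments of the two successors, so a program for
`next` also yields the feature vector. -/
theorem options_eq (φ : CNF v) (s : SearchState B V) :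
    s.options φ = bif s.phase && !(s.next φ false).isNone then
      (true, ((s.next φ false).getD s).assign, ((s.next φ true).getD s).assign)
      else (false, s.assign, s.assign) := by
  rcases hC : s.clause φ with _ | C
  · rw [next_of_none hC, options_of_none hC]; simp
  · rcases hp : s.phase
    · rw [options_of_false hp]; simp
    · rw [options_of_true hC hp, next_of_some hC, next_of_some hC]
      simp [hp, move]

end RL.SearchState

namespace RL.formulaMDP

open Machine ThreeSat

variable {v B V r : ℕ} {φ : CNF v}

theorem decode_eq (x : Str) : (formulaMDP φ B V r).decode x =
    if x.length = 1 + B + V then some (SearchState.ofStr B V x) else none := by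
  split_ifs with h
  · obtain ⟨s, rfl⟩ := SearchState.exists_code h
    rw [decode_code, SearchState.ofStr_code]
  · exact decode_of_length h

/-- Only queries for the features of a state lack the action bit. Too short queries, read with
default bits, have a remainder of the wrong length and thus fall under the last case. -/
theorem answer_eq (q : Str) : answer φ B V r q =
    let x := bif q.headD false && !q.tail.headD false then q.tail.tail else q.tail.tail.tail
    let s := SearchState.ofStr B V x
    let a := q.tail.tail.headD false
    if x.length = 1 + B + V then
      bif q.headD false then
        (tpow ((bif q.tail.headD false then (s.next φ a).getD s else s).vector φ) (2 * r)).flatMap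
          fun b => bif b then encRat 1 else encRat 0
      else bif q.tail.headD false then
        bif (s.next φ a).isNone then [false] else true :: ((s.next φ a).getD s).code
      else encRat 0
    else [] := by
  have hvec : ∀ s : SearchState B V, (MDP.encVector (fun i : Fin ((2 + B + 3 * V) ^ (2 * r)) =>
      bif (tpow (s.vector φ) (2 * r)).getD i false then 1 else 0)) =
      (tpow (s.vector φ) (2 * r)).flatMap fun b => bif b then encRat 1 else encRat 0 := fun s =>
    encVector_eq (by rw [length_tpow, SearchState.length_vector])
  rcases q with _ | ⟨_ | _, _ | ⟨_ | _, q⟩⟩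
  · simp [answer]; omega
  · simp [answer]; omega
  · rcases q with _ | ⟨a, x⟩
    · simp [answer]; omega
    · simp only [answer, decode_eq]
      by_cases h : x.length = 1 + B + V <;> simp [h] <;> rfl
  · rcases q with _ | ⟨a, x⟩
    · simp [answer]; omega
    · simp only [answer, decode_eq]
      by_cases h : x.length = 1 + B + V
      · simp only [h, if_true, List.headD_cons, List.tail_cons, Bool.not_true,
          Bool.and_false, cond_false, cond_true]
        change (formulaMDP φ B V r).encNext (SearchState.next φ (SearchState.ofStr B V x) a) = _
        rcases SearchState.next φ (SearchState.ofStr B V x) a with _ | t <;> rfl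
      · simp [h]; rfl
  · simp [answer]; omega
  · simp only [answer, decode_eq]
    by_cases h : q.length = 1 + B + V
    · simp only [h, if_true, List.headD_cons, List.tail_cons, Bool.not_false,
          Bool.and_true, cond_false, cond_true]
      exact hvec _
    · simp [h]; rfl
  · rcases q with _ | ⟨a, x⟩
    · simp [answer]; omega
    · simp only [answer, decode_eq]
      by_cases h : x.length = 1 + B + V
      · simp only [h, if_true, List.headD_cons, List.tail_cons, Bool.not_true,
          Bool.and_false, cond_false, cond_true]
        exact hvec _
      · simp [h]; rfl

end RL.formulaMDP

/-! ### Programs for the decision process -/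

namespace Machine

open ThreeSat RL

variable {X : Type} {Vs : List (X → Str)} {S : X → ℕ} {v B V r : X → ℕ} {φ : ∀ x, CNF (v x)}

/-- The data of a decision process are computable; its dimension is allowed for in the time. -/
structure CompData (Vs : List (X → Str)) (S : X → ℕ) (v B V r : X → ℕ) (φ : ∀ x, CNF (v x)) :
    Prop where
  formula : Comp Vs S (fun x => encCNF (φ x))
  bits : Comp Vs S (fun x => List.replicate (B x) true)
  vars : Comp Vs S (fun x => List.replicate (V x) true)
  power : Comp Vs S (fun x => List.replicate (2 * r x) true)
  dim : Bd S (fun x => (2 + B x + 3 * V x) ^ (2 * r x))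

/-- A state that is computable. -/
structure CompState (Vs : List (X → Str)) (S : X → ℕ) (s : ∀ x, SearchState (B x) (V x)) :
    Prop where
  phase : Comp Vs S (fun x => [(s x).phase])
  count : Comp Vs S (fun x => (s x).count)
  assign : Comp Vs S (fun x => (s x).assign)

namespace CompData

theorem falseClauses (D : CompData Vs S v B V r φ) {w : X → Str} (hw : Comp Vs S w) :
    Comp Vs S (fun x => Machine.falseClauses (φ x) (w x)) :=
  (Comp.skipClauses hw (Comp.tail (Comp.dropWhile D.formula))).congr fun x => by
    rw [encCNF_eq, dropWhile_replicate_append, List.tail_cons,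
      iterate_skipClause _ _ _ (length_le_length_encClauses _)]
    rfl

theorem lift (hV : ∀ g ∈ Vs, Bd S (fun x => (g x).length)) (D : CompData Vs S v B V r φ) :
    CompData (Prod.snd :: Vs.map (fun g (y : X × Str) => g y.1)) (fun y => S y.1 + y.2.length)
      (fun y => v y.1) (fun y => B y.1) (fun y => V y.1) (fun y => r y.1) (fun y => φ y.1) :=
  ⟨D.formula.lift hV, D.bits.lift hV, D.vars.lift hV, D.power.lift hV,
    D.dim.comp Prod.fst (Bd.self.mono fun _ => by simp)⟩

theorem ofStr (D : CompData Vs S v B V r φ) {q : X → Str} (hq : Comp Vs S q) :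
    CompState Vs S (fun x => SearchState.ofStr (B x) (V x) (q x)) := by
  have hB : Comp Vs S (fun x => List.replicate (B x) false) :=
    (Comp.replicate false D.bits).congr fun x => by rw [List.length_replicate]
  have hV : Comp Vs S (fun x => List.replicate (V x) false) :=
    (Comp.replicate false D.vars).congr fun x => by rw [List.length_replicate]
  have h := Comp.append (Comp.tail hq) hB
  refine ⟨Comp.headD hq, (Comp.take D.bits h).congr fun x => ?_,
    (Comp.take D.vars (Comp.append (Comp.drop D.bits h) hV)).congr fun x => ?_⟩
  · rw [List.length_replicate]; rfl
  · rw [List.length_replicate, List.length_replicate]; rfl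

end CompData

namespace CompState

variable {s : ∀ x, SearchState (B x) (V x)}

theorem congr {s' : ∀ x, SearchState (B x) (V x)} (h : CompState Vs S s) (e : ∀ x, s x = s' x) :
    CompState Vs S s' := (funext e : s = s') ▸ h

theorem code (hs : CompState Vs S s) : Comp Vs S (fun x => (s x).code) :=
  Comp.consBit hs.phase (Comp.append hs.count hs.assign)

theorem isNone_firstFalse (D : CompData Vs S v B V r φ) (hs : CompState Vs S s) :
    Comp Vs S (fun x => [(firstFalse (φ x) (s x).assign).isNone]) :=
  (Comp.not (Comp.headD (D.falseClauses hs.assign))).congr fun x => by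
    rw [headD_falseClauses]; cases firstFalse (φ x) (s x).assign <;> rfl

theorem isNone_next (D : CompData Vs S v B V r φ) (hs : CompState Vs S s) (a : X → Bool) :
    Comp Vs S (fun x => [((s x).next (φ x) (a x)).isNone]) :=
  (Comp.or (Comp.allOnes hs.count) (Comp.not (Comp.headD (D.falseClauses hs.assign)))).congr
    fun x => by rw [((s x).next_eq (φ x) (a x)).1]

theorem next (D : CompData Vs S v B V r φ) (hs : CompState Vs S s) {a : X → Bool}
    (ha : Comp Vs S (fun x => [a x])) :
    CompState Vs S (fun x => ((s x).next (φ x) (a x)).getD (s x)) := by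
  have hc := D.falseClauses hs.assign
  have h1 := Comp.or (Comp.allOnes hs.count) (Comp.not (Comp.headD hc))
  have h2 := Comp.and (Comp.not hs.phase) (Comp.not ha)
  have h3 := Comp.dropLiteral (Comp.tail hc)
  refine ⟨(Comp.cond h1 hs.phase h2).congr fun x => ?_,
    (Comp.cond h1 hs.count (Comp.cond h2 hs.count (Comp.inc hs.count))).congr fun x => ?_,
    (Comp.cond h1 hs.assign (Comp.cond h2 hs.assign (Comp.flipAt hs.assign (Comp.variableStr
      (Comp.cond hs.phase (Comp.cond ha (Comp.dropLiteral h3) h3) (Comp.tail hc)))))).congr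
      fun x => ?_⟩
  · rw [((s x).next_eq (φ x) (a x)).2.1, ← Bool.apply_cond (fun b => [b])]
  · rw [((s x).next_eq (φ x) (a x)).2.2.1]
  · rw [((s x).next_eq (φ x) (a x)).2.2.2]

theorem cond {s' : ∀ x, SearchState (B x) (V x)} {c : X → Bool} (hc : Comp Vs S (fun x => [c x]))
    (hs : CompState Vs S s) (hs' : CompState Vs S s') :
    CompState Vs S (fun x => bif c x then s x else s' x) :=
  ⟨(Comp.cond hc hs.phase hs'.phase).congr fun x => by cases c x <;> rfl,
    (Comp.cond hc hs.count hs'.count).congr fun x => by cases c x <;> rfl,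
    (Comp.cond hc hs.assign hs'.assign).congr fun x => by cases c x <;> rfl⟩

theorem vector (D : CompData Vs S v B V r φ) (hs : CompState Vs S s) :
    Comp Vs S (fun x => (s x).vector (φ x)) := by
  have h := Comp.and hs.phase (Comp.not (hs.isNone_next D (fun _ => false)))
  have h0 := (hs.next D (a := fun _ => false) (Comp.const [false])).assign
  have h1 := (hs.next D (a := fun _ => true) (Comp.const [true])).assign
  refine (Comp.cons true (Comp.consBit h (Comp.append hs.count (Comp.append hs.assign
    (Comp.append (Comp.cond h h0 hs.assign) (Comp.cond h h1 hs.assign)))))).congr fun x => ?_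
  rw [SearchState.vector, SearchState.options_eq]
  cases (s x).phase && !((s x).next (φ x) false).isNone <;> rfl

end CompState

namespace CompData

/-- The answers of the oracle are computable. -/
theorem answer (D : CompData Vs S v B V r φ) {q : X → Str} (hq : Comp Vs S q) :
    Comp Vs S (fun x => formulaMDP.answer (φ x) (B x) (V x) (r x) (q x)) := by
  have h0 := Comp.headD hq
  have h1 := Comp.headD (Comp.tail hq)
  have ha := Comp.headD (Comp.tail (Comp.tail hq))
  have hx := Comp.cond (Comp.and h0 (Comp.not h1)) (Comp.tail (Comp.tail hq))
    (Comp.tail (Comp.tail (Comp.tail hq)))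
  have hs := D.ofStr hx
  have hn := hs.next D ha
  have hlen := Comp.lenEq hx (Comp.cons true (Comp.append D.bits D.vars))
  have hvec := (CompState.cond h1 hn hs).vector D
  have hpow := Comp.tpow hvec D.power (D.dim.mono fun x => by
    rw [SearchState.length_vector, List.length_replicate])
  refine (Comp.cond hlen (Comp.cond h0 (Comp.flatMap (encRat 0) (encRat 1) hpow)
    (Comp.cond h1 (Comp.cond (hs.isNone_next D fun x => (q x).tail.tail.headD false)
      (Comp.const [false]) (Comp.cons true hn.code))
      (Comp.const (encRat 0)))) (Comp.const [])).congr fun x => ?_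
  rw [formulaMDP.answer_eq]
  simp only [List.length_replicate, List.length_cons, List.length_append]
  rw [show B x + V x + 1 = 1 + B x + V x by ring, Bool.cond_decide]

/-- A fold over the actions whose accumulator is the code of the present state; all codes have the
same length, which gives the bound required by `Comp.foldl`. -/
theorem follow (hVs : ∀ g ∈ Vs, Bd S (fun x => (g x).length)) (D : CompData Vs S v B V r φ)
    {as : X → Str} (has : Comp Vs S as) :
    CompState Vs S (fun x => (SearchState.origin (B x) (V x)).follow (φ x) (as x)) := by
  have D' := D.lift hVs
  have hs := D'.ofStr Comp.acc
  have key : ∀ x (u : Str) (s : SearchState (B x) (V x)),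
      u.foldl (fun acc a =>
        bif a then (((SearchState.ofStr (B x) (V x) acc).next (φ x) true).getD
          (SearchState.ofStr (B x) (V x) acc)).code
        else (((SearchState.ofStr (B x) (V x) acc).next (φ x) false).getD
          (SearchState.ofStr (B x) (V x) acc)).code) s.code =
      (s.follow (φ x) u).code := by
    intro x u
    induction u with
    | nil => intro s; rfl
    | cons a u ih =>
      intro s
      rw [List.foldl_cons, SearchState.ofStr_code]
      refine Eq.trans ?_ (ih ((s.next (φ x) a).getD s))
      cases a <;> rfl
  have hc := Comp.foldl (h₀ := fun x acc =>
      (((SearchState.ofStr (B x) (V x) acc).next (φ x) false).getD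
        (SearchState.ofStr (B x) (V x) acc)).code)
    (h₁ := fun x acc =>
      (((SearchState.ofStr (B x) (V x) acc).next (φ x) true).getD
        (SearchState.ofStr (B x) (V x) acc)).code)
    has (D.ofStr (Comp.const [])).code
    ((hs.next D' (a := fun _ => false) (Comp.const [false])).code)
    ((hs.next D' (a := fun _ => true) (Comp.const [true])).code)
    (fun x => 1 + (List.replicate (B x) true).length + (List.replicate (V x) true).length)
    (((Bd.const 1).add D.bits.bd).add D.vars.bd) (fun x u w _ => by
      rw [key, SearchState.length_code, List.length_replicate, List.length_replicate])
  refine (D.ofStr hc).congr fun x => ?_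
  rw [key, SearchState.ofStr_code, SearchState.ofStr_nil]

end CompData

end Machine

namespace RL

open Machine Filter

/-! ## The choice of the parameters -/

/-- The number of binary digits. -/
def bitLength (V : ℕ) : ℕ := (binary V).length

/-- The number of digits of the counter. -/
def counterLength (V : ℕ) : ℕ := bitLength V * cubeRoot V

/-- The feature dimension. -/
def dimension (V : ℕ) : ℕ := (2 + counterLength V + 3 * V) ^ (2 * cubeRoot V)

theorem lt_two_pow_bitLength (V : ℕ) : V < 2 ^ bitLength V := lt_two_pow_length_binary V

theorem two_pow_bitLength_le {V : ℕ} (hV : V ≠ 0) : 2 ^ bitLength V ≤ 2 * V :=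
  two_pow_length_binary_le hV

theorem eventually_le_bitLength (m : ℕ) : ∀ᶠ V in atTop, m ≤ bitLength V := by
  filter_upwards [eventually_ge_atTop (2 ^ m)] with V hV
  exact ((Nat.pow_lt_pow_iff_right (by norm_num)).mp (hV.trans_lt (lt_two_pow_bitLength V))).le

theorem eventually_le_cubeRoot (m : ℕ) : ∀ᶠ V in atTop, m ≤ cubeRoot V := by
  filter_upwards [eventually_ge_atTop (m ^ 3)] with V hV
  exact (lt_of_pow_lt_pow_left₀ 3 (Nat.zero_le _) (hV.trans_lt (lt_cubeRoot_pow V))).le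

/-- `k ^ m (2C + 1) ≤ 2 ^ k ≤ 2V` for large `k = bitLength V`. -/
theorem eventually_bitLength_pow_le (C m : ℕ) : ∀ᶠ V in atTop, C * bitLength V ^ m ≤ V := by
  have h := (isLittleO_pow_const_const_pow_of_one_lt (R := ℝ) m (one_lt_two)).bound
    (c := 1 / (2 * C + 1)) (by positivity)
  obtain ⟨a, ha⟩ := eventually_atTop.mp h
  filter_upwards [eventually_le_bitLength a, eventually_ne_atTop 0] with V h1 h2
  have h3 := ha _ h1
  rw [Real.norm_of_nonneg (by positivity), Real.norm_of_nonneg (by positivity), div_mul_eq_mul_div,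
    one_mul, le_div_iff₀ (by positivity)] at h3
  have h4 : (bitLength V ^ m * (2 * C + 1) : ℕ) ≤ 2 ^ bitLength V := by exact_mod_cast h3
  have h5 := two_pow_bitLength_le h2
  nlinarith

theorem cubeRoot_pow_le {V : ℕ} (h : 2 ≤ cubeRoot V) : cubeRoot V ^ 3 ≤ 8 * V := by
  have h1 := cubeRoot_sub_one_pow_le V
  calc cubeRoot V ^ 3 ≤ (2 * (cubeRoot V - 1)) ^ 3 := Nat.pow_le_pow_left (by omega) 3
    _ = 8 * (cubeRoot V - 1) ^ 3 := by ring
    _ ≤ 8 * V := by omega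

/-- With `r³ ≤ 8V`, the third power of the left side is at most `64 C³ k⁹ V²`, and polylogarithmic
factors are eventually below `V`. This is what fits the final running time into `2 ^ (v / log v)`.
-/
theorem eventually_mul_le (C : ℕ) :
    ∀ᶠ V in atTop, C * (cubeRoot V ^ 2 * bitLength V ^ 3) ≤ V := by
  filter_upwards [eventually_bitLength_pow_le (64 * C ^ 3) 9, eventually_le_cubeRoot 2]
    with V h1 h2
  have h3 := cubeRoot_pow_le h2
  refine le_of_pow_le_pow_left₀ (n := 3) (by norm_num) (Nat.zero_le _) ?_
  calc (C * (cubeRoot V ^ 2 * bitLength V ^ 3)) ^ 3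
      = C ^ 3 * (cubeRoot V ^ 3) ^ 2 * bitLength V ^ 9 := by ring
    _ ≤ C ^ 3 * (8 * V) ^ 2 * bitLength V ^ 9 := by gcongr
    _ = (64 * C ^ 3 * bitLength V ^ 9) * V ^ 2 := by ring
    _ ≤ V * V ^ 2 := by gcongr
    _ = V ^ 3 := by ring

theorem eventually_counterLength_le : ∀ᶠ V in atTop, counterLength V + 2 ≤ V := by
  filter_upwards [eventually_mul_le 3, eventually_le_bitLength 1] with V h1 h2
  have h3 := one_le_cubeRoot V
  have h4 : counterLength V ≤ cubeRoot V ^ 2 * bitLength V ^ 3 := by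
    rw [counterLength, mul_comm]
    exact Nat.mul_le_mul (Nat.le_self_pow (by norm_num) _) (Nat.le_self_pow (by norm_num) _)
  have h5 : 1 ≤ counterLength V := Nat.mul_pos h2 h3
  omega

/-- `2 ^ (k r) ≤ (2V) ^ r`, while the dimension is the `r`-th power of a square larger than `2V`; so
the horizon is linear in the dimension. -/
theorem two_pow_counterLength_le {V : ℕ} (hV : V ≠ 0) :
    2 ^ counterLength V ≤ dimension V := by
  rw [counterLength, dimension, pow_mul, pow_mul]
  refine Nat.pow_le_pow_left ((two_pow_bitLength_le hV).trans ?_) _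
  exact le_trans (by omega) (Nat.le_self_pow (by norm_num) _)

theorem pow_le_dimension (V : ℕ) : V ^ (2 * cubeRoot V) ≤ dimension V :=
  Nat.pow_le_pow_left (by omega) _

theorem dimension_le {V : ℕ} (h : counterLength V + 2 ≤ V) :
    dimension V ≤ 2 ^ (2 * cubeRoot V * (bitLength V + 2)) := by
  rw [dimension, mul_comm _ (bitLength V + 2), pow_mul 2]
  refine Nat.pow_le_pow_left ?_ _
  have := lt_two_pow_bitLength V
  rw [pow_add]
  omega

/-- The running time of the given algorithm, for the dimension in question. -/
theorem eventually_time_le {T : ℕ → ℕ} (hT : (fun d => (T d : ℝ)) =O[atTop]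
      (fun d : ℕ => (d : ℝ) ^ (Real.logb 2 d / (72 * Real.logb 2 (Real.logb 2 d))))) :
    ∃ K : ℕ, ∀ᶠ V in atTop,
      (T (dimension V) : ℝ) ≤ K * 2 ^ ((cubeRoot V ^ 2 * bitLength V : ℝ) / 3) := by
  obtain ⟨K, hK⟩ := hT.bound
  obtain ⟨d₀, hd₀⟩ := eventually_atTop.mp hK
  refine ⟨⌈|K|⌉₊, ?_⟩
  -- `k ≥ 7` is what the inequality `(k + 2)² ≤ 2k(k - 1)` below needs.
  filter_upwards [eventually_le_bitLength 7, eventually_le_cubeRoot 6, eventually_counterLength_le,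
    eventually_ge_atTop d₀, eventually_ge_atTop 2] with V hk hr hc hV hV2
  have hVd : V ≤ dimension V := (Nat.le_self_pow (by omega) V).trans (pow_le_dimension V)
  have h1 := hd₀ _ (hV.trans hVd)
  have hdpos : (0 : ℝ) < dimension V := by
    have : 0 < dimension V := by omega
    exact_mod_cast this
  set d : ℝ := (dimension V : ℝ) with hddef
  set r : ℝ := (cubeRoot V : ℝ) with hrdef
  set k : ℝ := (bitLength V : ℝ) with hkdef
  have hr6 : (6 : ℝ) ≤ r := by rw [hrdef]; exact_mod_cast hr
  have hk7 : (7 : ℝ) ≤ k := by rw [hkdef]; exact_mod_cast hk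
  have hVk : k - 1 ≤ Real.logb 2 V := by
    rw [Real.le_logb_iff_rpow_le (by norm_num) (by positivity)]
    have : (2 : ℝ) ^ k ≤ 2 * V := by
      rw [hkdef, Real.rpow_natCast]
      exact_mod_cast two_pow_bitLength_le (V := V) (by omega)
    rw [Real.rpow_sub (by norm_num), Real.rpow_one]
    linarith
  have hlog_le : Real.logb 2 d ≤ 2 * r * (k + 2) := by
    rw [Real.logb_le_iff_le_rpow (by norm_num) hdpos]
    have := dimension_le hc
    have h2 : (2 : ℝ) * r * (k + 2) = ((2 * cubeRoot V * (bitLength V + 2) : ℕ) : ℝ) := by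
      push_cast; ring
    rw [h2, Real.rpow_natCast, hddef]
    exact_mod_cast this
  have hlog_ge : r ≤ Real.logb 2 d := by
    rw [Real.le_logb_iff_rpow_le (by norm_num) hdpos, hrdef, Real.rpow_natCast, hddef]
    have : 2 ^ cubeRoot V ≤ dimension V :=
      (Nat.pow_le_pow_left hV2 _).trans ((Nat.pow_le_pow_right (by omega) (by omega)).trans
        (pow_le_dimension V))
    exact_mod_cast this
  -- `log d ≥ r ≥ V^(1/3)`, so the iterated logarithm is at least a third of `log V`.
  have hloglog : (k - 1) / 3 ≤ Real.logb 2 (Real.logb 2 d) := by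
    have h2 : Real.logb 2 V ≤ 3 * Real.logb 2 r := by
      have := lt_cubeRoot_pow V
      have h3 : (V : ℝ) ≤ r ^ 3 := by rw [hrdef]; exact_mod_cast this.le
      calc Real.logb 2 V ≤ Real.logb 2 (r ^ 3) :=
            Real.logb_le_logb_of_le (by norm_num) (by positivity) h3
        _ = 3 * Real.logb 2 r := by rw [Real.logb_pow]; norm_num
    have h4 : Real.logb 2 r ≤ Real.logb 2 (Real.logb 2 d) :=
      Real.logb_le_logb_of_le (by norm_num) (by positivity) hlog_ge
    linarith
  rw [Real.norm_of_nonneg (by positivity), Real.norm_of_nonneg (by positivity)] at h1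
  refine h1.trans ?_
  have hexp : d ^ (Real.logb 2 d / (72 * Real.logb 2 (Real.logb 2 d))) ≤
      2 ^ (r ^ 2 * k / 3) := by
    have h2 : d = 2 ^ Real.logb 2 d := (Real.rpow_logb (by norm_num) (by norm_num) hdpos).symm
    conv_lhs => rw [h2]
    rw [← Real.rpow_mul (by norm_num), ← h2]
    refine Real.rpow_le_rpow_of_exponent_le (by norm_num) ?_
    -- Here the constant 72 is spent: `(log d)² ≤ 4 r² (k + 2)² ≤ 8 r² k (k - 1)`, which is `72 · (k
    -- - 1)/3` times `r² k / 3`.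
    rw [← mul_div_assoc, div_le_iff₀ (by linarith)]
    calc Real.logb 2 d * Real.logb 2 d ≤ (2 * r * (k + 2)) * (2 * r * (k + 2)) := by
          have : 0 ≤ Real.logb 2 d := by linarith
          gcongr
      _ = 4 * r ^ 2 * (k + 2) ^ 2 := by ring
      _ ≤ 4 * r ^ 2 * (2 * k * (k - 1)) := by gcongr; nlinarith
      _ = r ^ 2 * k / 3 * (72 * ((k - 1) / 3)) := by ring
      _ ≤ r ^ 2 * k / 3 * (72 * Real.logb 2 (Real.logb 2 d)) := by gcongr
  gcongr
  exact (le_abs_self K).trans (Nat.le_ceil _)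

/-- For large parameters, the rewards are almost invisible. -/
theorem eventually_parameters {T : ℕ → ℕ} {K : ℕ} (hT : ∀ᶠ V in atTop,
      (T (dimension V) : ℝ) ≤ K * 2 ^ ((cubeRoot V ^ 2 * bitLength V : ℝ) / 3)) :
    ∀ᶠ V in atTop, V ≠ 0 ∧
      (cubeRoot V : ℝ) * ((V + 1) / 2 ^ counterLength V) ≤ 1 / 4 ∧
      (((V : ℝ) + 3) / 2 ^ counterLength V) ^ cubeRoot V ≤ 1 / 4 ∧
      T (dimension V) * (((V : ℝ) + 3) / 2 ^ counterLength V) ^ cubeRoot V ≤ 1 / 40 := by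
  filter_upwards [hT, eventually_le_bitLength 7, eventually_le_cubeRoot 6,
    eventually_counterLength_le, eventually_ge_atTop 8, eventually_ge_atTop (40 * K)]
    with V hT hk hr hc hV hVK
  have hV8 : (8 : ℝ) ≤ V := by exact_mod_cast hV
  have hVk : (V : ℝ) ≤ 2 ^ bitLength V := by exact_mod_cast (lt_two_pow_bitLength V).le
  have hrV : (cubeRoot V : ℝ) ≤ V := by
    have : cubeRoot V ≤ counterLength V := Nat.le_mul_of_pos_left _ (by omega)
    exact_mod_cast this.trans (by omega)
  have hVc : (V : ℝ) ^ 3 ≤ 2 ^ counterLength V := by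
    calc (V : ℝ) ^ 3 ≤ (2 ^ bitLength V) ^ 3 := by gcongr
      _ = 2 ^ (bitLength V * 3) := (pow_mul _ _ _).symm
      _ ≤ 2 ^ counterLength V :=
        pow_le_pow_right₀ (by norm_num) (Nat.mul_le_mul_left _ (by omega))
  have hpos : (0 : ℝ) < 2 ^ counterLength V := by positivity
  refine ⟨by omega, ?_, ?_, ?_⟩
  · rw [← mul_div_assoc, div_le_iff₀ hpos]
    have : (cubeRoot V : ℝ) * (V + 1) ≤ V * (V + 1) := by gcongr
    nlinarith
  · have : ((V : ℝ) + 3) / 2 ^ counterLength V ≤ 1 / 4 := by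
      rw [div_le_iff₀ hpos]
      have : 8 * V ≤ (V : ℝ) ^ 2 := by nlinarith
      nlinarith
    refine (pow_le_of_le_one (by positivity) (this.trans (by norm_num)) ?_).trans this
    omega
  · set r := cubeRoot V
    set k := bitLength V
    -- `V + 3 ≤ 2V ≤ 2 ^ (k + 1)` and `counterLength V = k r`.
    have h1 : (((V : ℝ) + 3) / 2 ^ counterLength V) ^ r ≤
        2 ^ (((k : ℝ) + 1 - k * r) * r) := by
      rw [Real.rpow_mul_natCast (by norm_num), Real.rpow_sub (by norm_num)]
      gcongr
      · rw [Real.rpow_add (by norm_num), Real.rpow_natCast, Real.rpow_one]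
        linarith
      · rw [← Real.rpow_natCast, counterLength]
        push_cast
        exact le_rfl
    have hr6 : (6 : ℝ) ≤ r := by exact_mod_cast hr
    have hk7 : (7 : ℝ) ≤ k := by exact_mod_cast hk
    calc T (dimension V) * (((V : ℝ) + 3) / 2 ^ counterLength V) ^ r
        ≤ (K * 2 ^ ((r ^ 2 * k : ℝ) / 3)) * 2 ^ (((k : ℝ) + 1 - k * r) * r) := by gcongr
      _ = K * 2 ^ ((r ^ 2 * k : ℝ) / 3 + ((k : ℝ) + 1 - k * r) * r) := by
        rw [mul_assoc, ← Real.rpow_add (by norm_num)]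
      -- The exponent is `(k + 1) r - (2/3) k r²`, at most `-k` for `r ≥ 6` and `k ≥ 7`; the
      -- remaining `2 ^ (-k) ≤ 1 / V` absorbs the constant `K`.
      _ ≤ K * 2 ^ (-(k : ℝ)) := by
        gcongr
        · norm_num
        · nlinarith [mul_nonneg (by linarith : (0 : ℝ) ≤ r - 6) (by linarith : (0 : ℝ) ≤ k - 7),
            mul_nonneg (mul_nonneg (by linarith : (0 : ℝ) ≤ r - 6)
              (by linarith : (0 : ℝ) ≤ k - 7)) (by linarith : (0 : ℝ) ≤ r)]
      _ ≤ 1 / 40 := by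
        rw [Real.rpow_neg (by norm_num), Real.rpow_natCast, ← div_eq_mul_inv,
          div_le_div_iff₀ (by positivity) (by norm_num)]
        have : (40 * K : ℝ) ≤ V := by exact_mod_cast hVK
        linarith

/-- Polynomials in the given running time are of the size claimed. -/
theorem isBigO_time {T : ℕ → ℕ} {K : ℕ} (hT : ∀ᶠ V in atTop,
      (T (dimension V) : ℝ) ≤ K * 2 ^ ((cubeRoot V ^ 2 * bitLength V : ℝ) / 3)) (v₀ a m : ℕ) :
    (fun v => (((a * (v + 1) ^ 2 + dimension (v + v₀) + T (dimension (v + v₀))) ^ m : ℕ) : ℝ))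
      =O[atTop] (fun v : ℕ => (2 : ℝ) ^ (1 * (v / Real.logb 2 v))) := by
  have shift : Tendsto (fun v => v + v₀) atTop atTop := tendsto_add_atTop_nat v₀
  refine Asymptotics.IsBigO.of_bound 1 ?_
  filter_upwards [shift.eventually hT, shift.eventually (eventually_le_cubeRoot 6),
    shift.eventually (eventually_le_bitLength 2), shift.eventually eventually_counterLength_le,
    shift.eventually (eventually_mul_le (2 * (m * (K + 16)))), eventually_ge_atTop a,
    eventually_ge_atTop v₀, eventually_ge_atTop 2] with v hT hr hk hc hm hva hv₀ hv2
  set V := v + v₀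
  have hpos : 0 < Real.logb 2 v := Real.logb_pos (by norm_num) (by exact_mod_cast hv2)
  have hlog : Real.logb 2 v ≤ bitLength V := by
    rw [Real.logb_le_iff_le_rpow (by norm_num) (by positivity), Real.rpow_natCast]
    exact_mod_cast (by omega : v ≤ V).trans (lt_two_pow_bitLength V).le
  have ha : a * (v + 1) ^ 2 ≤ dimension V * 1 := by
    rw [mul_one]
    calc a * (v + 1) ^ 2 ≤ v * (v * 2) ^ 2 := by gcongr; omega
      _ ≤ V * (V * V) ^ 2 := by gcongr <;> omega
      _ = V ^ 5 := by ring
      _ ≤ V ^ (2 * cubeRoot V) := Nat.pow_le_pow_right (by omega) (by omega)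
      _ ≤ dimension V := pow_le_dimension V
  have hd : (dimension V : ℝ) ≤ 2 ^ ((8 : ℝ) * (cubeRoot V ^ 2 * bitLength V ^ 2)) := by
    have h1 : 2 * cubeRoot V * (bitLength V + 2) ≤ 8 * (cubeRoot V ^ 2 * bitLength V ^ 2) := by
      have h2 : cubeRoot V ≤ cubeRoot V ^ 2 := Nat.le_self_pow (by norm_num) _
      have h3 : bitLength V + 2 ≤ 4 * bitLength V ^ 2 := by nlinarith
      calc 2 * cubeRoot V * (bitLength V + 2) ≤ 2 * cubeRoot V ^ 2 * (4 * bitLength V ^ 2) := by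
            gcongr
        _ = _ := by ring
    have h2 := (dimension_le hc).trans (Nat.pow_le_pow_right (by norm_num) h1)
    have h3 : (8 : ℝ) * (cubeRoot V ^ 2 * bitLength V ^ 2) =
        ((8 * (cubeRoot V ^ 2 * bitLength V ^ 2) : ℕ) : ℝ) := by push_cast; ring
    rw [h3, Real.rpow_natCast]
    exact_mod_cast h2
  -- All three summands are at most a constant times `2 ^ (8y)`; taking `m`-th powers multiplies the
  -- exponent by a constant.
  set y : ℝ := cubeRoot V ^ 2 * bitLength V ^ 2 with hy
  have hr6 : (6 : ℝ) ≤ cubeRoot V := by exact_mod_cast hr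
  have hk2 : (2 : ℝ) ≤ bitLength V := by exact_mod_cast hk
  have hy1 : 1 ≤ y := by rw [hy]; nlinarith [mul_self_nonneg ((bitLength V : ℝ) - 2)]
  have hT' : (T (dimension V) : ℝ) ≤ K * 2 ^ (8 * y) := by
    refine hT.trans ?_
    gcongr
    · norm_num
    · rw [hy]
      have : (0 : ℝ) ≤ cubeRoot V ^ 2 := by positivity
      nlinarith
  have hK : (K : ℝ) + 2 ≤ 2 ^ ((K : ℝ) + 2) := by
    have : K + 2 < 2 ^ (K + 2) := Nat.lt_two_pow_self
    have h2 : ((K + 2 : ℕ) : ℝ) ≤ ((2 ^ (K + 2) : ℕ) : ℝ) := by exact_mod_cast this.le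
    push_cast at h2
    rw [show ((K : ℝ) + 2) = ((K + 2 : ℕ) : ℝ) by push_cast; ring, Real.rpow_natCast]
    push_cast
    exact h2
  rw [one_mul, one_mul, Real.norm_of_nonneg (by positivity), Real.norm_of_nonneg (by positivity)]
  have hbase : ((a * (v + 1) ^ 2 + dimension V + T (dimension V) : ℕ) : ℝ) ≤
      2 ^ ((K + 16) * y) := by
    have h1 : ((a * (v + 1) ^ 2 : ℕ) : ℝ) ≤ dimension V := by exact_mod_cast ha.trans_eq (mul_one _)
    calc ((a * (v + 1) ^ 2 + dimension V + T (dimension V) : ℕ) : ℝ)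
        = ((a * (v + 1) ^ 2 : ℕ) : ℝ) + dimension V + T (dimension V) := by push_cast; ring
      _ ≤ 2 ^ (8 * y) + 2 ^ (8 * y) + K * 2 ^ (8 * y) := by
        gcongr
        exact h1.trans hd
      _ = (K + 2) * 2 ^ (8 * y) := by ring
      _ ≤ 2 ^ ((K : ℝ) + 2) * 2 ^ (8 * y) := by gcongr
      _ = 2 ^ ((K : ℝ) + 2 + 8 * y) := (Real.rpow_add (by norm_num) _ _).symm
      _ ≤ 2 ^ ((K + 16) * y) := by
        refine Real.rpow_le_rpow_of_exponent_le (by norm_num) ?_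
        have : (0 : ℝ) ≤ K := by positivity
        nlinarith
  push_cast at hbase ⊢
  calc _ ≤ ((2 : ℝ) ^ ((K + 16) * y)) ^ m := by gcongr
    _ = 2 ^ ((K + 16) * y * m) := by rw [Real.rpow_mul_natCast (by norm_num)]
    _ ≤ 2 ^ ((v : ℝ) / Real.logb 2 v) := by
      refine Real.rpow_le_rpow_of_exponent_le (by norm_num) ?_
      refine le_trans ?_ (div_le_div_of_nonneg_left (by positivity) hpos hlog)
      rw [le_div_iff₀ (by positivity)]
      -- The factor 2 in the bound for `V = v + v₀` pays for replacing `V ≤ 2v` by `v`.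
      have h1 : m * (K + 16) * (cubeRoot V ^ 2 * bitLength V ^ 3) ≤ v := by
        have : 2 * (m * (K + 16)) * (cubeRoot V ^ 2 * bitLength V ^ 3) =
          2 * (m * (K + 16) * (cubeRoot V ^ 2 * bitLength V ^ 3)) := by ring
        omega
      have h2 : ((m * (K + 16) * (cubeRoot V ^ 2 * bitLength V ^ 3) : ℕ) : ℝ) ≤ v := by
        exact_mod_cast h1
      push_cast at h2
      refine le_trans (le_of_eq ?_) h2
      rw [hy]; ring

end RL

namespace Machine

open ThreeSat RL

/-! ## The algorithm for `Unique-3-SAT` -/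

/-- Raise a flag if the query mentions a satisfying assignment. -/
def mark {v : ℕ} (φ : CNF v) (B V : ℕ) (f q : Str) : Str :=
  bif decide (q.tail.tail.tail.length = 1 + B + V) &&
    (firstFalse φ (SearchState.ofStr B V q.tail.tail.tail).assign).isNone then [true] else f

/-- Whether the flag has been raised or the actions lead to a satisfying assignment. -/
def verdict {v : ℕ} (φ : CNF v) (B V : ℕ) (f as : Str) : Bool :=
  f.headD false || (firstFalse φ ((SearchState.origin B V).follow φ as).assign).isNone

namespace CompData

section

variable {X : Type} {Vs : List (X → Str)} {S : X → ℕ} {v B V r : X → ℕ} {φ : ∀ x, CNF (v x)}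

/-- The number of variables is read in unary from the leading ones of the code; the constant `v₀`
and the parameters derived from the sum are then computed in unary too. -/
theorem of_formula (v₀ : ℕ) (hφ : Comp Vs S (fun x => encCNF (φ x)))
    (hd : Bd S (fun x => dimension (v x + v₀))) :
    CompData Vs S v (fun x => counterLength (v x + v₀)) (fun x => v x + v₀)
      (fun x => cubeRoot (v x + v₀)) φ := by
  have hV : Comp Vs S (fun x => List.replicate (v x + v₀) true) :=
    (Comp.append (Comp.takeWhile hφ) (Comp.const (List.replicate v₀ true))).congr fun x => by
      rw [encCNF_eq, takeWhile_replicate_append, List.replicate_add]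
  have hr := Comp.cubeRoot hV
  simp only [List.length_replicate] at hr
  refine ⟨hφ, (Comp.mul (Comp.binary hV) hr).congr fun x => ?_, hV,
    (Comp.append hr hr).congr fun x => ?_, hd⟩
  · simp only [List.length_replicate]; rfl
  · rw [← List.replicate_add, two_mul]

/-- Dimension and horizon have to be written in unary; powers are obtained as lengths of tensor
powers, and `hB` and `D.dim` allow for their size. -/
theorem input (D : CompData Vs S v B V r φ) (hB : Bd S (fun x => 2 ^ B x)) :
    Comp Vs S (fun x => (formulaMDP (φ x) (B x) (V x) (r x)).input
      ((2 + B x + 3 * V x) ^ (2 * r x))) := by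
  have h2 : Comp Vs S (fun x => List.replicate (2 * 2 ^ B x) true) :=
    (Comp.mul (Comp.const [true, true]) (Comp.tpow (Comp.const [true, true]) D.bits (by
      simpa using hB))).congr fun x => by
        rw [length_tpow, List.length_replicate]; rfl
  have hn := Comp.cons true (Comp.cons true (Comp.append D.bits (Comp.append D.vars
    (Comp.append D.vars D.vars))))
  have en : ∀ x, (true :: true :: (List.replicate (B x) true ++ (List.replicate (V x) true ++
      (List.replicate (V x) true ++ List.replicate (V x) true)))).length = 2 + B x + 3 * V x :=
    fun x => by simp; ring
  have hd : Comp Vs S (fun x => List.replicate ((2 + B x + 3 * V x) ^ (2 * r x)) true) :=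
    (Comp.replicate true (Comp.tpow hn D.power (D.dim.mono fun x => by
      rw [en, List.length_replicate]))).congr fun x => by
        rw [length_tpow, en, List.length_replicate]
  refine (Comp.append (Comp.append (Comp.append hd (Comp.const [false]))
    (Comp.append h2 (Comp.const [false]))) (D.ofStr (Comp.const [])).code).congr fun x => ?_
  rw [SearchState.ofStr_nil]
  rfl

theorem mark (D : CompData Vs S v B V r φ) {f q : X → Str} (hf : Comp Vs S f)
    (hq : Comp Vs S q) : Comp Vs S (fun x => Machine.mark (φ x) (B x) (V x) (f x) (q x)) := by
  have hx := Comp.tail (Comp.tail (Comp.tail hq))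
  refine (Comp.cond (Comp.and (Comp.lenEq hx (Comp.cons true (Comp.append D.bits D.vars)))
    ((D.ofStr hx).isNone_firstFalse D)) (Comp.const [true]) hf).congr fun x => ?_
  simp only [List.length_replicate, List.length_cons, List.length_append]
  rw [show B x + V x + 1 = 1 + B x + V x by ring]
  rfl

theorem verdict (hVs : ∀ g ∈ Vs, Bd S (fun x => (g x).length)) (D : CompData Vs S v B V r φ)
    {f q : X → Str} (hf : Comp Vs S f) (hq : Comp Vs S q) :
    Comp Vs S (fun x => [Machine.verdict (φ x) (B x) (V x) (f x) (q x)]) :=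
  Comp.or (Comp.headD hf) ((D.follow hVs hq).isNone_firstFalse D)

end

end CompData

/-- The size of a formula and of its decision process. -/
def formulaSize (v₀ : ℕ) (x : Σ v, CNF v) : ℕ := (encCNF x.2).length + dimension (x.1 + v₀)

/-- The variables of the parts of the algorithm: the formula, the flag, and a string. -/
abbrev algorithmVars : List ((Σ v, CNF v) × Str × Str → Str) :=
  [fun y => encCNF y.1.2, fun y => y.2.1, fun y => y.2.2]

/-- The size of these variables. -/
abbrev algorithmSize (v₀ : ℕ) (y : (Σ v, CNF v) × Str × Str) : ℕ :=
  formulaSize v₀ y.1 + y.2.1.length + y.2.2.length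

theorem bd_algorithmVars (v₀ : ℕ) :
    ∀ g ∈ algorithmVars, Bd (algorithmSize v₀) (fun y => (g y).length) := by
  simp only [List.mem_cons, List.not_mem_nil, or_false]
  rintro g (rfl | rfl | rfl) <;>
    exact Bd.self.mono fun _ => by simp only [algorithmSize, formulaSize]; omega

theorem compData_algorithm (v₀ : ℕ) :
    CompData algorithmVars (algorithmSize v₀) (fun y => y.1.1)
      (fun y => counterLength (y.1.1 + v₀)) (fun y => y.1.1 + v₀) (fun y => cubeRoot (y.1.1 + v₀))
      (fun y => y.1.2) :=
  .of_formula v₀ (.var 0 rfl (bd_algorithmVars v₀ _ (by simp)))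
    (Bd.self.mono fun _ => by simp only [algorithmSize, formulaSize]; omega)

theorem comp_flag (v₀ : ℕ) : Comp algorithmVars (algorithmSize v₀) (fun y => y.2.1) :=
  .var 1 rfl (bd_algorithmVars v₀ _ (by simp))

theorem comp_string (v₀ : ℕ) : Comp algorithmVars (algorithmSize v₀) (fun y => y.2.2) :=
  .var 2 rfl (bd_algorithmVars v₀ _ (by simp))

/-- Computations within a simulation. -/
theorem Comp.exists_prog {v₀ : ℕ} {G : (Σ v, CNF v) × Str × Str → Str}
    (hG : Comp algorithmVars (algorithmSize v₀) G) (m i j : ℕ) :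
    ∃ (P : Prog) (k : ℕ), i < m → j < m + 2 → ∀ x f σ, (∀ i, m ≤ i → σ i = []) →
      ∃ t ≤ (formulaSize v₀ x + f.length + (σ i).length + 2) ^ k +
          2 * (sim (encCNF x.2) f σ j).length,
        Runs P (sim (encCNF x.2) f σ)
          (Function.update (sim (encCNF x.2) f σ) j (G (x, f, σ i))) t := by
  by_cases h : i < m ∧ j < m + 2
  · obtain ⟨P, τ, ⟨k, hk⟩, hP⟩ := hG.prog (m + 2) [0, 1, i + 2] j
      (by simp only [List.mem_cons, List.not_mem_nil, or_false]; omega) h.2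
    refine ⟨P, k, fun _ _ x f σ hσ => ?_⟩
    obtain ⟨t, ht, hr⟩ := hP (x, f, σ i) (sim (encCNF x.2) f σ) (fun a ha => by
      obtain ⟨a, rfl⟩ : ∃ a', a = a' + 2 := ⟨a - 2, by omega⟩
      exact hσ a (by omega)) rfl
    exact ⟨t, ht.trans (Nat.add_le_add_right (hk _) _), hr⟩
  · exact ⟨.skip 0, 0, fun hi hj => absurd ⟨hi, hj⟩ h⟩

theorem outputProb_eq {O : Oracle} {p : Prog} {x : Str} {n : ℕ} (h : HaltsWithin O p x n)
    (A : Str → Prop) :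
    outputProb O p x n A = haltProb O n (initial p x) (fun σ => A (σ 0)) := by
  rw [outputProb, output, haltProb, PMF.toOuterMeasure_map_apply]
  refine PMF.toOuterMeasure_apply_eq_of_inter_support_eq _ ?_
  ext c
  simp only [Set.mem_inter_iff, Set.mem_preimage, Set.mem_ofPred_eq]
  exact ⟨fun hc => ⟨⟨h c hc.2, hc.1⟩, hc.2⟩, fun hc => ⟨hc.1.2, hc.2⟩⟩

theorem sim_initial (x : Str) : Function.update (fun _ => []) 0 x = sim x [] (fun _ => []) := by
  funext i
  rcases i with _ | _ | i <;> simp [sim]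

theorem run_seq_seq {p q r : Prog} {σ σ' : Store} {t : ℕ} (h : Runs p σ σ' t) (N : ℕ) :
    run noOracle (t + 2 + N) ⟨[.seq p (.seq q r)], σ⟩ = run noOracle N ⟨[q, r], σ'⟩ := by
  rw [show t + 2 + N = (t + (N + 1)) + 1 by ring,
    run_succ_of_step (c' := ⟨[p, .seq q r], σ⟩) rfl, h, run_succ_of_step rfl]

theorem length_encCNF_le {v : ℕ} (φ : CNF v) :
    (encCNF φ).length ≤ v + 2 + φ.length * (4 * (v + 1)) := by
  have hl : ∀ l : Literal v, (encLiteral l).length ≤ v + 1 := fun l => by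
    have := l.1.2
    simp [encLiteral, encUnary]
  have hc : (encClauses φ).length ≤ φ.length * (4 * (v + 1)) + 1 := by
    induction φ with
    | nil => simp [encClauses]
    | cons C φ ih =>
      have h1 := hl C.1
      have h2 := hl C.2.1
      have h3 := hl C.2.2
      rw [encClauses_cons, List.length_cons, List.length_append, List.length_cons, add_mul,
        encClause, List.length_append, List.length_append]
      omega
  rw [encCNF_eq, List.length_append, List.length_replicate, List.length_cons]
  omega

end Machine

/-! ### The reduction and its correctness -/

namespace Machine

open ThreeSat RL

/-- The decision process of a formula, for the chosen parameters. -/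
noncomputable abbrev instanceMDP (v₀ : ℕ) (x : Σ v, CNF v) : MDP :=
  formulaMDP x.2 (counterLength (x.1 + v₀)) (x.1 + v₀) (cubeRoot (x.1 + v₀))

noncomputable abbrev instanceFeatures (v₀ : ℕ) (x : Σ v, CNF v) :
    (instanceMDP v₀ x).Features (dimension (x.1 + v₀)) :=
  formulaFeatures x.2 (counterLength (x.1 + v₀)) (x.1 + v₀) (cubeRoot (x.1 + v₀))

noncomputable abbrev instanceOracle (v₀ : ℕ) (x : Σ v, CNF v) : Oracle :=
  (instanceMDP v₀ x).oracle (instanceFeatures v₀ x)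

noncomputable abbrev instanceInput (v₀ : ℕ) (x : Σ v, CNF v) : Str :=
  (instanceMDP v₀ x).input (dimension (x.1 + v₀))

noncomputable abbrev instanceAnswer (v₀ : ℕ) (x : Σ v, CNF v) (q : Str) : Str :=
  formulaMDP.answer x.2 (counterLength (x.1 + v₀)) (x.1 + v₀) (cubeRoot (x.1 + v₀)) q

abbrev instanceMark (v₀ : ℕ) (x : Σ v, CNF v) (f q : Str) : Str :=
  mark x.2 (counterLength (x.1 + v₀)) (x.1 + v₀) f q

abbrev instanceVerdict (v₀ : ℕ) (x : Σ v, CNF v) (f as : Str) : Bool :=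
  verdict x.2 (counterLength (x.1 + v₀)) (x.1 + v₀) f as

theorem mark_cases {v : ℕ} (φ : CNF v) (B V : ℕ) (f q : Str) :
    mark φ B V f q = f ∨ mark φ B V f q = [true] := by
  rw [mark]
  cases decide (q.tail.tail.tail.length = 1 + B + V) &&
    (firstFalse φ (SearchState.ofStr B V q.tail.tail.tail).assign).isNone
  · exact Or.inl rfl
  · exact Or.inr rfl

theorem mark_code {v B V : ℕ} {φ : CNF v} {s : SearchState B V}
    (h : firstFalse φ s.assign = none) {q : Str} (hq : q.drop 3 = s.code) (f : Str) :
    mark φ B V f q = [true] := by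
  have : q.tail.tail.tail = s.code := by
    rw [← hq]; rcases q with _ | ⟨_, _ | ⟨_, _ | ⟨_, _⟩⟩⟩ <;> rfl
  rw [mark, this, SearchState.ofStr_code, h, s.length_code]
  simp

theorem isNone_firstFalse_of_not_satisfiable {v : ℕ} {φ : CNF v} (h : ¬ Satisfiable φ) (w : Str) :
    (firstFalse φ w).isNone = false := by
  by_contra hne
  rw [Bool.not_eq_false, Option.isNone_iff_eq_none] at hne
  exact h ⟨_, (satisfies_iff φ w).mpr hne⟩

/-- The parts of the algorithm. -/
theorem exists_simulation (v₀ m : ℕ) :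
    ∃ (A : ℕ → ℕ → Prog) (k : ℕ), ∀ x L M,
      2 * ((formulaSize v₀ x + L + 3) ^ k + L) + 3 ≤ M → x.1 + v₀ ≠ 0 →
      cubeRoot (x.1 + v₀) ≠ 0 →
      Simulation (instanceOracle v₀ x) m (encCNF x.2) L (7 * dimension (x.1 + v₀) + 1) M A
        (instanceAnswer v₀ x) (instanceMark v₀ x) := by
  have D := compData_algorithm v₀
  choose PF kF hF using fun i =>
    (D.mark (comp_flag v₀) (comp_string v₀)).exists_prog m i 1
  choose PA kA hA using fun i j => (D.answer (comp_string v₀)).exists_prog m i (j + 2)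
  -- One exponent for the finitely many pairs of registers.
  set k := ∑ i ∈ Finset.range m, (kF i + ∑ j ∈ Finset.range m, kA i j) with hk
  have hki : ∀ i < m, kF i + ∑ j ∈ Finset.range m, kA i j ≤ k := fun i hi =>
    Finset.single_le_sum (f := fun i => kF i + ∑ j ∈ Finset.range m, kA i j)
      (fun _ _ => Nat.zero_le _) (Finset.mem_range.mpr hi)
  have hkij : ∀ i, ∀ j < m, kA i j ≤ ∑ j ∈ Finset.range m, kA i j := fun i j hj =>
    Finset.single_le_sum (f := fun j => kA i j) (fun _ _ => Nat.zero_le _)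
      (Finset.mem_range.mpr hj)
  -- The flag comes first: the answer may overwrite the register that contains the query.
  refine ⟨fun i j => .seq (PF i) (PA i j), k, fun x L M hM hV hr => ⟨fun q =>
    formulaMDP.answer_mem_support (Nat.le_add_right _ _) hr q, fun q =>
    (formulaMDP.length_answer rfl hr q).trans (Nat.le_succ _), Nat.le_add_left _ _,
    fun i hi j hj σ f hf hσ hL => ?_⟩⟩
  have hpow : ∀ (f q : Str) (l : ℕ), f.length ≤ 1 → q.length ≤ L → l ≤ k →
      (formulaSize v₀ x + f.length + q.length + 2) ^ l ≤ (formulaSize v₀ x + L + 3) ^ k :=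
    fun f q l hf hq hl => (Nat.pow_le_pow_left (by omega) l).trans
      (Nat.pow_le_pow_right (by omega) hl)
  have hf' : (instanceMark v₀ x f (σ i)).length ≤ 1 := by
    rcases mark_cases x.2 (counterLength (x.1 + v₀)) (x.1 + v₀) f (σ i) with h | h
    · exact (congrArg List.length h).trans_le hf
    · exact (congrArg List.length h).le
  obtain ⟨t, ht, hr⟩ := hF i hi (by omega) x f σ hσ
  rw [update_sim_one] at hr
  obtain ⟨t', ht', hr'⟩ := hA i j hi (by omega) x (instanceMark v₀ x f (σ i)) σ hσ
  rw [update_sim] at hr'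
  refine ⟨_, ?_, hr.seq hr'⟩
  have h1 := hpow f (σ i) (kF i) hf (hL i) ((Nat.le_add_right _ _).trans (hki i hi))
  have h2 := hpow _ (σ i) (kA i j) hf' (hL i)
    ((hkij i j hj).trans ((Nat.le_add_left _ _).trans (hki i hi)))
  have h3 : (sim (encCNF x.2) f σ 1).length = f.length := rfl
  have h4 : (sim (encCNF x.2) (instanceMark v₀ x f (σ i)) σ (j + 2)).length = (σ j).length := rfl
  have h5 := hL j
  omega

/-- A program for `Linear-2-RL` yields a program for `3-SAT`. -/
theorem exists_reduction {p : Prog} {T : ℕ → ℕ} {v₀ : ℕ}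
    (hp : ∀ (d : ℕ) (M : MDP) (ψ : M.Features d), M.IsInstance 8 d ψ →
      HaltsWithin (M.oracle ψ) p (M.input d) (T d) ∧
      1 - 1 / 10 ≤ outputProb (M.oracle ψ) p (M.input d) (T d) M.IsGood)
    (hv₀ : ∀ V ≥ v₀, V ≠ 0 ∧
      (cubeRoot V : ℝ) * ((V + 1) / 2 ^ counterLength V) ≤ 1 / 4 ∧
      (((V : ℝ) + 3) / 2 ^ counterLength V) ^ cubeRoot V ≤ 1 / 4 ∧
      T (dimension V) * (((V : ℝ) + 3) / 2 ^ counterLength V) ^ cubeRoot V ≤ 1 / 40) :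
    ∃ (P : Prog) (k : ℕ), ∀ (x : Σ v, CNF v) (N : ℕ),
      ((encCNF x.2).length + dimension (x.1 + v₀) + T (dimension (x.1 + v₀)) + 2) ^ k ≤ N →
      HaltsWithin noOracle P (encCNF x.2) N ∧
      (Satisfiable x.2 → 1 - 1 / 8 ≤ outputProb noOracle P (encCNF x.2) N (· = [true])) ∧
      (¬ Satisfiable x.2 → outputProb noOracle P (encCNF x.2) N (· = [false]) = 1) := by
  -- The bound is made positive so that register 0, which carries input and output, is among the
  -- simulated ones.
  obtain ⟨m, hm⟩ : ∃ m, p.Below (m + 1) := p.exists_below.imp fun m h => h.mono (Nat.le_succ m)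
  have hV : ∀ x : Σ v, CNF v, x.1 + v₀ ≥ v₀ := fun x => Nat.le_add_left _ _
  have hr0 : ∀ x : Σ v, CNF v, cubeRoot (x.1 + v₀) ≠ 0 := fun x =>
    Nat.one_le_iff_ne_zero.mp (one_le_cubeRoot _)
  have D := compData_algorithm v₀
  have hin : Comp algorithmVars (algorithmSize v₀) (fun y => instanceInput v₀ y.1) :=
    D.input (Bd.self.mono fun y => by
      have := two_pow_counterLength_le (hv₀ _ (hV y.1)).1
      simp only [algorithmSize, formulaSize]
      omega)
  -- The algorithm: `P₁` writes the input into the simulated register 0, which is register 2; then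
  -- the simulation runs; then `P₃` writes the verdict into the true register 0.
  obtain ⟨P₁, k₁, h₁⟩ := hin.exists_prog (m + 1) 0 2
  obtain ⟨A, k₂, h₂⟩ := exists_simulation v₀ (m + 1)
  obtain ⟨P₃, k₃, h₃⟩ := (D.verdict (bd_algorithmVars v₀) (comp_flag v₀)
    (comp_string v₀)).exists_prog (m + 1) 0 0
  -- No register gets longer than the input plus one answer length per step.
  let L : (Σ v, CNF v) → ℕ := fun x => (instanceInput v₀ x).length +
    T (dimension (x.1 + v₀)) * (7 * dimension (x.1 + v₀) + 1)
  let M : (Σ v, CNF v) → ℕ := fun x => 2 * ((formulaSize v₀ x + L x + 3) ^ k₂ + L x) + 3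
  let Tf : (Σ v, CNF v) → ℕ := fun x =>
    (formulaSize v₀ x + L x + 3) ^ k₃ + 2 * (encCNF x.2).length
  let Z : (Σ v, CNF v) → ℕ := fun x =>
    (encCNF x.2).length + dimension (x.1 + v₀) + T (dimension (x.1 + v₀))
  have hbd : Bd Z (fun x => (formulaSize v₀ x + 2) ^ k₁ + 2 +
      (T (dimension (x.1 + v₀)) * (M x + 1) + Tf x)) := by
    have hS : Bd Z (formulaSize v₀) := Bd.self.mono fun x => Nat.le_add_right _ _
    have hE : Bd Z (fun x => (encCNF x.2).length) := Bd.self.mono fun x => by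
      simp only [Z]; omega
    have hd : Bd Z (fun x => dimension (x.1 + v₀)) := Bd.self.mono fun x => by
      simp only [Z]; omega
    have hT : Bd Z (fun x => T (dimension (x.1 + v₀))) := Bd.self.mono fun x => by
      simp only [Z]; omega
    have hI : Bd Z (fun x => (instanceInput v₀ x).length) :=
      hin.bd.comp (fun x => (x, [], [])) (hS.mono fun x => by simp [algorithmSize])
    have hL : Bd Z L := hI.add (hT.mul (((Bd.const 7).mul hd).add (Bd.const 1)))
    have hpow : ∀ {f : (Σ v, CNF v) → ℕ}, Bd Z f → ∀ k, Bd Z (fun x => (f x + 2) ^ k) :=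
      fun hf k => hf.trans (τ'' := fun x => (_ + 2) ^ k) ⟨k, fun _ => le_rfl⟩
    have hSL : Bd Z (fun x => formulaSize v₀ x + L x + 1) := (hS.add hL).add (Bd.const 1)
    have hM : Bd Z M := ((Bd.const 2).mul ((hpow hSL k₂).add hL)).add (Bd.const 3)
    exact ((hpow hS k₁).add (Bd.const 2)).add ((hT.mul (hM.add (Bd.const 1))).add
      ((hpow hSL k₃).add ((Bd.const 2).mul hE)))
  obtain ⟨k, hk⟩ := hbd
  refine ⟨.seq P₁ (.seq (p.translate A) P₃), k, fun x N hN => ?_⟩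
  obtain ⟨hV0, hp1, hp2, hp3⟩ := hv₀ _ (hV x)
  have hN : (formulaSize v₀ x + 2) ^ k₁ + 2 +
      (T (dimension (x.1 + v₀)) * (M x + 1) + Tf x) ≤ N := (hk x).trans hN
  have hI := formulaMDP.isInstance (φ := x.2) (Nat.le_add_right x.1 v₀) (hr0 x)
    (two_pow_counterLength_le hV0)
  obtain ⟨hhalt, hprob⟩ := hp _ _ _ hI
  have Sim := h₂ x (L x) (M x) le_rfl hV0 (hr0 x)
  have rest : ∀ (σ : Store) f, f.length ≤ 1 → (∀ i, m + 1 ≤ i → σ i = []) →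
      (∀ i, (σ i).length ≤ L x) → ∃ t ≤ Tf x, ∃ σ', Runs P₃ (sim (encCNF x.2) f σ) σ' t ∧
        σ' 0 = [instanceVerdict v₀ x f (σ 0)] := by
    intro σ f hf hσ hL
    obtain ⟨t, ht, hr⟩ := h₃ (by omega) (by omega) x f σ hσ
    refine ⟨t, ht.trans ?_, _, hr, Function.update_self _ _ _⟩
    refine Nat.add_le_add_right (Nat.pow_le_pow_left ?_ _) _
    have := hL 0
    omega
  obtain ⟨t₁, ht₁, hr₁⟩ := h₁ (by omega) (by omega) x [] (fun _ => []) (fun _ _ => rfl)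
  rw [show (2 : ℕ) = 0 + 2 from rfl, update_sim] at hr₁
  have ht₁ : t₁ ≤ (formulaSize v₀ x + 2) ^ k₁ := by simpa [sim] using ht₁
  obtain ⟨N', rfl⟩ : ∃ N', N = t₁ + 2 + N' := ⟨N - (t₁ + 2), by omega⟩
  have hN' : T (dimension (x.1 + v₀)) * (M x + 1) + Tf x ≤ N' := by omega
  set σ₀ : Store := Function.update (fun _ => []) 0 (instanceInput v₀ x) with hσ₀
  have hrun : run noOracle (t₁ + 2 + N')
        (initial (.seq P₁ (.seq (p.translate A) P₃)) (encCNF x.2)) =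
      run noOracle N' ⟨[p].map (Prog.translate A) ++ [P₃], sim (encCNF x.2) [] σ₀⟩ := by
    rw [initial, sim_initial, run_seq_seq hr₁]
    rfl
  have hbelow : ∀ q ∈ [p], q.Below (m + 1) := by
    simpa using hm
  have hσm : ∀ i, m + 1 ≤ i → σ₀ i = [] := fun i hi => Function.update_of_ne (by omega) _ _
  have hσL : ∀ i, (σ₀ i).length +
      T (dimension (x.1 + v₀)) * (7 * dimension (x.1 + v₀) + 1) ≤ L x := by
    intro i
    rcases eq_or_ne i 0 with rfl | hi
    · rw [hσ₀, Function.update_self]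
    · rw [hσ₀, Function.update_of_ne hi]
      exact Nat.add_le_add_right (Nat.zero_le _) _
  have hlen : ∀ f : Str, f = [] ∨ f = [true] → f.length ≤ 1 := by
    rintro f (rfl | rfl) <;> simp
  have hhalts : HaltsWithin noOracle (.seq P₁ (.seq (p.translate A) P₃)) (encCNF x.2)
      (t₁ + 2 + N') := by
    intro e he
    rw [hrun] at he
    refine (Sim.support (fun f => f = [] ∨ f = [true]) hlen
      (fun f q hf => (mark_cases x.2 _ _ f q).elim
        (fun h => (congrArg (fun f => f = [] ∨ f = [true]) h).mpr hf) Or.inr) P₃ (Tf x)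
      (fun _ => True) (fun σ f hf hσ hL => ?_) _ [p] σ₀ [] N' hbelow (Or.inl rfl) hσm hσL hhalt hN'
      e he).1
    obtain ⟨t, ht, σ', hr, -⟩ := rest σ f (hlen f hf) hσ hL
    exact ⟨t, ht, σ', hr, trivial⟩
  refine ⟨hhalts, fun hs => ?_, fun hs => ?_⟩
  · rw [outputProb_eq hhalt] at hprob
    have key := Sim.haltProb_le
      (ENNReal.ofReal
        ((((x.1 + v₀ : ℕ) + 3 : ℝ) / 2 ^ counterLength (x.1 + v₀)) ^ cubeRoot (x.1 + v₀)))
      (fun q => by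
        rcases formulaMDP.one_le_answer_add (φ := x.2) (B := counterLength (x.1 + v₀))
          (r := cubeRoot (x.1 + v₀)) (Nat.le_add_right x.1 v₀) q with ⟨s, hq, hs⟩ | h
        · exact Or.inl (mark_code hs hq)
        · exact Or.inr h)
      (fun f q => mark_cases _ _ _ f q) P₃ (Tf x) (fun σ => (instanceMDP v₀ x).IsGood (σ 0))
      (fun σ => σ 0 = [true]) (fun σ f hf hσ hL => ?_) _ [p] σ₀ [] N' hbelow (Or.inl rfl) hσm hσL
      hhalt hN'
    · rw [outputProb_eq hhalts, haltProb, hrun]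
      change _ ≤ haltProb noOracle N' _ (fun σ => σ 0 = [true])
      have hε : (T (dimension (x.1 + v₀)) : ℝ≥0∞) * ENNReal.ofReal
          ((((x.1 + v₀ : ℕ) + 3 : ℝ) / 2 ^ counterLength (x.1 + v₀)) ^ cubeRoot (x.1 + v₀)) ≤
          1 / 40 := by
        rw [← ENNReal.ofReal_natCast, ← ENNReal.ofReal_mul (by positivity)]
        refine (ENNReal.ofReal_le_ofReal hp3).trans ?_
        rw [ENNReal.ofReal_div_of_pos (by norm_num)]
        simp
      -- Adding up the errors: `1/10 + 1/40 = 1/8`.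
      have h1 := tsub_le_iff_right.mp ((hprob.trans key).trans (add_le_add_right hε _))
      rw [tsub_le_iff_right]
      refine h1.trans_eq ?_
      rw [add_assoc]
      congr 1
      rw [← ENNReal.toReal_eq_toReal_iff' (by finiteness) (by finiteness),
        ENNReal.toReal_add (by finiteness) (by finiteness)]
      simp
      norm_num
    · obtain ⟨t, ht, σ', hr, hσ'⟩ := rest σ f (hlen f hf) hσ hL
      refine ⟨t, ht, σ', hr, fun h => ?_⟩
      rw [hσ', instanceVerdict, verdict]
      rcases h with rfl | h
      · rfl
      · have := formulaMDP.firstFalse_of_isGood hs (Nat.le_add_right _ _) (hr0 x) hp1 hp2 h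
        have h2 : firstFalse x.2 ((SearchState.origin (counterLength (x.1 + v₀)) (x.1 + v₀)).follow
          x.2 (σ 0)).assign = none := this
        rw [h2]
        simp
  · rw [outputProb_eq hhalts, haltProb, hrun, PMF.toOuterMeasure_apply_eq_one_iff]
    -- Without satisfying assignments the flag is never raised and the final check fails, whatever
    -- the coins are.
    refine Sim.support (fun f => f = []) (fun f hf => hlen f (Or.inl hf))
      (fun f q hf => ?_) P₃ (Tf x) (fun σ => σ 0 = [false]) (fun σ f hf hσ hL => ?_) _ [p] σ₀ [] N'
      hbelow rfl hσm hσL hhalt hN'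
    · rw [instanceMark, mark, isNone_firstFalse_of_not_satisfiable hs, Bool.and_false, hf]
      rfl
    · obtain ⟨t, ht, σ', hr, hσ'⟩ := rest σ f (hlen f (Or.inl hf)) hσ hL
      refine ⟨t, ht, σ', hr, ?_⟩
      rw [hσ', instanceVerdict, verdict, isNone_firstFalse_of_not_satisfiable hs, hf]
      rfl

end Machine

theorem proposition3
    (h : RL.LinearTwoRLSolvableInTime
      (fun d : ℕ => (d : ℝ) ^ (Real.logb 2 d / (72 * Real.logb 2 (Real.logb 2 d)))) (1 / 10)) :
    ∃ C : ℝ, ThreeSat.UniqueThreeSatSolvableInTime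
      (fun v : ℕ => (2 : ℝ) ^ (C * (v / Real.logb 2 v))) (1 / 8) := by
  -- 8 is the constant with which the constructed processes are instances.
  obtain ⟨p, T, hT, hp⟩ := h 8
  obtain ⟨K, hK⟩ := RL.eventually_time_le hT
  obtain ⟨v₀, hv₀⟩ := Filter.eventually_atTop.mp (RL.eventually_parameters hK)
  obtain ⟨P, k, hP⟩ := Machine.exists_reduction hp hv₀
  -- The program does not depend on `c`, only the time bound does. As every constant in the exponent
  -- is absorbed by a polylogarithmic gain, `C = 1` is enough.
  refine ⟨1, P, fun c => ⟨fun v => ((4 * c + 4) * (v + 1) ^ 2 + RL.dimension (v + v₀) +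
    T (RL.dimension (v + v₀))) ^ k, RL.isBigO_time hK v₀ (4 * c + 4) k, fun v φ hφ _ =>
    hP ⟨v, φ⟩ _ (Nat.pow_le_pow_left ?_ _)⟩⟩
  have h1 := Machine.length_encCNF_le φ
  have h2 : φ.length * (4 * (v + 1)) ≤ c * v * (4 * (v + 1)) := Nat.mul_le_mul_right _ hφ
  have h3 : v + 2 + c * v * (4 * (v + 1)) + 2 ≤ (4 * c + 4) * (v + 1) ^ 2 := by nlinarith
  dsimp only
  omega
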